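/- Let $n\ge 1$ and $s\in(0,1)$. Let $\Sigma$ be a closed (that is, compact and without boundary) smooth Riemannian manifold of dimension $n$, smoothly embedded into $\mathbb{R}^L$, and let $\mathcal N$ be a closed smooth manifold, smoothly embedded into $\mathbb{R}^M$. For $f\colon\Sigma\to\mathbb{R}^M$ put $$E_{s,\frac ns}(f,\Sigma)=\int_\Sigma\int_\Sigma\frac{|f(x)-f(y)|^{\frac ns}}{|x-y|^{2n}}\,dx\,dy ,$$ where $|x-y|$ is the Euclidean distance in $\mathbb{R}^L$ and $dx$, $dy$ denote the Riemannian volume of $\Sigma$. The norm of $W^{s,\frac ns}(\Sigma,\mathbb{R}^M)$ is $\|f\|_{L^{n/s}(\Sigma)}+E_{s,\frac ns}(f,\Sigma)^{s/n}$, and $W^{s,\frac ns}(\Sigma,\mathcal N)$ is the set of measurable maps $f\colon\Sigma\to\mathcal N\subset\mathbb{R}^M$ for which it is finite. For $u,v\in W^{s,\frac ns}(\Sigma,\mathcal N)$ write $u\sim v$ ($u$ is homotopic to $v$) if for all families $u_\varepsilon,v_\varepsilon\in C^\infty(\Sigma,\mathcal N)$, $\varepsilon>0$, with $u_\varepsilon\to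 u$ and $v_\varepsilon\to v$ in the $W^{s,\frac ns}$-norm as $\varepsilon\to0$, there is an $\varepsilon_0>0$ such that $u_\varepsilon$ and $v_\varepsilon$ are smoothly homotopic as maps $\Sigma\to\mathcal N$ for every $\varepsilon\in(0,\varepsilon_0)$. Let $B(x,r)$ denote the open ball about $x$ of radius $r$ for the geodesic distance of $\Sigma$. Equality of maps on a set is understood almost everywhere. Theorem. Let $x_0\in\Sigma$, let $R>0$, and let $u\in W^{s,\frac ns}(\Sigma,\mathcal N)$ be minimizing in $B(x_0,R)$ in homotopy away from the point $x_0$, that is, assume that for every $\varepsilon>0$ and every $w\in W^{s,\frac ns}(\Sigma,\mathcal N)$ such that $u= w$ on $B(x_0,\varepsilon)\cup(\Sigma\setminus B(x_0,R))$ and $u\sim w$ we have $$E_{s,\frac ns}(u,\Sigma)\le E_{s,\frac ns}(w,\Sigma).$$ Then $u$ is minimizing in homotopy in all of $B(x_0,R)$: for every $v\in W^{s,\frac ns}(\Sigma,\mathcal N)$ such that $u= v$ on $\Sigma\setminus B(x_0,R)$ and $u\sim v$ we have $$E_{s,\frac ns}(u,\Sigma)\le E_{s,\frac ns}(v,\Sigma).$$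 -/

import Mathlib

open MeasureTheory Filter Set Manifold Bundle
open scoped ENNReal Topology ContDiff

noncomputable section

namespace FracHarmonic

/-- The Gagliardo energy `E_{s,p}(f) = ∫_S ∫_S |f x - f y|^p / |e x - e y|^(n + s p) dx dy` of a map
`f` on an `n`-dimensional Riemannian manifold `S` that is embedded by `e` into `ℝ^L`. The measure
`μHE[n]` is the `n`-dimensional Hausdorff measure of the geodesic distance, normalized so that it is
Lebesgue measure on `ℝⁿ`; on a Riemannian `n`-manifold it is the Riemannian volume. -/
def gagliardoEnergy {S : Type*} [EMetricSpace S] [MeasurableSpace S] [BorelSpace S] (n : ℕ) {L : ℕ}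
    (e : S → EuclideanSpace ℝ (Fin L)) (s p : ℝ) {M : ℕ} (f : S → EuclideanSpace ℝ (Fin M)) :
    ℝ≥0∞ :=
  ∫⁻ x, ∫⁻ y, ENNReal.ofReal (‖f x - f y‖ ^ p / ‖e x - e y‖ ^ ((n : ℝ) + s * p))
    ∂(μHE[n] : Measure S) ∂(μHE[n] : Measure S)

/-- The `W^{s,p}` norm `‖f‖_{L^p} + [f]_{W^{s,p}}`, with value `⊤` where it is not finite. -/
def sobolevNorm {S : Type*} [EMetricSpace S] [MeasurableSpace S] [BorelSpace S] (n : ℕ) {L : ℕ}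
    (e : S → EuclideanSpace ℝ (Fin L)) (s p : ℝ) {M : ℕ} (f : S → EuclideanSpace ℝ (Fin M)) :
    ℝ≥0∞ :=
  eLpNorm f (ENNReal.ofReal p) (μHE[n] : Measure S) + gagliardoEnergy n e s p f ^ (1 / p)

/-- `u ∈ W^{s,p}(S, N)`, where the manifold `N` is embedded by `ι` into `ℝ^M`. -/
def MemSobolev {S : Type*} [EMetricSpace S] [MeasurableSpace S] [BorelSpace S] (n : ℕ) {L : ℕ}
    (e : S → EuclideanSpace ℝ (Fin L)) {N : Type*} {M : ℕ} (ι : N → EuclideanSpace ℝ (Fin M))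
    (s p : ℝ) (u : S → N) : Prop :=
  AEStronglyMeasurable (fun x => ι (u x)) (μHE[n] : Measure S) ∧
    sobolevNorm n e s p (fun x => ι (u x)) < ⊤

/-- `f` and `g` are smoothly homotopic: there is a smooth `H` on `[0,1] × S` with values in `N`
such that `H (0, ·) = f` and `H (1, ·) = g`. -/
def SmoothHomotopic (n m : ℕ) {S : Type*} [TopologicalSpace S]
    [ChartedSpace (EuclideanSpace ℝ (Fin n)) S] {N : Type*} [TopologicalSpace N]
    [ChartedSpace (EuclideanSpace ℝ (Fin m)) N] (f g : S → N) : Prop :=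
  ∃ H : ℝ × S → N,
    ContMDiffOn (𝓘(ℝ, ℝ).prod (𝓡 n)) (𝓡 m) ∞ H (Icc (0 : ℝ) 1 ×ˢ (univ : Set S)) ∧
      (∀ x, H (0, x) = f x) ∧ ∀ x, H (1, x) = g x

/-- `(a ε)_{ε > 0}` is a smooth approximation of `u` in `W^{s,p}` as `ε → 0⁺`. -/
def IsSmoothApprox {S : Type*} [EMetricSpace S] [MeasurableSpace S] [BorelSpace S] (n m : ℕ)
    [ChartedSpace (EuclideanSpace ℝ (Fin n)) S] {L : ℕ} (e : S → EuclideanSpace ℝ (Fin L))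
    {N : Type*} [TopologicalSpace N] [ChartedSpace (EuclideanSpace ℝ (Fin m)) N] {M : ℕ}
    (ι : N → EuclideanSpace ℝ (Fin M)) (s p : ℝ) (a : ℝ → S → N) (u : S → N) : Prop :=
  (∀ ε : ℝ, 0 < ε → ContMDiff (𝓡 n) (𝓡 m) ∞ (a ε)) ∧
    Tendsto (fun ε : ℝ => sobolevNorm n e s p (fun x => ι (a ε x) - ι (u x))) (𝓝[>] 0) (𝓝 0)

/-- The relation `u ∼ v` between Sobolev maps: for any smooth approximations `a ε → u` and
`b ε → v` in `W^{s,p}`, the maps `a ε` and `b ε` are smoothly homotopic for all small `ε > 0`. -/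
def SobolevHomotopic {S : Type*} [EMetricSpace S] [MeasurableSpace S] [BorelSpace S] (n m : ℕ)
    [ChartedSpace (EuclideanSpace ℝ (Fin n)) S] {L : ℕ} (e : S → EuclideanSpace ℝ (Fin L))
    {N : Type*} [TopologicalSpace N] [ChartedSpace (EuclideanSpace ℝ (Fin m)) N] {M : ℕ}
    (ι : N → EuclideanSpace ℝ (Fin M)) (s p : ℝ) (u v : S → N) : Prop :=
  ∀ a b : ℝ → S → N, IsSmoothApprox n m e ι s p a u → IsSmoothApprox n m e ι s p b v →
    ∃ ε₀ : ℝ, 0 < ε₀ ∧ ∀ ε : ℝ, 0 < ε → ε < ε₀ → SmoothHomotopic n m (a ε) (b ε)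

end FracHarmonic

end

set_option linter.unusedSectionVars false

namespace FracHarmonic

/-! ### Charts are locally bi-Lipschitz for the geodesic distance -/

section RiemannianCharts

open Metric
open scoped NNReal

attribute [local instance] normedAddCommGroupTangentSpaceVectorSpace
attribute [local instance] normedSpaceTangentSpaceVectorSpace

variable {E : Type*} [NormedAddCommGroup E] [NormedSpace ℝ E]
  {H : Type*} [TopologicalSpace H] (I : ModelWithCorners ℝ E H)
  {S : Type*} [EMetricSpace S] [ChartedSpace H S]
  [RiemannianBundle (fun x : S => TangentSpace I x)] [IsManifold I 1 S]
  [IsContinuousRiemannianBundle E (fun x : S => TangentSpace I x)]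
  [IsRiemannianManifold I S]

/-! Put `p = n / s`, so that `s p = n` and `p > n ≥ 1`. At this critical exponent the energy is
scale invariant and a point has zero capacity: there are cutoffs equal to 1 near `x₀`, supported in
any prescribed ball, of arbitrarily small energy (`exists_cutoff`). This suggests that a competitor
`v` for the full problem can be changed near `x₀`, at arbitrarily small cost, so as to agree with
`u` there. Indeed `exists_glue_sobolevNorm_le` gives `w` with `w = u` on some ball about `x₀`, `w =
v` off a prescribed ball, and `w - v` of Sobolev norm at most `κ`. Since `u ∼ v` and this relation
survives small perturbations of `v` (`exists_ne_zero_forall_sobolevHomotopic`), also `u ∼ w` once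
`κ` is small. Thus `w` is admissible for the hypothesis and `E(u) ≤ E(w)`. Minkowski's inequality
gives `E(w)^(1/p) ≤ E(v)^(1/p) + κ`, and `κ` is arbitrary.

The difficulty is the constraint to `N`: the maps may be discontinuous at `x₀`, and a cutoff between
`u` and `v` leaves `N`. The gluing therefore passes through constants. A map is averaged on an
annulus about `x₀`, at a scale that vanishes at the boundary of the annulus, with a density that is
the same for all points of a middle annulus; the average is then constant there. Its energy is
controlled by that of the map on close pairs of points (`exists_energyOn_avg_le`), which is small by
absolute continuity of the integral. For the same reason averages are close to `N`, and a Lipschitz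
retraction brings them back (`exists_annulus_block`). A map that is constant on an annulus can be
cut there, keeping either its inner or its outer part (`exists_truncation`, `exists_const_near`).

It remains to join the constant obtained from `v` to the one obtained from `u`. A step shorter than
the width of the tubular neighbourhood of `N` is made with a cutoff of small energy followed by the
retraction (`exists_move_value`), and finitely many steps make a chain. A chain exists because `u ∼
v`: smooth approximations of `u` and `v` are homotopic, so their values at `x₀` are joined by a path
(`chained_of_sobolevHomotopic`). Such approximations exist by mollifying in the ambient space and
retracting (`exists_contMDiff_sobolevNorm_le`).

The geometry of the two manifolds enters these energy estimates through Ahlfors regularity of the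
volume for the Euclidean distance (`exists_isAhlfors`) and the smooth nearest point retraction
(`exists_smooth_retraction`). -/

theorem eventually_enorm_mfderivWithin_symm_extChartAt_apply_le (x : S) :
    ∃ C > (0 : ℝ≥0), ∀ᶠ y in 𝓝[range I] (extChartAt I x x), ∀ v : E,
      ‖(mfderiv[range I] (extChartAt I x).symm y v :
        TangentSpace I ((extChartAt I x).symm y))‖ₑ ≤ C * ‖v‖ₑ := by
  rcases eventually_enorm_mfderivWithin_symm_extChartAt_lt I x with ⟨C, C_pos, hC⟩
  refine ⟨C, C_pos, hC.mono fun y hy v => ?_⟩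
  exact (ContinuousLinearMap.le_opENorm _ _).trans (mul_le_mul_left hy.le _)

theorem eventually_enorm_mfderiv_extChartAt_apply_le (x : S) :
    ∃ C > (0 : ℝ≥0), ∀ᶠ y in 𝓝 x, ∀ v : TangentSpace I y,
      ‖(mfderiv% (extChartAt I x) y v : E)‖ₑ ≤ C * ‖v‖ₑ := by
  rcases eventually_enorm_mfderiv_extChartAt_lt I x with ⟨C, C_pos, hC⟩
  refine ⟨C, C_pos, hC.mono fun y hy v => ?_⟩
  exact (ContinuousLinearMap.le_opENorm _ _).trans (mul_le_mul_left hy.le _)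

/-- The inverse of an extended chart is locally Lipschitz for the geodesic distance. -/
theorem eventually_edist_le_edist_extChartAt (x : S) :
    ∃ C : ℝ≥0, ∃ U ∈ 𝓝 x, ∀ y ∈ U, ∀ z ∈ U,
      edist y z ≤ C * edist (extChartAt I x y) (extChartAt I x z) := by
  rcases eventually_enorm_mfderivWithin_symm_extChartAt_apply_le I x with ⟨C, C_pos, hC⟩
  obtain ⟨r, r_pos, hr⟩ : ∃ r > 0,
      ball (extChartAt I x x) r ∩ range I ⊆ (extChartAt I x).target ∩
        {y | ∀ v : E, ‖(mfderiv[range I] (extChartAt I x).symm y v :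
          TangentSpace I ((extChartAt I x).symm y))‖ₑ ≤ C * ‖v‖ₑ} :=
    mem_nhdsWithin_iff.1 (inter_mem (extChartAt_target_mem_nhdsWithin x) hC)
  have A : (extChartAt I x) ⁻¹' (ball (extChartAt I x x) r ∩ range I) ∈ 𝓝 x := by
    apply extChartAt_preimage_mem_nhds_of_mem_nhdsWithin (by simp)
    rw [inter_comm]
    exact inter_mem_nhdsWithin _ (ball_mem_nhds _ r_pos)
  refine ⟨C, _, inter_mem A (chart_source_mem_nhds H x), ?_⟩
  rintro y ⟨hy, h'y⟩ z ⟨hz, h'z⟩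
  rw [IsRiemannianManifold.out (I := I) y z]
  -- The segment joining the chart images stays in the convex set `ball ∩ range I`; lifted by the
  -- inverse chart it is an admissible path of length at most `C` times that of the segment.
  let η := ContinuousAffineMap.lineMap (R := ℝ) (extChartAt I x y) (extChartAt I x z)
  set γ := (extChartAt I x).symm ∘ η
  have hη : Icc 0 1 ⊆ ⇑η ⁻¹' ((extChartAt I x).target ∩
        {y | ∀ v : E, ‖(mfderiv[range I] (extChartAt I x).symm y v :
          TangentSpace I ((extChartAt I x).symm y))‖ₑ ≤ C * ‖v‖ₑ}) := by
    simp only [← image_subset_iff, ContinuousAffineMap.coe_lineMap_eq,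
     ← segment_eq_image_lineMap, η]
    apply Subset.trans _ hr
    exact ((convex_ball _ _).inter I.convex_range).segment_subset hy hz
  simp only [preimage_inter, subset_inter_iff] at hη
  have η_smooth : CMDiff[Icc 0 1] 1 η := by
    apply ContMDiff.contMDiffOn
    rw [contMDiff_iff_contDiff]
    exact ContinuousAffineMap.contDiff _
  have : riemannianEDist I y z ≤ pathELength I γ 0 1 := by
    apply riemannianEDist_le_pathELength _ _ _ zero_le_one
    · exact (contMDiffOn_extChartAt_symm x).comp η_smooth hη.1
    · simp [γ, η, ContinuousAffineMap.coe_lineMap_eq, h'y]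
    · simp [γ, η, ContinuousAffineMap.coe_lineMap_eq, h'z]
  apply this.trans
  rw [← lintegral_fderiv_lineMap_eq_edist, pathELength_eq_lintegral_mfderivWithin_Icc,
    ← lintegral_const_mul' _ _ ENNReal.coe_ne_top]
  apply setLIntegral_mono' measurableSet_Icc (fun t ht ↦ ?_)
  have : mfderiv[Icc 0 1] γ t =
      (mfderiv[range I] (extChartAt I x).symm (η t)) ∘L (mfderiv[Icc 0 1] η t) := by
    apply mfderivWithin_comp
    · exact mdifferentiableWithinAt_extChartAt_symm (hη.1 ht)
    · exact η_smooth.mdifferentiableOn one_ne_zero t ht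
    · exact hη.1.trans (preimage_mono (extChartAt_target_subset_range x))
    · rw [uniqueMDiffWithinAt_iff_uniqueDiffWithinAt]
      exact uniqueDiffOn_Icc zero_lt_one t ht
  have : mfderiv[Icc 0 1] γ t 1 =
      (mfderiv[range I] (extChartAt I x).symm (η t)) (mfderiv[Icc 0 1] η t 1) := congr($this 1)
  rw [this]
  refine (hη.2 ht _).trans (le_of_eq ?_)
  simp only [mfderivWithin_eq_fderivWithin]
  rfl

/-- An extended chart is locally Lipschitz for the geodesic distance. -/
theorem eventually_edist_extChartAt_le_edist (x : S) :
    ∃ C : ℝ≥0, ∃ U ∈ 𝓝 x, ∀ y ∈ U, ∀ z ∈ U,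
      edist (extChartAt I x y) (extChartAt I x z) ≤ C * edist y z := by
  rcases eventually_enorm_mfderiv_extChartAt_apply_le I x with ⟨C, C_pos, hC⟩
  have hsrc := extChartAt_source_mem_nhds (I := I) x
  obtain ⟨ρ, ρ_pos, hρ⟩ := EMetric.mem_nhds_iff.1 (inter_mem hC hsrc)
  have hρ3 : 0 < ρ / 3 := ENNReal.div_pos ρ_pos.ne' (by simp)
  -- With radius `ρ / 3`, a path from `y` of length less than `2ρ / 3` stays in the `ρ`-ball about
  -- `x`, where the derivative of the chart is bounded.
  refine ⟨C, eball x (ρ / 3), eball_mem_nhds x hρ3, fun y hy z hz => ?_⟩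
  have htop : edist y z ≠ ⊤ := by
    refine ne_top_of_lt (b := ⊤) ((edist_triangle_right y z x).trans_lt ?_)
    exact ENNReal.add_lt_top.2 ⟨lt_top_of_lt hy, lt_top_of_lt hz⟩
  have hlt : edist y z < ρ / 3 + ρ / 3 :=
    (edist_triangle_right y z x).trans_lt (ENNReal.add_lt_add hy hz)
  have key : ∀ r : ℝ≥0∞, edist y z < r → r ≤ ρ / 3 + ρ / 3 →
      edist (extChartAt I x y) (extChartAt I x z) ≤ C * r := by
    intro r hr hr2
    rw [IsRiemannianManifold.out (I := I) y z] at hr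
    rcases exists_lt_locally_constant_of_riemannianEDist_lt hr zero_lt_one
      with ⟨γ, hγy, hγz, γ_smooth, hγ, -⟩
    have hin : ∀ t ∈ Icc (0 : ℝ) 1, γ t ∈ eball x ρ := by
      intro t ht
      have h1 : edist y (γ t) ≤ pathELength I γ 0 1 := by
        rw [IsRiemannianManifold.out (I := I) y (γ t)]
        exact (riemannianEDist_le_pathELength γ_smooth.contMDiffOn hγy rfl ht.1).trans
          (pathELength_mono le_rfl ht.2)
      have h2 : edist (γ t) x < (ρ / 3 + ρ / 3) + ρ / 3 := by
        refine (edist_triangle _ y _).trans_lt (ENNReal.add_lt_add ?_ hy)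
        rw [edist_comm]
        exact h1.trans_lt (hγ.trans_le hr2)
      have h3 : ρ / 3 + ρ / 3 + ρ / 3 = ρ := ENNReal.add_thirds ρ
      rwa [h3] at h2
    let γ' := extChartAt I x ∘ γ
    have hC1 : CMDiff[Icc 0 1] 1 γ' :=
      contMDiffOn_extChartAt.comp (I' := I) (t := (chartAt H x).source)
        γ_smooth.contMDiffOn (fun t' ht' ↦ by simpa using (hρ (hin t' ht')).2)
    have : ‖γ' 1 - γ' 0‖ₑ ≤ C * r := by
      calc
        ‖γ' 1 - γ' 0‖ₑ
      _ ≤ ∫⁻ t' in Icc 0 1, ‖derivWithin γ' (Icc 0 1) t'‖ₑ := by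
        apply enorm_sub_le_lintegral_derivWithin_Icc_of_contDiffOn_Icc _ zero_le_one
        rwa [← contMDiffOn_iff_contDiffOn]
      _ = ∫⁻ t' in Icc 0 1, ‖mfderiv[Icc 0 1] γ' t' 1‖ₑ := by
        simp_rw [← fderivWithin_derivWithin, mfderivWithin_eq_fderivWithin]
        rfl
      _ ≤ ∫⁻ t' in Icc 0 1, C * ‖mfderiv[Icc 0 1] γ t' 1‖ₑ := by
        apply setLIntegral_mono' measurableSet_Icc (fun t' ht' ↦ ?_)
        have : mfderiv[Icc 0 1] γ' t' =
            (mfderiv% (extChartAt I x) (γ t')) ∘L (mfderiv[Icc 0 1] γ t') := by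
          apply mfderiv_comp_mfderivWithin
          · refine mdifferentiableAt_extChartAt ?_
            simpa using (hρ (hin t' ht')).2
          · exact (γ_smooth.mdifferentiable one_ne_zero).mdifferentiableOn _ ht'
          · rw [uniqueMDiffWithinAt_iff_uniqueDiffWithinAt]
            exact uniqueDiffOn_Icc zero_lt_one _ ht'
        have : mfderiv[Icc 0 1] γ' t' 1 =
            (mfderiv% (extChartAt I x) (γ t')) (mfderiv[Icc 0 1] γ t' 1) :=
          congr($this 1)
        rw [this]
        exact (hρ (hin t' ht')).1 _
      _ = C * pathELength I γ 0 1 := by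
        rw [lintegral_const_mul' _ _ ENNReal.coe_ne_top,
            pathELength_eq_lintegral_mfderivWithin_Icc]
      _ ≤ C * r := by gcongr
    rw [edist_comm, edist_eq_enorm_sub]
    simpa [γ', hγy, hγz] using this
  by_cases hC0 : edist (extChartAt I x y) (extChartAt I x z) ≤ C * edist y z
  · exact hC0
  push Not at hC0
  -- If the bound failed, there would be room for an `r` strictly above `edist y z`, to which `key`
  -- applies, with `C * r` still below the chart distance.
  have hdiv : edist y z < edist (extChartAt I x y) (extChartAt I x z) / C := by
    rw [ENNReal.lt_div_iff_mul_lt (Or.inl (mod_cast C_pos.ne')) (Or.inl (by simp)), mul_comm]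
    exact hC0
  obtain ⟨r, hr1, hr2⟩ := exists_between (lt_min hdiv hlt)
  have h4 := key r hr1 (hr2.le.trans (min_le_right _ _))
  have h5 : r < edist (extChartAt I x y) (extChartAt I x z) / C := hr2.trans_le (min_le_left _ _)
  rw [ENNReal.lt_div_iff_mul_lt (Or.inl (mod_cast C_pos.ne')) (Or.inl (by simp)), mul_comm] at h5
  exact absurd h4 (not_le.2 h5)

end RiemannianCharts

/-! ### Charts are locally bi-Lipschitz for the Euclidean distance of the embedding -/

section ImmersionCharts

open scoped NNReal

variable {n L : ℕ} {S : Type*} [TopologicalSpace S] [ChartedSpace (EuclideanSpace ℝ (Fin n)) S]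
  [IsManifold (𝓡 n) ∞ S] {e : S → EuclideanSpace ℝ (Fin L)}

/-- An immersion into Euclidean space has a smooth local left inverse in the extended charts. -/
theorem exists_contDiffAt_leftInverse (he : IsImmersion (𝓡 n) (𝓡 L) ∞ e) (x : S) :
    ∃ l : EuclideanSpace ℝ (Fin L) → EuclideanSpace ℝ (Fin n),
      ContDiffAt ℝ ∞ l (e x) ∧ ∀ᶠ y in 𝓝 x, l (e y) = extChartAt (𝓡 n) x y := by
  have h := he.isImmersionAt x
  -- In charts adapted to the immersion, `e` is the inclusion of the first factor, so projecting to
  -- that factor recovers the source coordinate.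
  have hkey : ∀ y ∈ h.domChart.source, (h.equiv.symm (h.codChart (e y))).1 = h.domChart y := by
    intro y hy
    have h1 := h.writtenInCharts
      (show h.domChart y ∈ (h.domChart.extend (𝓡 n)).target by simp [hy])
    simp only [Function.comp_apply, OpenPartialHomeomorph.extend,
      PartialEquiv.coe_trans, OpenPartialHomeomorph.coe_toPartialEquiv, PartialEquiv.coe_trans_symm,
      modelWithCornersSelf_partialEquiv, PartialEquiv.refl_coe, PartialEquiv.refl_symm, id,
      OpenPartialHomeomorph.coe_toPartialEquiv_symm, h.domChart.left_inv hy] at h1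
    rw [h1]; simp
  refine ⟨fun w => extChartAt (𝓡 n) x (h.domChart.symm (h.equiv.symm (h.codChart w)).1), ?_, ?_⟩
  · rw [← contMDiffAt_iff_contDiffAt]
    have h1 : ContMDiffAt (𝓡 L) (𝓡 L) ∞ h.codChart (e x) :=
      contMDiffAt_of_mem_maximalAtlas h.codChart_mem_maximalAtlas h.mem_codChart_source
    have h2 : ContMDiffAt (𝓡 L) (𝓡 n) ∞ (fun w => (h.equiv.symm (h.codChart w)).1) (e x) := by
      have : ContDiff ℝ ∞ (fun w => (h.equiv.symm w).1) := by fun_prop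
      exact (this.contDiffAt.contMDiffAt).comp (e x) h1
    have h3 : ContMDiffAt (𝓡 n) (𝓡 n) ∞ h.domChart.symm (h.equiv.symm (h.codChart (e x))).1 := by
      rw [hkey x h.mem_domChart_source]
      exact contMDiffAt_symm_of_mem_maximalAtlas h.domChart_mem_maximalAtlas
        (h.domChart.map_source h.mem_domChart_source)
    have h4 : ContMDiffAt (𝓡 n) (𝓡 n) ∞ (extChartAt (𝓡 n) x)
        (h.domChart.symm (h.equiv.symm (h.codChart (e x))).1) := by
      rw [hkey x h.mem_domChart_source, h.domChart.left_inv h.mem_domChart_source]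
      exact contMDiffAt_extChartAt
    exact ContMDiffAt.comp (e x) h4 (ContMDiffAt.comp (e x) h3 h2)
  · filter_upwards [h.domChart.open_source.mem_nhds h.mem_domChart_source] with y hy
    rw [hkey y hy, h.domChart.left_inv hy]

/-- The extended charts of a submanifold of Euclidean space are locally Lipschitz for the Euclidean
distance. -/
theorem eventually_edist_extChartAt_le_edist_embedding (he : IsImmersion (𝓡 n) (𝓡 L) ∞ e) (x : S) :
    ∃ C : ℝ≥0, ∃ U ∈ 𝓝 x, ∀ y ∈ U, ∀ z ∈ U,
      edist (extChartAt (𝓡 n) x y) (extChartAt (𝓡 n) x z) ≤ C * edist (e y) (e z) := by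
  obtain ⟨l, hl, hle⟩ := exists_contDiffAt_leftInverse he x
  obtain ⟨K, t, ht, hK⟩ := (hl.of_le (m := 1) (by simp)).exists_lipschitzOnWith
  refine ⟨K, _, inter_mem hle (he.contMDiff.continuous.continuousAt.preimage_mem_nhds ht), ?_⟩
  rintro y ⟨hy, hy'⟩ z ⟨hz, hz'⟩
  have := hK hy' hz'
  rwa [hy, hz] at this

theorem contDiffOn_comp_extChartAt_symm (he : ContMDiff (𝓡 n) (𝓡 L) ∞ e) (x : S) :
    ContDiffOn ℝ ∞ (e ∘ (extChartAt (𝓡 n) x).symm) (extChartAt (𝓡 n) x).target := by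
  rw [← contMDiffOn_iff_contDiffOn]
  exact he.comp_contMDiffOn (contMDiffOn_extChartAt_symm x)

/-- A smooth map is locally Lipschitz in the extended charts. -/
theorem eventually_edist_embedding_le_edist_extChartAt (he : IsImmersion (𝓡 n) (𝓡 L) ∞ e) (x : S) :
    ∃ C : ℝ≥0, ∃ U ∈ 𝓝 x, ∀ y ∈ U, ∀ z ∈ U,
      edist (e y) (e z) ≤ C * edist (extChartAt (𝓡 n) x y) (extChartAt (𝓡 n) x z) := by
  have h1 : ContDiffAt ℝ 1 (e ∘ (extChartAt (𝓡 n) x).symm) (extChartAt (𝓡 n) x x) :=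
    ((contDiffOn_comp_extChartAt_symm he.contMDiff x).of_le (m := 1) (by simp)).contDiffAt
      (extChartAt_target_mem_nhds x)
  obtain ⟨K, t, ht, hK⟩ := h1.exists_lipschitzOnWith
  refine ⟨K, _, inter_mem (extChartAt_source_mem_nhds (I := 𝓡 n) x)
    ((continuousAt_extChartAt x).preimage_mem_nhds ht), ?_⟩
  rintro y ⟨hy, hy'⟩ z ⟨hz, hz'⟩
  have := hK hy' hz'
  simpa only [Function.comp_apply, (extChartAt (𝓡 n) x).left_inv hy,
    (extChartAt (𝓡 n) x).left_inv hz] using this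

end ImmersionCharts

/-! ### Ahlfors regularity of the Riemannian volume -/

open scoped NNReal

/-- `n`-Ahlfors regularity of the measure `μ` for the distance `‖e x - e y‖`. -/
structure IsAhlfors {X : Type*} [MeasurableSpace X] {E : Type*} [NormedAddCommGroup E] (n : ℕ)
    (μ : Measure X) (e : X → E) (c C : ℝ) : Prop where
  c_pos : 0 < c
  C_pos : 0 < C
  lower : ∀ x r, 0 < r → r ≤ 1 → ENNReal.ofReal (c * r ^ n) ≤ μ {y | ‖e y - e x‖ < r}
  upper : ∀ x r, 0 < r → μ {y | ‖e y - e x‖ < r} ≤ ENNReal.ofReal (C * r ^ n)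

theorem euclideanHausdorffMeasure_image_le {X Y : Type*} [EMetricSpace X] [MeasurableSpace X]
    [BorelSpace X] [EMetricSpace Y] [MeasurableSpace Y] [BorelSpace Y] {K : ℝ≥0} {f : X → Y}
    {s : Set X} (h : LipschitzOnWith K f s) (n : ℕ) :
    (μHE[n] : Measure Y) (f '' s) ≤ (K : ℝ≥0∞) ^ n * (μHE[n] : Measure X) s := by
  rw [Measure.euclideanHausdorffMeasure_def, Measure.euclideanHausdorffMeasure_def,
    Measure.smul_apply, Measure.smul_apply, ENNReal.smul_def, ENNReal.smul_def, smul_eq_mul,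
    smul_eq_mul, mul_left_comm]
  gcongr
  have := h.hausdorffMeasure_image_le (d := n) (by positivity)
  simpa using this

section

variable {n L : ℕ} {S : Type*} [EMetricSpace S] [MeasurableSpace S] [BorelSpace S]
  [ChartedSpace (EuclideanSpace ℝ (Fin n)) S] [IsManifold (𝓡 n) ∞ S]
  [RiemannianBundle (fun x : S => TangentSpace (𝓡 n) x)]
  [IsContinuousRiemannianBundle (EuclideanSpace ℝ (Fin n))
      (fun x : S => TangentSpace (𝓡 n) x)]
  [IsRiemannianManifold (𝓡 n) S]
  {e : S → EuclideanSpace ℝ (Fin L)}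

/-- One chart is `K`-bi-Lipschitz both for the geodesic distance, which defines the measure, and for
the distance of the embedding, which defines the balls. A ball of radius `r` is thus compared with
coordinate balls of radii `r / K` and `K r`, and the chart distorts the measure by at most another
factor `K ^ n`; hence the `K ^ (2 * n)`. -/
theorem exists_local_volume_bounds (he : IsSmoothEmbedding (𝓡 n) (𝓡 L) ∞ e) (x : S) :
    ∃ r₀ c C : ℝ, 0 < r₀ ∧ 0 < c ∧ 0 < C ∧ ∀ x', ‖e x' - e x‖ < r₀ → ∀ r, 0 < r → r ≤ r₀ →
      ENNReal.ofReal (c * r ^ n) ≤ (μHE[n] : Measure S) {y | ‖e y - e x'‖ < r} ∧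
      (μHE[n] : Measure S) {y | ‖e y - e x'‖ < r} ≤ ENNReal.ofReal (C * r ^ n) := by
  have : IsManifold (𝓡 n) 1 S := IsManifold.of_le (n := ∞) (by simp)
  obtain ⟨C₁, U₁, hU₁, h₁⟩ := eventually_edist_le_edist_extChartAt (𝓡 n) x
  obtain ⟨C₂, U₂, hU₂, h₂⟩ := eventually_edist_extChartAt_le_edist (𝓡 n) x
  obtain ⟨C₃, U₃, hU₃, h₃⟩ := eventually_edist_extChartAt_le_edist_embedding he.isImmersion x
  obtain ⟨C₄, U₄, hU₄, h₄⟩ := eventually_edist_embedding_le_edist_extChartAt he.isImmersion x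
  set φ := extChartAt (𝓡 n) x with hφ
  obtain ⟨K, hK1, hKC₁, hKC₂, hKC₃, hKC₄⟩ :
      ∃ K : ℝ≥0, 1 ≤ K ∧ C₁ ≤ K ∧ C₂ ≤ K ∧ C₃ ≤ K ∧ C₄ ≤ K :=
    ⟨1 + C₁ + C₂ + C₃ + C₄, by
      rw [add_assoc, add_assoc, add_assoc]; exact le_self_add,
      by
        calc C₁ ≤ C₁ + (1 + C₂ + C₃ + C₄) := le_self_add
          _ = _ := by ring,
      by
        calc C₂ ≤ C₂ + (1 + C₁ + C₃ + C₄) := le_self_add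
          _ = _ := by ring,
      by
        calc C₃ ≤ C₃ + (1 + C₁ + C₂ + C₄) := le_self_add
          _ = _ := by ring,
      by
        calc C₄ ≤ C₄ + (1 + C₁ + C₂ + C₃) := le_self_add
          _ = _ := by ring⟩
  obtain ⟨U, hU, hUs, k₁, k₂, k₃, k₄⟩ : ∃ U ∈ 𝓝 x, U ⊆ φ.source ∧
      (∀ y ∈ U, ∀ z ∈ U, edist y z ≤ K * edist (φ y) (φ z)) ∧
      (∀ y ∈ U, ∀ z ∈ U, edist (φ y) (φ z) ≤ K * edist y z) ∧
      (∀ y ∈ U, ∀ z ∈ U, dist (φ y) (φ z) ≤ K * dist (e y) (e z)) ∧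
      (∀ y ∈ U, ∀ z ∈ U, dist (e y) (e z) ≤ K * dist (φ y) (φ z)) := by
    refine ⟨_, inter_mem (inter_mem (inter_mem hU₁ hU₂) (inter_mem hU₃ hU₄))
      (extChartAt_source_mem_nhds (I := 𝓡 n) x), fun y hy => hy.2, ?_, ?_, ?_, ?_⟩
    · intro y hy z hz
      exact (h₁ y hy.1.1.1 z hz.1.1.1).trans (by gcongr)
    · intro y hy z hz
      exact (h₂ y hy.1.1.2 z hz.1.1.2).trans (by gcongr)
    · intro y hy z hz
      have := (h₃ y hy.1.2.1 z hz.1.2.1).trans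
        (mul_le_mul_left (ENNReal.coe_le_coe.2 hKC₃) _)
      rw [edist_nndist, edist_nndist] at this
      exact_mod_cast this
    · intro y hy z hz
      have := (h₄ y hy.1.2.2 z hz.1.2.2).trans
        (mul_le_mul_left (ENNReal.coe_le_coe.2 hKC₄) _)
      rw [edist_nndist, edist_nndist] at this
      exact_mod_cast this
  have hK0 : (0 : ℝ) < K := lt_of_lt_of_le one_pos (by exact_mod_cast hK1)
  obtain ⟨r₁, hr₁, hb₁⟩ : ∃ r > 0, e ⁻¹' Metric.ball (e x) r ⊆ U := by
    have := hU
    rw [he.isEmbedding.isInducing.nhds_eq_comap, mem_comap] at this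
    obtain ⟨t, ht, htU⟩ := this
    obtain ⟨r, hr, hrt⟩ := Metric.mem_nhds_iff.1 ht
    exact ⟨r, hr, (preimage_mono hrt).trans htU⟩
  obtain ⟨δ, hδ, hb₂⟩ : ∃ δ > 0, Metric.ball (φ x) δ ⊆ φ.target ∩ φ.symm ⁻¹' U := by
    apply Metric.mem_nhds_iff.1
    refine inter_mem (extChartAt_target_mem_nhds x) ?_
    exact extChartAt_preimage_mem_nhds hU
  set vb : ℝ≥0∞ := volume (Metric.ball (0 : EuclideanSpace ℝ (Fin n)) 1) with hvb
  have hvb0 : vb ≠ 0 := (Metric.measure_ball_pos volume _ one_pos).ne'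
  have hvbt : vb ≠ ⊤ := measure_ball_lt_top.ne
  have hvbr : 0 < vb.toReal := ENNReal.toReal_pos hvb0 hvbt
  have hxU : x ∈ U := mem_of_mem_nhds hU
  -- The first bound keeps the balls inside the domain `U`; the second keeps the coordinate ball of
  -- radius `r / K` about `φ x'` inside the `δ`-ball about `φ x`.
  refine ⟨min (r₁ / 2) (δ / (2 * K)), vb.toReal / K ^ (2 * n), vb.toReal * K ^ (2 * n),
    by positivity, by positivity, by positivity, fun x' hx' r hr hrr => ?_⟩
  have hr1 : r ≤ r₁ / 2 := hrr.trans (min_le_left _ _)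
  have hr2 : r ≤ δ / (2 * K) := hrr.trans (min_le_right _ _)
  have hx1 : ‖e x' - e x‖ < r₁ / 2 := hx'.trans_le (min_le_left _ _)
  have hx2 : ‖e x' - e x‖ < δ / (2 * K) := hx'.trans_le (min_le_right _ _)
  have hx'U : x' ∈ U := hb₁ (by rw [mem_preimage, mem_ball_iff_norm]; linarith)
  have hAU : {y | ‖e y - e x'‖ < r} ⊆ U := by
    intro y hy
    apply hb₁
    rw [mem_preimage, mem_ball_iff_norm]
    have : ‖e y - e x‖ ≤ ‖e y - e x'‖ + ‖e x' - e x‖ := norm_sub_le_norm_sub_add_norm_sub ..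
    have hy' : ‖e y - e x'‖ < r := hy
    linarith
  have hφx' : dist (φ x') (φ x) < δ / 2 := by
    refine (k₃ x' hx'U x hxU).trans_lt ?_
    rw [dist_eq_norm]
    calc K * ‖e x' - e x‖ < K * (δ / (2 * K)) := by gcongr
      _ = δ / 2 := by field_simp
  constructor
  · set B := Metric.ball (φ x') (r / K) with hB
    have hBV : B ⊆ φ.target ∩ φ.symm ⁻¹' U := by
      refine Subset.trans (fun w hw => ?_) hb₂
      rw [Metric.mem_ball] at hw ⊢
      have h1 : dist w (φ x) ≤ dist w (φ x') + dist (φ x') (φ x) := dist_triangle _ _ _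
      have h2 : r / K ≤ δ / 2 := by
        have hK1' : (1 : ℝ) ≤ K := by exact_mod_cast hK1
        calc r / K ≤ (δ / (2 * K)) / K := by gcongr
          _ ≤ (δ / (2 * 1)) / 1 := by gcongr
          _ = δ / 2 := by ring
      linarith
    have hsub : φ.symm '' B ⊆ {y | ‖e y - e x'‖ < r} := by
      rintro _ ⟨w, hw, rfl⟩
      have h1 := k₄ _ (hBV hw).2 x' hx'U
      rw [φ.right_inv (hBV hw).1, dist_eq_norm] at h1
      refine h1.trans_lt ?_
      calc K * dist w (φ x') < K * (r / K) := by gcongr; exact hw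
        _ = r := by field_simp
    have himg : B = φ '' (φ.symm '' B) := by
      rw [image_image]
      conv_lhs => rw [← image_id B]
      exact image_congr fun w hw => (φ.right_inv (hBV hw).1).symm
    have hLip : LipschitzOnWith K φ (φ.symm '' B) := by
      rintro _ ⟨w, hw, rfl⟩ _ ⟨w', hw', rfl⟩
      exact k₂ _ (hBV hw).2 _ (hBV hw').2
    have h3 := euclideanHausdorffMeasure_image_le hLip n
    rw [← himg, EuclideanSpace.euclideanHausdorffMeasure_eq_volume,
      Measure.addHaar_ball_of_pos _ _ (by positivity), finrank_euclideanSpace_fin] at h3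
    have h4 := h3.trans (mul_le_mul_right (measure_mono hsub) _)
    rw [← hvb] at h4
    have h5 : ENNReal.ofReal ((K : ℝ) ^ n) = (K : ℝ≥0∞) ^ n := by
      rw [ENNReal.ofReal_pow hK0.le, ENNReal.ofReal_coe_nnreal]
    have h6 : ENNReal.ofReal (vb.toReal / K ^ (2 * n) * r ^ n) * (K : ℝ≥0∞) ^ n =
        ENNReal.ofReal ((r / K) ^ n) * vb := by
      conv_rhs => rw [← ENNReal.ofReal_toReal hvbt]
      rw [← h5, ← ENNReal.ofReal_mul (by positivity), ← ENNReal.ofReal_mul (by positivity)]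
      congr 1
      rw [div_pow, two_mul, pow_add]
      field_simp
    rw [← h6, mul_comm] at h4
    refine (ENNReal.mul_le_mul_iff_right ?_ ?_).1 h4
    · rw [← h5]; exact (ENNReal.ofReal_pos.2 (by positivity)).ne'
    · simp
  · set A := {y | ‖e y - e x'‖ < r} with hA
    have hLip : LipschitzOnWith K φ.symm (φ '' A) := by
      rintro _ ⟨y, hy, rfl⟩ _ ⟨z, hz, rfl⟩
      rw [φ.left_inv (hUs (hAU hy)), φ.left_inv (hUs (hAU hz))]
      exact k₁ _ (hAU hy) _ (hAU hz)
    have himg : φ.symm '' (φ '' A) = A := by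
      rw [image_image]
      conv_rhs => rw [← image_id A]
      exact image_congr fun w hw => φ.left_inv (hUs (hAU hw))
    have hsub : φ '' A ⊆ Metric.ball (φ x') (K * r) := by
      rintro _ ⟨y, hy, rfl⟩
      rw [Metric.mem_ball]
      refine (k₃ _ (hAU hy) _ hx'U).trans_lt ?_
      rw [dist_eq_norm]
      gcongr
      exact hy
    have h3 := euclideanHausdorffMeasure_image_le hLip n
    rw [himg] at h3
    refine h3.trans ((mul_le_mul_right (measure_mono hsub) _).trans ?_)
    rw [EuclideanSpace.euclideanHausdorffMeasure_eq_volume,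
      Measure.addHaar_ball_of_pos _ _ (by positivity), finrank_euclideanSpace_fin, ← hvb]
    have h5 : ENNReal.ofReal ((K : ℝ) ^ n) = (K : ℝ≥0∞) ^ n := by
      rw [ENNReal.ofReal_pow hK0.le, ENNReal.ofReal_coe_nnreal]
    conv_lhs => rw [← ENNReal.ofReal_toReal hvbt]
    rw [← h5, ← ENNReal.ofReal_mul (by positivity), ← ENNReal.ofReal_mul (by positivity)]
    apply ENNReal.ofReal_le_ofReal
    rw [mul_pow, two_mul, pow_add]
    apply le_of_eq; ring

/-- A closed submanifold of Euclidean space is Ahlfors regular for its Riemannian volume. -/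
theorem exists_isAhlfors [CompactSpace S] (he : IsSmoothEmbedding (𝓡 n) (𝓡 L) ∞ e) :
    ∃ c C : ℝ, IsAhlfors n (μHE[n] : Measure S) e c C ∧ (μHE[n] : Measure S) univ < ⊤ := by
  choose r₀ c C hr₀ hc hC h using fun x => exists_local_volume_bounds he x
  have hcont : Continuous e := he.isEmbedding.continuous
  obtain ⟨t, -, ht⟩ := isCompact_univ.elim_nhds_subcover
    (fun x => {y | ‖e y - e x‖ < r₀ x}) (fun x _ =>
      (isOpen_lt (by fun_prop) continuous_const).mem_nhds (by simpa using hr₀ x))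
  have hcov : ∀ x, ∃ i ∈ t, ‖e x - e i‖ < r₀ i := by
    intro x
    simpa using ht (mem_univ x)
  have hfin : (μHE[n] : Measure S) univ < ⊤ := by
    refine (measure_mono ht).trans_lt ((measure_biUnion_finset_le _ _).trans_lt ?_)
    refine ENNReal.sum_lt_top.2 fun i _ => ?_
    exact ((h i i (by simpa using hr₀ i) (r₀ i) (hr₀ i) le_rfl).2).trans_lt ENNReal.ofReal_lt_top
  rcases isEmpty_or_nonempty S with hS | ⟨⟨x₁⟩⟩
  · exact ⟨1, 1, ⟨one_pos, one_pos, fun x => (hS.false x).elim, fun x => (hS.false x).elim⟩, hfin⟩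
  have hne : t.Nonempty := by
    obtain ⟨i, hi, -⟩ := hcov x₁
    exact ⟨i, hi⟩
  obtain ⟨a, ha, ha1, haall⟩ : ∃ a : ℝ, 0 < a ∧ a ≤ 1 ∧ ∀ i ∈ t, a ≤ r₀ i := by
    obtain ⟨j, hj, hj'⟩ := t.exists_min_image r₀ hne
    exact ⟨min 1 (r₀ j), lt_min one_pos (hr₀ j), min_le_left _ _,
      fun i hi => (min_le_right _ _).trans (hj' i hi)⟩
  obtain ⟨b, hb, hball⟩ : ∃ b : ℝ, 0 < b ∧ ∀ i ∈ t, b ≤ c i := by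
    obtain ⟨j, hj, hj'⟩ := t.exists_min_image c hne
    exact ⟨c j, hc j, hj'⟩
  obtain ⟨D, hD, hDall⟩ : ∃ D : ℝ, 0 < D ∧ ∀ i ∈ t, C i ≤ D := by
    obtain ⟨j, hj, hj'⟩ := t.exists_max_image C hne
    exact ⟨C j, hC j, hj'⟩
  set m := ((μHE[n] : Measure S) univ).toReal with hm
  -- For the lower bound the radius is shrunk to `r * a`, where the local estimate holds. For `r >
  -- a` the upper bound is the total mass `m ≤ (m / a ^ n) * r ^ n`.
  refine ⟨b * a ^ n, D + m / a ^ n, ⟨by positivity, by positivity, fun x r hr hr1 => ?_,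
    fun x r hr => ?_⟩, hfin⟩
  · obtain ⟨i, hi, hxi⟩ := hcov x
    have h1 := (h i x hxi (r * a) (by positivity)
      ((mul_le_of_le_one_left ha.le hr1).trans (haall i hi))).1
    have h2 : b * a ^ n * r ^ n ≤ c i * (r * a) ^ n := by
      rw [mul_pow]
      calc b * a ^ n * r ^ n = b * (r ^ n * a ^ n) := by ring
        _ ≤ _ := by gcongr; exact hball i hi
    refine (ENNReal.ofReal_le_ofReal h2).trans (h1.trans (measure_mono fun y hy => ?_))
    have hy' : ‖e y - e x‖ < r * a := hy
    exact hy'.trans_le (mul_le_of_le_one_right hr.le ha1)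
  · by_cases hra : r ≤ a
    · obtain ⟨i, hi, hxi⟩ := hcov x
      refine (h i x hxi r hr (hra.trans (haall i hi))).2.trans (ENNReal.ofReal_le_ofReal ?_)
      gcongr
      have := hDall i hi
      have : 0 ≤ m / a ^ n := by positivity
      linarith
    · push Not at hra
      refine (measure_mono (subset_univ _)).trans ?_
      rw [← ENNReal.ofReal_toReal hfin.ne, ← hm]
      apply ENNReal.ofReal_le_ofReal
      have h1 : 1 ≤ r ^ n / a ^ n := by
        rw [one_le_div (by positivity)]
        gcongr
      calc m = m * 1 := by ring
        _ ≤ m * (r ^ n / a ^ n) := by gcongr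
        _ = m / a ^ n * r ^ n := by ring
        _ ≤ _ := by gcongr; linarith
end

/-! ### Nearest points by the inverse function theorem -/

section NearestPoint

open scoped RealInnerProductSpace

variable {U W : Type*} [NormedAddCommGroup U] [InnerProductSpace ℝ U] [FiniteDimensional ℝ U]
  [NormedAddCommGroup W] [InnerProductSpace ℝ W] [FiniteDimensional ℝ W]

/-- Half the gradient of `u ↦ ‖f u - w‖ ^ 2`. -/
noncomputable def distGradient (f : U → W) (p : W × U) : U :=
  ContinuousLinearMap.adjoint (fderiv ℝ f p.2) (f p.2 - p.1)

theorem distGradient_eq_zero_of_isLocalMin {f : U → W} {w : W} {u : U}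
    (hf : DifferentiableAt ℝ f u) (h : IsLocalMin (fun u => ‖f u - w‖ ^ 2) u) :
    distGradient f (w, u) = 0 := by
  have h1 : HasFDerivAt (fun u => ‖f u - w‖ ^ 2)
      (2 • (innerSL ℝ (f u - w)).comp (fderiv ℝ f u)) u :=
    (hf.hasFDerivAt.sub_const w).norm_sq
  have h2 := h.hasFDerivAt_eq_zero h1
  refine ext_inner_right ℝ fun v => ?_
  have h3 := congrArg (fun T => T v) h2
  simp only [distGradient, ContinuousLinearMap.adjoint_inner_left, inner_zero_left]
  simpa [inner_sub_left] using h3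

theorem contDiffAt_distGradient {f : U → W} {w : W} {u : U} (hf : ContDiffAt ℝ ∞ f u) :
    ContDiffAt ℝ ∞ (distGradient f) (w, u) := by
  have h1 : ContDiffAt ℝ ∞ (fun p : W × U => fderiv ℝ f p.2) (w, u) :=
    (hf.fderiv_right (m := ∞) (by simp)).comp (w, u) contDiffAt_snd
  have h2 : ContDiffAt ℝ ∞ (fun p : W × U => ContinuousLinearMap.adjoint (fderiv ℝ f p.2)) (w, u) :=
    (ContinuousLinearMap.adjoint (𝕜 := ℝ) (E := U) (F := W)).toContinuousLinearEquiv.contDiff.contDiffAt.comp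
      (w, u) h1
  have h3 : ContDiffAt ℝ ∞ (fun p : W × U => f p.2 - p.1) (w, u) :=
    (hf.comp (w, u) contDiffAt_snd).sub contDiffAt_fst
  exact h2.clm_apply h3

/-- At `w = f u` the residual `f u - w` vanishes, so no second derivative of `f` survives: the
derivative of the gradient in `u` is `(Df)* Df`, which is injective along with `Df`. -/
theorem injective_fderiv_prod_distGradient {f : U → W} {u : U} (hf : ContDiffAt ℝ ∞ f u)
    (hinj : Function.Injective (fderiv ℝ f u)) :
    Function.Injective
      (fderiv ℝ (fun p : W × U => (p.1, distGradient f p)) (f u, u)) := by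
  have h1 : DifferentiableAt ℝ (fun p : W × U => ContinuousLinearMap.adjoint (fderiv ℝ f p.2))
      (f u, u) := by
    have h1 : ContDiffAt ℝ ∞ (fun p : W × U => fderiv ℝ f p.2) (f u, u) :=
      (hf.fderiv_right (m := ∞) (by simp)).comp (f u, u) contDiffAt_snd
    exact ((ContinuousLinearMap.adjoint (𝕜 := ℝ) (E := U) (F := W)).toContinuousLinearEquiv.contDiff.contDiffAt.comp
      (f u, u) h1).differentiableAt (by simp)
  have hfd : HasFDerivAt f (fderiv ℝ f u) u := (hf.differentiableAt (by simp)).hasFDerivAt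
  have h2 : HasFDerivAt (fun p : W × U => f p.2 - p.1)
      ((fderiv ℝ f u).comp (ContinuousLinearMap.snd ℝ W U) - ContinuousLinearMap.fst ℝ W U)
      (f u, u) :=
    (HasFDerivAt.comp (f u, u) hfd hasFDerivAt_snd).sub hasFDerivAt_fst
  have h3 := (hasFDerivAt_fst (𝕜 := ℝ) (E := W) (F := U) (p := (f u, u))).prodMk
    (h1.hasFDerivAt.clm_apply h2)
  have h4 : fderiv ℝ (fun p : W × U => (p.1, distGradient f p)) (f u, u) = _ := h3.fderiv
  rw [h4, injective_iff_map_eq_zero]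
  rintro ⟨dw, du⟩ h
  simp only [sub_self] at h
  have h5 := congrArg Prod.fst h
  have h6 := congrArg Prod.snd h
  simp at h5 h6
  subst h5
  rw [map_zero, sub_zero] at h6
  have h7 : ⟪(fderiv ℝ f u) du, (fderiv ℝ f u) du⟫ = 0 := by
    rw [← ContinuousLinearMap.adjoint_inner_left, h6, inner_zero_left]
  have h8 : du = 0 := hinj (by rw [map_zero]; exact inner_self_eq_zero.1 h7)
  simp [h8]

/-- A parameter minimizing the distance to `w` is a critical point, hence is sent to `(w, 0)` by
`(w, u) ↦ (w, distGradient f (w, u))`. This map is locally invertible, so the local inverse at `(w,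
0)` finds the minimizer and depends smoothly on `w`. -/
theorem exists_local_nearest_parameter {f : U → W} {V : Set U} (hV : IsOpen V)
    (hf : ContDiffOn ℝ ∞ f V) {u₀ : U} (hu₀ : u₀ ∈ V)
    (hinj : Function.Injective (fderiv ℝ f u₀)) :
    ∃ g : W → U, ∃ A ∈ 𝓝 (f u₀), ∃ B ∈ 𝓝 u₀, B ⊆ V ∧
      (∀ w ∈ A, ContDiffAt ℝ ∞ g w ∧ g w ∈ V) ∧
      ∀ w ∈ A, ∀ u ∈ B, IsLocalMin (fun u => ‖f u - w‖ ^ 2) u → g w = u := by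
  set Φ : W × U → W × U := fun p => (p.1, distGradient f p) with hΦ
  have hΦs : ∀ p : W × U, p.2 ∈ V → ContDiffAt ℝ ∞ Φ p := fun p hp =>
    contDiffAt_fst.prodMk (contDiffAt_distGradient (hf.contDiffAt (hV.mem_nhds hp)))
  set p₀ : W × U := (f u₀, u₀) with hp₀
  have hs0 := hΦs p₀ hu₀
  have hinj0 : Function.Injective (fderiv ℝ Φ p₀) :=
    injective_fderiv_prod_distGradient (hf.contDiffAt (hV.mem_nhds hu₀)) hinj
  let D : (W × U) ≃L[ℝ] (W × U) :=
    (LinearEquiv.ofInjectiveEndo (fderiv ℝ Φ p₀ : (W × U) →ₗ[ℝ] (W × U)) hinj0).toContinuousLinearEquiv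
  have hD : (D : (W × U) →L[ℝ] (W × U)) = fderiv ℝ Φ p₀ := by
    ext v <;> rfl
  have hd0 : HasFDerivAt Φ (D : (W × U) →L[ℝ] (W × U)) p₀ := by
    rw [hD]; exact (hs0.differentiableAt (by simp)).hasFDerivAt
  set T := hs0.toOpenPartialHomeomorph Φ hd0 (by simp) with hT
  have hTc : ∀ p, T p = Φ p := fun p => rfl
  have hp₀T : p₀ ∈ T.source := hs0.mem_toOpenPartialHomeomorph_source hd0 (by simp)
  have hΦ0 : Φ p₀ = (f u₀, 0) := by simp [hΦ, hp₀, distGradient]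
  have hmt : (f u₀, (0 : U)) ∈ T.target := by
    rw [← hΦ0]; exact T.map_source hp₀T
  have hsymm0 : T.symm (f u₀, 0) = p₀ := by
    rw [← hΦ0, ← hTc, T.left_inv hp₀T]
  -- Smoothness of the inverse is wanted at all nearby points and not only at the centre; invertible
  -- operators form an open set, so the derivative stays invertible.
  have hgood : ∀ᶠ p in 𝓝 p₀, p.2 ∈ V ∧
      fderiv ℝ Φ p ∈ range ((↑) : ((W × U) ≃L[ℝ] (W × U)) → (W × U) →L[ℝ] (W × U)) := by
    refine Filter.Eventually.and ?_ ?_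
    · exact continuousAt_snd.preimage_mem_nhds (hV.mem_nhds hu₀)
    · have : ContinuousAt (fderiv ℝ Φ) p₀ :=
        (hs0.fderiv_right (m := 0) (by simp)).continuousAt
      exact this.preimage_mem_nhds (ContinuousLinearEquiv.isOpen.mem_nhds ⟨D, hD⟩)
  have hc : ContinuousAt (fun w : W => T.symm (w, (0 : U))) (f u₀) := by
    refine ContinuousAt.comp (f := fun w : W => (w, (0 : U))) (T.continuousAt_symm hmt) ?_
    fun_prop
  obtain ⟨A₁, hA₁, B₁, hB₁, hAB⟩ := mem_nhds_prod_iff.1 (T.open_source.mem_nhds hp₀T)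
  refine ⟨fun w => (T.symm (w, 0)).2, A₁ ∩ {w | (w, (0 : U)) ∈ T.target ∧
    ((T.symm (w, 0)).2 ∈ V ∧ fderiv ℝ Φ (T.symm (w, 0)) ∈
      range ((↑) : ((W × U) ≃L[ℝ] (W × U)) → (W × U) →L[ℝ] (W × U)))}, ?_, B₁ ∩ V,
      inter_mem hB₁ (hV.mem_nhds hu₀), inter_subset_right, ?_, ?_⟩
  · refine inter_mem hA₁ (Filter.Eventually.and ?_ ?_)
    · have : ContinuousAt (fun w : W => (w, (0 : U))) (f u₀) := by fun_prop
      exact this.preimage_mem_nhds (T.open_target.mem_nhds hmt)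
    · have := hc.tendsto
      rw [hsymm0] at this
      exact this.eventually hgood
  · rintro w ⟨-, hw1, hw2, ⟨D', hD'⟩⟩
    refine ⟨?_, hw2⟩
    have h1 : ContDiffAt ℝ ∞ Φ (T.symm (w, 0)) := hΦs _ hw2
    have h2 : ContDiffAt ℝ ∞ T.symm (w, (0 : U)) := by
      refine T.contDiffAt_symm hw1 (f₀' := D') ?_ h1
      rw [hD']
      exact (h1.differentiableAt (by simp)).hasFDerivAt
    have h3 : ContDiffAt ℝ ∞ (fun w : W => (w, (0 : U))) w := by fun_prop
    exact contDiffAt_snd.comp w (ContDiffAt.comp w h2 h3)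
  · rintro w ⟨hwA, -, -, -⟩ u ⟨huB, huV⟩ hmin
    have h1 : distGradient f (w, u) = 0 := distGradient_eq_zero_of_isLocalMin
      ((hf.contDiffAt (hV.mem_nhds huV)).differentiableAt (by simp)) hmin
    have h2 : T (w, u) = (w, 0) := by rw [hTc, hΦ]; simp [h1]
    change (T.symm (w, 0)).2 = u
    rw [← h2, T.left_inv (hAB ⟨hwA, huB⟩)]

end NearestPoint

/-! ### The smooth, Lipschitz retraction onto a closed submanifold -/

section Retraction

open scoped NNReal

variable {m M : ℕ} {N : Type*} [TopologicalSpace N] [CompactSpace N]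
  [ChartedSpace (EuclideanSpace ℝ (Fin m)) N] [IsManifold (𝓡 m) ∞ N]
  {ι : N → EuclideanSpace ℝ (Fin M)}

-- A point of `N` nearest to `w` has distance at most `2 ‖w - ι q‖` from `ι q`. Since `ι` is an
-- embedding, it lies in a given chart neighbourhood of `q` when `w` is close to `ι q`, and the
-- parametric result applies.
omit [CompactSpace N] in
theorem exists_local_nearest_point (hι : IsSmoothEmbedding (𝓡 m) (𝓡 M) ∞ ι) (q : N) :
    ∃ h : EuclideanSpace ℝ (Fin M) → N, ∃ A ∈ 𝓝 (ι q),
      (∀ w ∈ A, ContMDiffAt (𝓡 M) (𝓡 m) ∞ h w) ∧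
      ∀ w ∈ A, ∀ z : N, (∀ z', ‖ι z - w‖ ≤ ‖ι z' - w‖) → h w = z := by
  set ψ := extChartAt (𝓡 m) q with hψ
  set f := ι ∘ ψ.symm with hf
  have hq : q ∈ ψ.source := mem_extChartAt_source q
  have hfψ : f (ψ q) = ι q := by simp [hf, ψ.left_inv hq]
  have hfs : ContDiffOn ℝ ∞ f ψ.target :=
    contDiffOn_comp_extChartAt_symm hι.isImmersion.contMDiff q
  have hopen : IsOpen ψ.target := isOpen_extChartAt_target q
  have hu₀ : ψ q ∈ ψ.target := mem_extChartAt_target q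
  have hinj : Function.Injective (fderiv ℝ f (ψ q)) := by
    obtain ⟨l, hl, hle⟩ := exists_contDiffAt_leftInverse hι.isImmersion q
    have h1 : (l ∘ f) =ᶠ[𝓝 (ψ q)] id := by
      have hc : ContinuousAt ψ.symm (ψ q) := continuousAt_extChartAt_symm q
      have h2 : ∀ᶠ u in 𝓝 (ψ q), l (ι (ψ.symm u)) = ψ (ψ.symm u) := by
        have h3 := hc.tendsto
        rw [ψ.left_inv hq] at h3
        exact h3.eventually hle
      filter_upwards [h2, hopen.mem_nhds hu₀] with u hu hu'
      simp [hf, hu, ψ.right_inv hu']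
    have hfd : HasFDerivAt f (fderiv ℝ f (ψ q)) (ψ q) :=
      ((hfs.contDiffAt (hopen.mem_nhds hu₀)).differentiableAt (by simp)).hasFDerivAt
    have hld : HasFDerivAt l (fderiv ℝ l (ι q)) (f (ψ q)) := by
      rw [hfψ]; exact (hl.differentiableAt (by simp)).hasFDerivAt
    have h3 := (hld.comp (ψ q) hfd).congr_of_eventuallyEq h1.symm
    have h4 := h3.unique (hasFDerivAt_id (ψ q))
    exact Function.LeftInverse.injective (g := fderiv ℝ l (ι q)) fun v =>
      congrArg (fun T => T v) h4
  obtain ⟨g, A, hA, B, hB, hBV, hg, hmin⟩ := exists_local_nearest_parameter hopen hfs hu₀ hinj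
  rw [hfψ] at hA
  have hB' : ψ.source ∩ ψ ⁻¹' B ∈ 𝓝 q :=
    inter_mem (extChartAt_source_mem_nhds q) ((continuousAt_extChartAt q).preimage_mem_nhds hB)
  rw [hι.isEmbedding.isInducing.nhds_eq_comap, mem_comap] at hB'
  obtain ⟨t, ht, htU⟩ := hB'
  obtain ⟨r, hr, hrt⟩ := Metric.mem_nhds_iff.1 ht
  refine ⟨ψ.symm ∘ g, A ∩ Metric.ball (ι q) (r / 2),
    inter_mem hA (Metric.ball_mem_nhds _ (by positivity)), ?_, ?_⟩
  · rintro w ⟨hw, -⟩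
    exact ((contMDiffOn_extChartAt_symm q).contMDiffAt (hopen.mem_nhds (hg w hw).2)).comp w
      (hg w hw).1.contMDiffAt
  · rintro w ⟨hw, hwr⟩ z hz
    have hzB : z ∈ ψ.source ∩ ψ ⁻¹' B := by
      apply htU
      apply hrt
      rw [Metric.mem_ball, dist_eq_norm] at hwr ⊢
      have h1 := hz q
      have h2 : ‖ι z - ι q‖ ≤ ‖ι z - w‖ + ‖w - ι q‖ := norm_sub_le_norm_sub_add_norm_sub ..
      rw [norm_sub_rev (ι q) w] at h1
      linarith
    have h1 := hmin w hw (ψ z) hzB.2 (Filter.Eventually.of_forall fun u => by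
      have h2 : f (ψ z) = ι z := by simp [hf, ψ.left_inv hzB.1]
      change ‖f (ψ z) - w‖ ^ 2 ≤ ‖f u - w‖ ^ 2
      rw [h2]
      exact pow_le_pow_left₀ (norm_nonneg _) (hz _) 2)
    simp [h1, ψ.left_inv hzB.1]

/-- A smooth retraction of a neighbourhood of a closed submanifold of Euclidean space. -/
theorem exists_smooth_retraction [Nonempty N] (hι : IsSmoothEmbedding (𝓡 m) (𝓡 M) ∞ ι) :
    ∃ (ρ : EuclideanSpace ℝ (Fin M) → N) (δ : ℝ) (K : ℝ≥0), 0 < δ ∧ (∀ q, ρ (ι q) = q) ∧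
      (∀ w, (∃ q, ‖w - ι q‖ < δ) → ContMDiffAt (𝓡 M) (𝓡 m) ∞ ρ w) ∧
      ∀ w w', (∃ q, ‖w - ι q‖ < δ) → (∃ q, ‖w' - ι q‖ < δ) →
        ‖ι (ρ w) - ι (ρ w')‖ ≤ K * ‖w - w'‖ := by
  have hιc : Continuous ι := hι.isEmbedding.continuous
  have hex : ∀ w : EuclideanSpace ℝ (Fin M), ∃ z : N, ∀ z', ‖ι z - w‖ ≤ ‖ι z' - w‖ := by
    intro w
    obtain ⟨z, -, hz⟩ := isCompact_univ.exists_isMinOn (univ_nonempty (α := N))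
      (f := fun z => ‖ι z - w‖) (by fun_prop)
    exact ⟨z, fun z' => hz (mem_univ z')⟩
  -- The choice of nearest points is arbitrary; close to `N` it is forced to agree with the smooth
  -- local solutions `h q`.
  choose ρ hρ using hex
  choose h A hA hsm hmin using fun q => exists_local_nearest_point hι q
  set O := ⋃ q, interior (A q) with hO
  have hOopen : IsOpen O := isOpen_iUnion fun q => isOpen_interior
  have hsub : range ι ⊆ O := by
    rintro _ ⟨q, rfl⟩
    exact mem_iUnion.2 ⟨q, mem_interior_iff_mem_nhds.2 (hA q)⟩
  have hsmooth : ∀ w ∈ O, ContMDiffAt (𝓡 M) (𝓡 m) ∞ ρ w := by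
    intro w hw
    obtain ⟨q, hq⟩ := mem_iUnion.1 hw
    refine (hsm q w (interior_subset hq)).congr_of_eventuallyEq ?_
    filter_upwards [isOpen_interior.mem_nhds hq] with w' hw'
    exact (hmin q w' (interior_subset hw') (ρ w') (hρ w')).symm
  have hK : IsCompact (range ι) := isCompact_range hιc
  obtain ⟨δ, hδ, hδO⟩ := hK.exists_cthickening_subset_open hOopen hsub
  have hcpt : IsCompact (Metric.cthickening δ (range ι)) := hK.cthickening
  -- The closed tube need not be convex; on a compact set local Lipschitz bounds already yield a
  -- global one.
  have hll : LocallyLipschitzOn (Metric.cthickening δ (range ι)) (ι ∘ ρ) := by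
    intro w hw
    have h1 : ContDiffAt ℝ ∞ (ι ∘ ρ) w := by
      rw [← contMDiffAt_iff_contDiffAt]
      exact hι.isImmersion.contMDiff.contMDiffAt.comp w (hsmooth w (hδO hw))
    obtain ⟨K, t, ht, hKt⟩ := (h1.of_le (m := 1) (by simp)).exists_lipschitzOnWith
    exact ⟨K, t, mem_nhdsWithin_of_mem_nhds ht, hKt⟩
  obtain ⟨K, hK⟩ := hll.exists_lipschitzOnWith_of_compact hcpt
  have hmem : ∀ w, (∃ q, ‖w - ι q‖ < δ) → w ∈ Metric.cthickening δ (range ι) := by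
    rintro w ⟨q, hq⟩
    exact Metric.mem_cthickening_of_dist_le w (ι q) δ _ (mem_range_self q)
      (by rw [dist_eq_norm]; exact hq.le)
  refine ⟨ρ, δ, K, hδ, fun q => ?_, fun w hw => hsmooth w (hδO (hmem w hw)),
    fun w w' hw hw' => ?_⟩
  · have := hρ (ι q) q
    rw [sub_self, norm_zero] at this
    exact hι.isEmbedding.injective (sub_eq_zero.1 (norm_le_zero_iff.1 this))
  · have := hK.dist_le_mul w (hmem w hw) w' (hmem w' hw')
    simpa [dist_eq_norm] using this

end Retraction

/-! ### Integrals of the weight over balls and their complements -/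

section Weights

variable {X : Type*} [MeasurableSpace X] {μ : Measure X}
  {E : Type*} [NormedAddCommGroup E] [MeasurableSpace E] [BorelSpace E]
  [SecondCountableTopology E] {e : X → E} {n : ℕ} {c₀ C₀ : ℝ}

/-- The ball about `x` of radius `r` for the distance `‖e x - e y‖`. -/
def embBall (e : X → E) (x : X) (r : ℝ) : Set X := {y | ‖e y - e x‖ < r}

/-- The weight `‖e x - e y‖ ^ (-2n)`. -/
noncomputable def gagliardoWeight (n : ℕ) (e : X → E) (x y : X) : ℝ≥0∞ :=
  ENNReal.ofReal ((‖e x - e y‖ ^ (2 * n))⁻¹)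

omit [MeasurableSpace X] [MeasurableSpace E] [BorelSpace E] [SecondCountableTopology E] in
theorem mem_embBall {x y : X} {r : ℝ} : y ∈ embBall e x r ↔ ‖e y - e x‖ < r := Iff.rfl

omit [MeasurableSpace X] [MeasurableSpace E] [BorelSpace E] [SecondCountableTopology E] in
theorem mem_embBall' {x y : X} {r : ℝ} : y ∈ embBall e x r ↔ ‖e x - e y‖ < r := by
  rw [mem_embBall, norm_sub_rev]

theorem measurable_emb_dist (he : Measurable e) :
    Measurable (fun z : X × X => ‖e z.1 - e z.2‖) :=
  ((he.comp measurable_fst).sub (he.comp measurable_snd)).norm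

omit [SecondCountableTopology E] in
theorem measurableSet_embBall (he : Measurable e) (x : X) (r : ℝ) :
    MeasurableSet (embBall e x r) :=
  measurableSet_lt (he.sub_const _).norm measurable_const

theorem measurable_gagliardoWeight (he : Measurable e) :
    Measurable (fun z : X × X => gagliardoWeight n e z.1 z.2) :=
  (((measurable_emb_dist he).pow_const _).inv).ennreal_ofReal

omit [MeasurableSpace X] [MeasurableSpace E] [BorelSpace E] [SecondCountableTopology E] in
theorem gagliardoWeight_comm (x y : X) : gagliardoWeight n e x y = gagliardoWeight n e y x := by
  rw [gagliardoWeight, gagliardoWeight, norm_sub_rev]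

omit [MeasurableSpace E] [BorelSpace E] [SecondCountableTopology E] in
theorem IsAhlfors.measure_embBall_le (h : IsAhlfors n μ e c₀ C₀) (x : X) {r : ℝ} (hr : 0 < r) :
    μ (embBall e x r) ≤ ENNReal.ofReal (C₀ * r ^ n) := h.upper x r hr

/-- Split into dyadic shells. The shell at distance `2 ^ k * σ` carries weight at most `(2 ^ k σ) ^
(-2n)` and mass at most `C₀ (2 ^ (k+1) σ) ^ n`, so the contributions decay like `2 ^ (-k n)`; `n ≥
1` makes the ratio at most `1 / 2`. -/
theorem lintegral_gagliardoWeight_compl_embBall_le (h : IsAhlfors n μ e c₀ C₀) (he : Measurable e)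
    (hn : 1 ≤ n) (x : X) {σ : ℝ} (hσ : 0 < σ) :
    ∫⁻ y in (embBall e x σ)ᶜ, gagliardoWeight n e x y ∂μ ≤
      ENNReal.ofReal (C₀ * 2 ^ (n + 1) / σ ^ n) := by
  have hC := h.C_pos
  have hpt : ∀ y ∈ (embBall e x σ)ᶜ, gagliardoWeight n e x y ≤
      ∑' k : ℕ, (embBall e x (2 ^ (k + 1) * σ)).indicator
        (fun _ => ENNReal.ofReal (((2 ^ k * σ) ^ (2 * n))⁻¹)) y := by
    intro y hy
    have hy' : σ ≤ ‖e x - e y‖ := by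
      rw [mem_compl_iff, mem_embBall', not_lt] at hy; exact hy
    obtain ⟨k, hk1, hk2⟩ := exists_nat_pow_near (one_le_div hσ |>.2 hy') (one_lt_two (α := ℝ))
    rw [le_div_iff₀ hσ] at hk1
    rw [div_lt_iff₀ hσ] at hk2
    refine le_trans ?_ (ENNReal.le_tsum k)
    rw [indicator_of_mem (mem_embBall'.2 hk2), gagliardoWeight]
    apply ENNReal.ofReal_le_ofReal
    gcongr
  calc ∫⁻ y in (embBall e x σ)ᶜ, gagliardoWeight n e x y ∂μ
      ≤ ∫⁻ y in (embBall e x σ)ᶜ, ∑' k : ℕ, (embBall e x (2 ^ (k + 1) * σ)).indicator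
        (fun _ => ENNReal.ofReal (((2 ^ k * σ) ^ (2 * n))⁻¹)) y ∂μ :=
        setLIntegral_mono' (measurableSet_embBall he x σ).compl hpt
    _ ≤ ∫⁻ y, ∑' k : ℕ, (embBall e x (2 ^ (k + 1) * σ)).indicator
        (fun _ => ENNReal.ofReal (((2 ^ k * σ) ^ (2 * n))⁻¹)) y ∂μ := setLIntegral_le_lintegral _ _
    _ = ∑' k : ℕ, ENNReal.ofReal (((2 ^ k * σ) ^ (2 * n))⁻¹) *
          μ (embBall e x (2 ^ (k + 1) * σ)) := by
        rw [lintegral_tsum fun k => (measurable_const.indicator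
          (measurableSet_embBall he x _)).aemeasurable]
        congr with k
        rw [lintegral_indicator (measurableSet_embBall he x _), setLIntegral_const]
    _ ≤ ∑' k : ℕ, ENNReal.ofReal (C₀ * 2 ^ n / σ ^ n * (1 / 2) ^ k) := by
        refine ENNReal.tsum_le_tsum fun k => ?_
        refine (mul_le_mul_right (h.measure_embBall_le x (by positivity)) _).trans ?_
        rw [← ENNReal.ofReal_mul (by positivity)]
        apply ENNReal.ofReal_le_ofReal
        have h1 : ((2 ^ k * σ) ^ (2 * n))⁻¹ * (C₀ * (2 ^ (k + 1) * σ) ^ n) =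
            C₀ * 2 ^ n / σ ^ n * ((1 / 2) ^ k) ^ n := by
          rw [one_div, inv_pow, inv_pow]
          field_simp
          ring
        rw [h1]
        gcongr
        have h2 : ((1 / 2 : ℝ) ^ k) ≤ 1 := pow_le_one₀ (by norm_num) (by norm_num)
        exact pow_le_of_le_one (by positivity) h2 (by omega)
    _ = ENNReal.ofReal (C₀ * 2 ^ (n + 1) / σ ^ n) := by
        have hs : HasSum (fun k : ℕ => C₀ * 2 ^ n / σ ^ n * (1 / 2 : ℝ) ^ k)
            (C₀ * 2 ^ n / σ ^ n * 2) := hasSum_geometric_two.mul_left _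
        rw [← ENNReal.ofReal_tsum_of_nonneg (fun k => by positivity) hs.summable, hs.tsum_eq]
        congr 1
        ring

/-- The same dyadic sum taken inwards: the integrand is of order `‖e x - e y‖ ^ (p - 2n)`, which is
integrable on an `n`-regular space because `p > n`. It is used where a Lipschitz bound meets the
singular weight. -/
theorem exists_lintegral_rpow_mul_gagliardoWeight_le (h : IsAhlfors n μ e c₀ C₀)
    (he : Measurable e) {p : ℝ} (hp : (n : ℝ) < p) :
    ∃ C : ℝ, 0 < C ∧ ∀ (x : X) (σ : ℝ), 0 < σ →
      ∫⁻ y in embBall e x σ, ENNReal.ofReal (‖e x - e y‖ ^ p) * gagliardoWeight n e x y ∂μ ≤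
        ENNReal.ofReal (C * σ ^ (p - n)) := by
  have hC := h.C_pos
  set a : ℝ := (1 / 2) ^ (p - n) with ha
  have ha0 : 0 < a := by positivity
  have ha1 : a < 1 := Real.rpow_lt_one (by norm_num) (by norm_num) (by linarith)
  have h1a : 0 < 1 - a := by linarith
  have hp0 : 0 < p := lt_of_le_of_lt (Nat.cast_nonneg n) hp
  refine ⟨C₀ * 2 ^ n * 4 ^ n * (1 - a)⁻¹, by positivity, fun x σ hσ => ?_⟩
  have hpt : ∀ y ∈ embBall e x σ, ENNReal.ofReal (‖e x - e y‖ ^ p) * gagliardoWeight n e x y ≤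
      ∑' k : ℕ, (embBall e x (2 * (σ * (1 / 2) ^ k))).indicator
        (fun _ => ENNReal.ofReal ((σ * (1 / 2) ^ k) ^ p *
          ((σ * (1 / 2) ^ k / 2) ^ (2 * n))⁻¹)) y := by
    intro y hy
    rw [mem_embBall'] at hy
    rcases (norm_nonneg (e x - e y)).eq_or_lt with h0 | h0
    · rw [← h0, Real.zero_rpow hp0.ne']; simp
    obtain ⟨k, hk1, hk2⟩ := exists_nat_pow_near (one_le_div h0 |>.2 hy.le) (one_lt_two (α := ℝ))
    rw [le_div_iff₀ h0] at hk1
    rw [div_lt_iff₀ h0] at hk2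
    have h2k : (0 : ℝ) < 2 ^ k := by positivity
    have hk1' : ‖e x - e y‖ ≤ σ * (1 / 2) ^ k := by
      rw [one_div, inv_pow, ← div_eq_mul_inv, le_div_iff₀ h2k]; linarith
    have hk2' : σ * (1 / 2) ^ k / 2 ≤ ‖e x - e y‖ := by
      rw [one_div, inv_pow, ← div_eq_mul_inv, div_div, div_le_iff₀ (by positivity)]
      rw [pow_succ] at hk2; linarith
    refine le_trans ?_ (ENNReal.le_tsum k)
    have hmem : y ∈ embBall e x (2 * (σ * (1 / 2) ^ k)) := by
      rw [mem_embBall']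
      have : 0 < σ * (1 / 2) ^ k := by positivity
      linarith
    rw [indicator_of_mem hmem, gagliardoWeight, ← ENNReal.ofReal_mul (by positivity)]
    apply ENNReal.ofReal_le_ofReal
    gcongr
  calc ∫⁻ y in embBall e x σ, ENNReal.ofReal (‖e x - e y‖ ^ p) * gagliardoWeight n e x y ∂μ
      ≤ ∫⁻ y in embBall e x σ, ∑' k : ℕ, (embBall e x (2 * (σ * (1 / 2) ^ k))).indicator
        (fun _ => ENNReal.ofReal ((σ * (1 / 2) ^ k) ^ p *
          ((σ * (1 / 2) ^ k / 2) ^ (2 * n))⁻¹)) y ∂μ :=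
        setLIntegral_mono' (measurableSet_embBall he x σ) hpt
    _ ≤ _ := setLIntegral_le_lintegral _ _
    _ = ∑' k : ℕ, ENNReal.ofReal ((σ * (1 / 2) ^ k) ^ p *
          ((σ * (1 / 2) ^ k / 2) ^ (2 * n))⁻¹) * μ (embBall e x (2 * (σ * (1 / 2) ^ k))) := by
        rw [lintegral_tsum fun k => (measurable_const.indicator
          (measurableSet_embBall he x _)).aemeasurable]
        congr with k
        rw [lintegral_indicator (measurableSet_embBall he x _), setLIntegral_const]
    _ ≤ ∑' k : ℕ, ENNReal.ofReal (C₀ * 2 ^ n * 4 ^ n * σ ^ (p - n) * a ^ k) := by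
        refine ENNReal.tsum_le_tsum fun k => ?_
        refine (mul_le_mul_right (h.measure_embBall_le x (by positivity)) _).trans ?_
        rw [← ENNReal.ofReal_mul (by positivity)]
        apply ENNReal.ofReal_le_ofReal
        have hb : 0 < σ * (1 / 2) ^ k := by positivity
        have h2 : σ ^ (p - n) * a ^ k = (σ * (1 / 2) ^ k) ^ (p - n) := by
          rw [Real.mul_rpow hσ.le (by positivity), ha, ← Real.rpow_natCast, ← Real.rpow_mul
            (by norm_num), ← Real.rpow_natCast (1 / 2 : ℝ), ← Real.rpow_mul (by norm_num),
            mul_comm (p - n)]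
        rw [mul_assoc _ (σ ^ _), h2, Real.rpow_sub hb, Real.rpow_natCast]
        apply le_of_eq
        generalize σ * (1 / 2) ^ k = b at hb
        have h4 : (4 : ℝ) ^ n = 2 ^ n * 2 ^ n := by rw [← mul_pow]; norm_num
        rw [div_pow, mul_pow 2 b, h4, two_mul, pow_add, pow_add]
        field_simp
    _ = ENNReal.ofReal (C₀ * 2 ^ n * 4 ^ n * (1 - a)⁻¹ * σ ^ (p - n)) := by
        have hs : HasSum (fun k : ℕ => C₀ * 2 ^ n * 4 ^ n * σ ^ (p - n) * a ^ k)
            (C₀ * 2 ^ n * 4 ^ n * σ ^ (p - n) * (1 - a)⁻¹) :=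
          (hasSum_geometric_of_lt_one ha0.le ha1).mul_left _
        rw [← ENNReal.ofReal_tsum_of_nonneg (fun k => by positivity) hs.summable, hs.tsum_eq]
        congr 1
        ring

end Weights

/-! ### Jensen's inequality -/

section Jensen

theorem rpow_lintegral_le_mul_lintegral_rpow {α : Type*} [MeasurableSpace α] {ν : Measure α}
    {p : ℝ} (hp : 1 ≤ p) {g : α → ℝ≥0∞} (hg : AEMeasurable g ν) :
    (∫⁻ a, g a ∂ν) ^ p ≤ ν univ ^ (p - 1) * ∫⁻ a, g a ^ p ∂ν := by
  rcases hp.eq_or_lt with rfl | hp1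
  · simp
  have hp0 : 0 < p := by linarith
  have hpq : p.HolderConjugate (p / (p - 1)) := Real.HolderConjugate.conjExponent hp1
  have h1 := ENNReal.lintegral_mul_le_Lp_mul_Lq ν hpq hg (aemeasurable_const (b := 1))
  simp only [Pi.mul_apply, mul_one, ENNReal.one_rpow, lintegral_one] at h1
  have h2 := ENNReal.rpow_le_rpow h1 hp0.le
  rw [ENNReal.mul_rpow_of_nonneg _ _ hp0.le, ← ENNReal.rpow_mul, ← ENNReal.rpow_mul,
    one_div_mul_cancel hp0.ne', ENNReal.rpow_one, mul_comm] at h2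
  convert h2 using 3
  field_simp

end Jensen

/-! ### Averaging at a variable scale -/

section Averaging

variable {X : Type*} [MeasurableSpace X]
  {E : Type*} [NormedAddCommGroup E] [MeasurableSpace E] [BorelSpace E]
  [SecondCountableTopology E]
  {V : Type*} [NormedAddCommGroup V] [NormedSpace ℝ V] [CompleteSpace V] [MeasurableSpace V]
  [BorelSpace V] [SecondCountableTopology V]

/-- A nonnegative averaging density `k`, at scale `d x` about the point `x ∈ X₀`. -/
structure IsAveraging (μ : Measure X) (n : ℕ) (e : X → E) (X₀ : Set X) (d : X → ℝ)
    (k : X → X → ℝ) (Λ l : ℝ) : Prop where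
  measurableSet : MeasurableSet X₀
  d_meas : Measurable d
  k_meas : Measurable (Function.uncurry k)
  one_le : 1 ≤ Λ
  l_pos : 0 < l
  d_nonneg : ∀ x, 0 ≤ d x
  d_lip : ∀ x ∈ X₀, ∀ x' ∈ X₀, d x ≤ d x' + ‖e x - e x'‖
  k_nonneg : ∀ x y, 0 ≤ k x y
  k_le : ∀ x ∈ X₀, ∀ y, k x y ≤ Λ * d x
  k_supp : ∀ x ∈ X₀, ∀ y, k x y ≠ 0 → ‖e x - e y‖ < Λ * d x
  k_lip : ∀ x ∈ X₀, ∀ x' ∈ X₀, ∀ y, |k x y - k x' y| ≤ Λ * ‖e x - e x'‖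
  mass : ∀ x ∈ X₀, 0 < d x → l * d x ^ (n + 1) ≤ ∫ y, k x y ∂μ
  col : ∀ y, ∫⁻ x in X₀, ENNReal.ofReal (k x y / d x ^ (n + 1)) ∂μ ≤ ENNReal.ofReal Λ

/-- The normalized density of `k`. -/
noncomputable def normDensity (μ : Measure X) (k : X → X → ℝ) (x y : X) : ℝ :=
  k x y / ∫ z, k x z ∂μ

/-- The average of `f` for the density `k`, which is `f` itself where the scale `d` vanishes. -/
noncomputable def avg (μ : Measure X) (d : X → ℝ) (k : X → X → ℝ) (f : X → V) (x : X) : V :=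
  open Classical in if d x = 0 then f x else ∫ y, normDensity μ k x y • f y ∂μ

open Classical in
/-- The averaging probability measures as a kernel. -/
noncomputable def avgKernel (μ : Measure X) [IsFiniteMeasure μ] {d : X → ℝ} (hd : Measurable d)
    (k : X → X → ℝ) : ProbabilityTheory.Kernel X X :=
  ProbabilityTheory.Kernel.piecewise (hd (measurableSet_singleton 0)) ProbabilityTheory.Kernel.id
    (ProbabilityTheory.Kernel.withDensity (ProbabilityTheory.Kernel.const X μ)
      (fun x y => ENNReal.ofReal (normDensity μ k x y)))

variable {μ : Measure X} [IsFiniteMeasure μ] {n : ℕ} {e : X → E} {X₀ : Set X} {d : X → ℝ}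
  {k : X → X → ℝ} {Λ l c₀ C₀ : ℝ}

instance (hd : Measurable d) : ProbabilityTheory.IsSFiniteKernel (avgKernel μ hd k) := by
  classical
  unfold avgKernel
  have : ProbabilityTheory.IsSFiniteKernel
      (ProbabilityTheory.Kernel.withDensity (ProbabilityTheory.Kernel.const X μ)
      (fun x y => ENNReal.ofReal (normDensity μ k x y))) :=
    ProbabilityTheory.Kernel.IsSFiniteKernel.withDensity _ fun _ _ => ENNReal.ofReal_ne_top
  infer_instance

theorem measurable_normDensity (hk : Measurable (Function.uncurry k)) :
    Measurable (Function.uncurry (normDensity μ k)) := by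
  unfold normDensity
  have h1 : Measurable (fun x => ∫ z, k x z ∂μ) :=
    (hk.stronglyMeasurable.integral_prod_right (ν := μ)).measurable
  exact hk.div (h1.comp measurable_fst)

theorem lintegral_avgKernel_of_eq_zero (hd : Measurable d) {x : X} (hx : d x = 0)
    {g : X → ℝ≥0∞} (hg : Measurable g) :
    ∫⁻ y, g y ∂(avgKernel μ hd k x) = g x := by
  classical
  rw [avgKernel, ProbabilityTheory.Kernel.lintegral_piecewise, if_pos (by simpa using hx),
    ProbabilityTheory.Kernel.id_apply, lintegral_dirac' _ hg]

theorem lintegral_avgKernel_of_ne_zero (hd : Measurable d) (hk : Measurable (Function.uncurry k))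
    {x : X} (hx : d x ≠ 0) {g : X → ℝ≥0∞} (hg : Measurable g) :
    ∫⁻ y, g y ∂(avgKernel μ hd k x) =
      ∫⁻ y, ENNReal.ofReal (normDensity μ k x y) * g y ∂μ := by
  classical
  rw [avgKernel, ProbabilityTheory.Kernel.lintegral_piecewise, if_neg (by simpa using hx),
    ProbabilityTheory.Kernel.lintegral_withDensity _ _ _ hg]
  · simp
  · exact (measurable_normDensity hk).ennreal_ofReal

namespace IsAveraging

variable (h : IsAveraging μ n e X₀ d k Λ l)
include h

theorem integrable_k {x : X} (hx : x ∈ X₀) : Integrable (k x) μ := by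
  refine Integrable.of_bound (C := Λ * d x)
    (h.k_meas.comp measurable_prodMk_left).aestronglyMeasurable (ae_of_all _ fun y => ?_)
  rw [Real.norm_eq_abs, abs_of_nonneg (h.k_nonneg x y)]
  exact h.k_le x hx y

theorem mass_pos {x : X} (hx : x ∈ X₀) (hd : d x ≠ 0) : 0 < ∫ y, k x y ∂μ := by
  have hd' := lt_of_le_of_ne (h.d_nonneg x) (Ne.symm hd)
  have := h.l_pos
  exact lt_of_lt_of_le (by positivity) (h.mass x hx hd')

theorem normDensity_nonneg (x y : X) : 0 ≤ normDensity μ k x y :=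
  div_nonneg (h.k_nonneg x y) (integral_nonneg (h.k_nonneg x))

theorem integrable_normDensity {x : X} (hx : x ∈ X₀) : Integrable (normDensity μ k x) μ :=
  (h.integrable_k hx).div_const _

theorem integral_normDensity {x : X} (hx : x ∈ X₀) (hd : d x ≠ 0) :
    ∫ y, normDensity μ k x y ∂μ = 1 := by
  unfold normDensity
  rw [integral_div, div_self (h.mass_pos hx hd).ne']

/-- The density `k` is left unnormalized, of height of order `d x` and with a Lipschitz constant
independent of the scale; its mass is then at least of order `d x ^ (n + 1)`, and normalizing
divides by this power. -/
theorem normDensity_le {x : X} (hx : x ∈ X₀) (hd : d x ≠ 0) (y : X) :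
    normDensity μ k x y ≤ k x y / (l * d x ^ (n + 1)) := by
  have hd' := lt_of_le_of_ne (h.d_nonneg x) (Ne.symm hd)
  have hl := h.l_pos
  exact div_le_div_of_nonneg_left (h.k_nonneg x y) (by positivity) (h.mass x hx hd')

theorem isProbabilityMeasure_avgKernel {x : X} (hx : x ∈ X₀) :
    IsProbabilityMeasure (avgKernel μ h.d_meas k x) := by
  refine ⟨?_⟩
  rw [← lintegral_one]
  by_cases hd : d x = 0
  · rw [lintegral_avgKernel_of_eq_zero _ hd measurable_const]
  · rw [lintegral_avgKernel_of_ne_zero _ h.k_meas hd measurable_const]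
    simp only [mul_one]
    rw [← ofReal_integral_eq_lintegral_ofReal (h.integrable_normDensity hx)
      (ae_of_all _ (h.normDensity_nonneg x)), h.integral_normDensity hx hd, ENNReal.ofReal_one]

theorem ae_avgKernel (he : Measurable e) {x : X} (hx : x ∈ X₀) :
    ∀ᵐ y ∂(avgKernel μ h.d_meas k x), ‖e x - e y‖ ≤ Λ * d x := by
  have hm : MeasurableSet {y | ¬ ‖e x - e y‖ ≤ Λ * d x} :=
    (measurableSet_le (he.const_sub _).norm measurable_const).compl
  rw [ae_iff, ← setLIntegral_one, ← lintegral_indicator hm]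
  have hg : Measurable ({y | ¬ ‖e x - e y‖ ≤ Λ * d x}.indicator fun _ => (1 : ℝ≥0∞)) :=
    measurable_const.indicator hm
  by_cases hd : d x = 0
  · rw [lintegral_avgKernel_of_eq_zero _ hd hg]
    simp [hd]
  · rw [lintegral_avgKernel_of_ne_zero _ h.k_meas hd hg]
    refine (lintegral_congr fun y => ?_).trans lintegral_zero
    by_cases hy : ‖e x - e y‖ ≤ Λ * d x
    · rw [indicator_of_notMem (by simpa using hy), mul_zero]
    · have : k x y = 0 := by
        by_contra h0
        exact hy (h.k_supp x hx y h0).le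
      simp [normDensity, this]

theorem lintegral_avgKernel_le {x : X} (he : Measurable e) (hx : x ∈ X₀) (hd : d x ≠ 0)
    {g : X → ℝ≥0∞} (hg : Measurable g) :
    ∫⁻ y, g y ∂(avgKernel μ h.d_meas k x) ≤
      ENNReal.ofReal (Λ / (l * d x ^ n)) * ∫⁻ y in embBall e x (Λ * d x), g y ∂μ := by
  have hd' := lt_of_le_of_ne (h.d_nonneg x) (Ne.symm hd)
  have hl := h.l_pos
  rw [lintegral_avgKernel_of_ne_zero _ h.k_meas hd hg, ← lintegral_const_mul _ hg,
    ← lintegral_indicator (measurableSet_embBall he _ _)]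
  refine lintegral_mono fun y => ?_
  by_cases hy : y ∈ embBall e x (Λ * d x)
  · rw [indicator_of_mem hy]
    gcongr
    refine (h.normDensity_le hx hd y).trans ?_
    rw [div_le_div_iff₀ (by positivity) (by positivity)]
    calc k x y * (l * d x ^ n) ≤ (Λ * d x) * (l * d x ^ n) := by
          gcongr; exact h.k_le x hx y
      _ = _ := by ring
  · rw [indicator_of_notMem hy]
    have : k x y = 0 := by
      by_contra h0
      exact hy (mem_embBall'.2 (h.k_supp x hx y h0))
    simp [normDensity, this]

/-- By Tonelli it suffices to bound the total weight that a point `y` receives from all `x`: this is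
the column bound `col`, plus 1 for the Dirac masses where the scale vanishes. -/
theorem lintegral_lintegral_avgKernel_le {g : X → ℝ≥0∞} (hg : Measurable g) :
    ∫⁻ x in X₀, ∫⁻ y, g y ∂(avgKernel μ h.d_meas k x) ∂μ ≤
      ENNReal.ofReal (1 + Λ / l) * ∫⁻ y, g y ∂μ := by
  have hl := h.l_pos
  have hΛ := h.one_le
  have hkd : Measurable (fun z : X × X => ENNReal.ofReal (k z.1 z.2 / d z.1 ^ (n + 1))) :=
    (h.k_meas.div ((h.d_meas.comp measurable_fst).pow_const _)).ennreal_ofReal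
  have h1 : ∀ x ∈ X₀, ∫⁻ y, g y ∂(avgKernel μ h.d_meas k x) ≤
      g x + ENNReal.ofReal (1 / l) *
        ∫⁻ y, ENNReal.ofReal (k x y / d x ^ (n + 1)) * g y ∂μ := by
    intro x hx
    by_cases hd : d x = 0
    · rw [lintegral_avgKernel_of_eq_zero _ hd hg]
      exact le_self_add
    · have hd' := lt_of_le_of_ne (h.d_nonneg x) (Ne.symm hd)
      rw [lintegral_avgKernel_of_ne_zero _ h.k_meas hd hg]
      refine le_trans ?_ le_add_self
      have hkx : Measurable fun y => ENNReal.ofReal (k x y / d x ^ (n + 1)) :=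
        hkd.comp (measurable_prodMk_left (x := x))
      have hkg : Measurable fun y => ENNReal.ofReal (k x y / d x ^ (n + 1)) * g y := hkx.mul hg
      rw [← lintegral_const_mul _ hkg]
      refine lintegral_mono fun y => ?_
      rw [← mul_assoc, ← ENNReal.ofReal_mul (by positivity)]
      gcongr
      refine (h.normDensity_le hx hd y).trans (le_of_eq ?_)
      field_simp
  have hm2 : Measurable (fun z : X × X => ENNReal.ofReal (k z.1 z.2 / d z.1 ^ (n + 1)) * g z.2) :=
    hkd.mul (hg.comp measurable_snd)
  calc _ ≤ ∫⁻ x in X₀, (g x + ENNReal.ofReal (1 / l) *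
        ∫⁻ y, ENNReal.ofReal (k x y / d x ^ (n + 1)) * g y ∂μ) ∂μ :=
        setLIntegral_mono' h.measurableSet h1
    _ = ∫⁻ x in X₀, g x ∂μ + ENNReal.ofReal (1 / l) * ∫⁻ x in X₀,
        ∫⁻ y, ENNReal.ofReal (k x y / d x ^ (n + 1)) * g y ∂μ ∂μ := by
        rw [lintegral_add_left hg, lintegral_const_mul _ hm2.lintegral_prod_right']
    _ = ∫⁻ x in X₀, g x ∂μ + ENNReal.ofReal (1 / l) * ∫⁻ y, (∫⁻ x in X₀,
        ENNReal.ofReal (k x y / d x ^ (n + 1)) ∂μ) * g y ∂μ := by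
        rw [lintegral_lintegral_swap hm2.aemeasurable]
        congr 2
        refine lintegral_congr fun y => ?_
        have hky : Measurable fun x => ENNReal.ofReal (k x y / d x ^ (n + 1)) :=
          hkd.comp (measurable_prodMk_right (y := y))
        rw [lintegral_mul_const _ hky]
    _ ≤ ∫⁻ x, g x ∂μ + ENNReal.ofReal (1 / l) * (ENNReal.ofReal Λ * ∫⁻ y, g y ∂μ) := by
        rw [← lintegral_const_mul _ hg]
        gcongr
        · exact Measure.restrict_le_self
        · exact h.col _
    _ = _ := by
        rw [← mul_assoc, ← ENNReal.ofReal_mul (by positivity),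
          ENNReal.ofReal_add (by positivity) (by positivity), ENNReal.ofReal_one, add_mul, one_mul]
        congr 3
        ring

variable {f : X → V} {b : ℝ}

theorem integrable_smul (hf : Measurable f) (hb : ∀ y, ‖f y‖ ≤ b) {x : X} (hx : x ∈ X₀) :
    Integrable (fun y => normDensity μ k x y • f y) μ :=
  (h.integrable_normDensity hx).smul_bdd b hf.aestronglyMeasurable (ae_of_all _ hb)

theorem avg_sub_eq (hf : Measurable f) (hb : ∀ y, ‖f y‖ ≤ b) {x : X} (hx : x ∈ X₀)
    (hd : d x ≠ 0) (a : V) :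
    avg μ d k f x - a = ∫ y, normDensity μ k x y • (f y - a) ∂μ := by
  simp_rw [smul_sub]
  rw [integral_sub (h.integrable_smul hf hb hx) ((h.integrable_normDensity hx).smul_const a),
    integral_smul_const, h.integral_normDensity hx hd, one_smul, avg, if_neg hd]

/-- Jensen for the averaging probability measure, Dirac or not. The constant `a` is free, so that
for a difference of two averages it can be applied in one variable and then in the other. -/
theorem enorm_avg_sub_rpow_le (hf : Measurable f) (hb : ∀ y, ‖f y‖ ≤ b) {x : X} (hx : x ∈ X₀)
    {p : ℝ} (hp : 1 ≤ p) (a : V) :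
    ‖avg μ d k f x - a‖ₑ ^ p ≤ ∫⁻ y, ‖f y - a‖ₑ ^ p ∂(avgKernel μ h.d_meas k x) := by
  have hm : Measurable fun y => ‖f y - a‖ₑ := (hf.sub_const a).enorm
  have h1 : ‖avg μ d k f x - a‖ₑ ≤ ∫⁻ y, ‖f y - a‖ₑ ∂(avgKernel μ h.d_meas k x) := by
    by_cases hd : d x = 0
    · rw [lintegral_avgKernel_of_eq_zero _ hd hm, avg, if_pos hd]
    · rw [lintegral_avgKernel_of_ne_zero _ h.k_meas hd hm, h.avg_sub_eq hf hb hx hd]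
      refine (enorm_integral_le_lintegral_enorm _).trans (lintegral_mono fun y => ?_)
      simp only
      rw [enorm_smul, Real.enorm_of_nonneg (h.normDensity_nonneg x y)]
  have := h.isProbabilityMeasure_avgKernel hx
  calc ‖avg μ d k f x - a‖ₑ ^ p ≤ (∫⁻ y, ‖f y - a‖ₑ ∂(avgKernel μ h.d_meas k x)) ^ p := by
        gcongr
    _ ≤ _ := rpow_lintegral_le_mul_lintegral_rpow hp hm.aemeasurable
    _ = _ := by simp

theorem measurable_avg (hf : Measurable f) : Measurable (avg μ d k f) := by
  classical
  have h1 : StronglyMeasurable (fun x => ∫ y, normDensity μ k x y • f y ∂μ) :=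
    ((measurable_normDensity h.k_meas).smul
      (hf.comp measurable_snd)).stronglyMeasurable.integral_prod_right (ν := μ)
  exact Measurable.ite (h.d_meas (measurableSet_singleton 0)) hf h1.measurable

end IsAveraging

end Averaging

/-! ### Differences of averages at points closer than the scale -/

section NearPairs

variable {X : Type*} [MeasurableSpace X]
  {E : Type*} [NormedAddCommGroup E] [MeasurableSpace E] [BorelSpace E]
  [SecondCountableTopology E]
  {V : Type*} [NormedAddCommGroup V] [NormedSpace ℝ V] [CompleteSpace V] [MeasurableSpace V]
  [BorelSpace V] [SecondCountableTopology V]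
  {μ : Measure X} [IsFiniteMeasure μ] {n : ℕ} {e : X → E} {X₀ : Set X} {d : X → ℝ}
  {k : X → X → ℝ} {Λ l c₀ C₀ : ℝ}

/-- The powers of `d` add up to `-(n+1)p + n(p-1) - n = -p - 2n`. -/
theorem near_pair_exponents (n : ℕ) {p a B D t d : ℝ} (ha : 0 ≤ a) (hB : 0 ≤ B) (ht : 0 ≤ t)
    (hd : 0 < d) :
    (a * t / d ^ (n + 1)) ^ p * (B * d ^ n) ^ (p - 1) * (D / d ^ n) =
      a ^ p * B ^ (p - 1) * D * (t ^ p / (d ^ p * d ^ (2 * n))) := by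
  have h0 : 0 < d ^ n := by positivity
  rw [Real.div_rpow (by positivity) (by positivity), Real.mul_rpow ha ht,
    Real.mul_rpow hB h0.le, Real.rpow_sub h0, Real.rpow_one, pow_succ,
    Real.mul_rpow h0.le hd.le, two_mul, pow_add]
  have h1 : 0 < (d ^ n) ^ p := by positivity
  have h2 : 0 < d ^ p := by positivity
  field_simp

theorem measurable_enorm_sub_rpow {f : X → V} (hf : Measurable f) (p : ℝ) :
    Measurable (fun w : X × X => ‖f w.1 - f w.2‖ₑ ^ p) :=
  ((hf.comp measurable_fst).sub (hf.comp measurable_snd)).enorm.pow_const _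

namespace IsAveraging

variable (h : IsAveraging μ n e X₀ d k Λ l)
include h

variable {f : X → V} {b : ℝ}

theorem setLIntegral_enorm_sub_avg_rpow_le (he : Measurable e) (hf : Measurable f)
    (hb : ∀ y, ‖f y‖ ≤ b) {p : ℝ} (hp : 1 ≤ p) {x : X} (hx : x ∈ X₀) (hd : d x ≠ 0) :
    ∫⁻ y in embBall e x (2 * Λ * d x), ‖f y - avg μ d k f x‖ₑ ^ p ∂μ ≤
      ENNReal.ofReal (Λ / (l * d x ^ n)) *
        ∫⁻ w in embBall e x (2 * Λ * d x) ×ˢ embBall e x (2 * Λ * d x),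
          ‖f w.1 - f w.2‖ₑ ^ p ∂(μ.prod μ) := by
  have hd' := lt_of_le_of_ne (h.d_nonneg x) (Ne.symm hd)
  have hΛ := h.one_le
  have hm := measurable_enorm_sub_rpow hf p
  rw [← Measure.prod_restrict, lintegral_prod _ hm.aemeasurable,
    ← lintegral_const_mul _ hm.lintegral_prod_right']
  refine lintegral_mono fun y => ?_
  have hmy : Measurable fun z => ‖f z - f y‖ₑ ^ p := (hf.sub_const _).enorm.pow_const _
  calc ‖f y - avg μ d k f x‖ₑ ^ p = ‖avg μ d k f x - f y‖ₑ ^ p := by rw [enorm_sub_rev]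
    _ ≤ _ := h.enorm_avg_sub_rpow_le hf hb hx hp (f y)
    _ ≤ _ := h.lintegral_avgKernel_le he hx hd hmy
    _ ≤ _ := by
      refine mul_le_mul_right ((lintegral_mono_set
        (?_ : embBall e x (Λ * d x) ⊆ embBall e x (2 * Λ * d x))).trans ?_) _
      · intro z hz
        rw [mem_embBall] at hz ⊢
        nlinarith [mul_pos (lt_of_lt_of_le one_pos hΛ) hd']
      · refine lintegral_mono fun z => ?_
        rw [enorm_sub_rev]

/-- `f - avg f x` integrates to zero against `k x`, so `k x` may be subtracted from `k x'` for free.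
The remaining factor `k x' - k x` is small by the Lipschitz bound. -/
theorem avg_sub_avg_eq (hf : Measurable f) (hb : ∀ y, ‖f y‖ ≤ b) {x x' : X} (hx : x ∈ X₀)
    (hx' : x' ∈ X₀) (hd : d x ≠ 0) (hd' : d x' ≠ 0) :
    avg μ d k f x' - avg μ d k f x =
      (∫ z, k x' z ∂μ)⁻¹ • ∫ y, (k x' y - k x y) • (f y - avg μ d k f x) ∂μ := by
  have hint : ∀ x ∈ X₀, ∀ a : V, Integrable (fun y => k x y • (f y - a)) μ := fun x hx a =>
    (h.integrable_k hx).smul_bdd (b + ‖a‖) (hf.sub_const a).aestronglyMeasurable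
      (ae_of_all _ fun y => (norm_sub_le _ _).trans (by gcongr; exact hb y))
  have h1 : ∀ x ∈ X₀, ∀ a : V, ∫ y, normDensity μ k x y • (f y - a) ∂μ =
      (∫ z, k x z ∂μ)⁻¹ • ∫ y, k x y • (f y - a) ∂μ := by
    intro x hx a
    rw [← integral_smul]
    refine integral_congr_ae (ae_of_all _ fun y => ?_)
    simp only [normDensity, smul_smul]
    rw [div_eq_inv_mul]
  have h2 : ∫ y, k x y • (f y - avg μ d k f x) ∂μ = 0 := by
    have h3 := h.avg_sub_eq hf hb hx hd (avg μ d k f x)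
    rw [sub_self, h1 x hx] at h3
    exact (smul_eq_zero.1 h3.symm).resolve_left (inv_ne_zero (h.mass_pos hx hd).ne')
  simp_rw [sub_smul]
  rw [integral_sub (hint x' hx' _) (hint x hx _), h2, sub_zero, ← h1 x' hx',
    h.avg_sub_eq hf hb hx' hd']

/-- The scales at `x` and `x'` are comparable here, so the Lipschitz bound on `k` and the lower
bound on the mass give the factor `‖e x - e x'‖ / d x ^ (n + 1)`. Hölder and Jensen then turn the
oscillation of `f` about its average into a double integral over one ball. -/
theorem near_pair_le (hA : IsAhlfors n μ e c₀ C₀) (he : Measurable e) (hf : Measurable f)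
    (hb : ∀ y, ‖f y‖ ≤ b) {p : ℝ} (hp : 1 ≤ p) {x x' : X} (hx : x ∈ X₀) (hx' : x' ∈ X₀)
    (hd : d x ≠ 0) (ht : ‖e x - e x'‖ < d x / 2) :
    ‖avg μ d k f x' - avg μ d k f x‖ₑ ^ p ≤
      ENNReal.ofReal ((Λ * 2 ^ (n + 1) / l) ^ p * (C₀ * (2 * Λ) ^ n) ^ (p - 1) * (Λ / l) *
        (‖e x - e x'‖ ^ p / (d x ^ p * d x ^ (2 * n)))) *
        ∫⁻ w in embBall e x (2 * Λ * d x) ×ˢ embBall e x (2 * Λ * d x),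
          ‖f w.1 - f w.2‖ₑ ^ p ∂(μ.prod μ) := by
  have hd0 := lt_of_le_of_ne (h.d_nonneg x) (Ne.symm hd)
  have hΛ := h.one_le
  have hl := h.l_pos
  have hC := hA.C_pos
  have hdx' : d x / 2 ≤ d x' := by
    have := h.d_lip x hx x' hx'
    linarith
  have hd0' : 0 < d x' := by linarith
  set t := ‖e x - e x'‖ with htdef
  set B := embBall e x (2 * Λ * d x) with hB
  have hBm : MeasurableSet B := measurableSet_embBall he _ _
  have hmB : Measurable fun y => ‖f y - avg μ d k f x‖ₑ := (hf.sub_const _).enorm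
  have h1 : ‖avg μ d k f x' - avg μ d k f x‖ₑ ≤
      ENNReal.ofReal (Λ * 2 ^ (n + 1) / l * t / d x ^ (n + 1)) *
        ∫⁻ y in B, ‖f y - avg μ d k f x‖ₑ ∂μ := by
    -- As `d x' ≤ 3/2 * d x`, the support about `x'` lies within `d x / 2 + 3/2 * Λ * d x ≤ 2 * Λ *
    -- d x` of `x`.
    have hsub : ∀ y, y ∉ B → k x' y - k x y = 0 := by
      intro y hy
      rw [hB, mem_embBall', not_lt] at hy
      have hΛd : 0 < Λ * d x := by positivity
      have e1 : k x y = 0 := by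
        by_contra h0
        have := h.k_supp x hx y h0
        nlinarith
      have e2 : k x' y = 0 := by
        by_contra h0
        have h3 := h.k_supp x' hx' y h0
        have h4 : ‖e x - e y‖ ≤ t + ‖e x' - e y‖ := norm_sub_le_norm_sub_add_norm_sub ..
        have h5 := h.d_lip x' hx' x hx
        rw [norm_sub_rev, ← htdef] at h5
        nlinarith
      rw [e1, e2, sub_zero]
    rw [h.avg_sub_avg_eq hf hb hx hx' hd hd0'.ne', enorm_smul]
    calc _ ≤ ‖(∫ z, k x' z ∂μ)⁻¹‖ₑ *
          ∫⁻ y, ‖(k x' y - k x y) • (f y - avg μ d k f x)‖ₑ ∂μ := by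
          gcongr; exact enorm_integral_le_lintegral_enorm _
      _ ≤ ENNReal.ofReal ((l * (d x / 2) ^ (n + 1))⁻¹) *
          ∫⁻ y in B, ENNReal.ofReal (Λ * t) * ‖f y - avg μ d k f x‖ₑ ∂μ := by
          refine mul_le_mul' ?_ ?_
          · rw [Real.enorm_of_nonneg (inv_nonneg.2 (h.mass_pos hx' hd0'.ne').le)]
            apply ENNReal.ofReal_le_ofReal
            refine inv_anti₀ (by positivity) (le_trans ?_ (h.mass x' hx' hd0'))
            gcongr
          · rw [← lintegral_indicator hBm]
            refine lintegral_mono fun y => ?_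
            by_cases hy : y ∈ B
            · rw [indicator_of_mem hy, enorm_smul]
              gcongr
              rw [← ofReal_norm, Real.norm_eq_abs]
              apply ENNReal.ofReal_le_ofReal
              rw [abs_sub_comm]
              exact h.k_lip x hx x' hx' y
            · rw [indicator_of_notMem hy, hsub y hy, zero_smul, enorm_zero]
      _ = _ := by
          rw [lintegral_const_mul _ hmB, ← mul_assoc, ← ENNReal.ofReal_mul (by positivity)]
          congr 2
          rw [div_pow]
          field_simp
  have hp1 : 0 ≤ p - 1 := by linarith
  have hp0 : 0 ≤ p := by linarith
  calc ‖avg μ d k f x' - avg μ d k f x‖ₑ ^ p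
      ≤ (ENNReal.ofReal (Λ * 2 ^ (n + 1) / l * t / d x ^ (n + 1)) *
        ∫⁻ y in B, ‖f y - avg μ d k f x‖ₑ ∂μ) ^ p := by gcongr
    _ = ENNReal.ofReal (Λ * 2 ^ (n + 1) / l * t / d x ^ (n + 1)) ^ p *
        (∫⁻ y in B, ‖f y - avg μ d k f x‖ₑ ∂μ) ^ p := ENNReal.mul_rpow_of_nonneg _ _ hp0
    _ ≤ ENNReal.ofReal (Λ * 2 ^ (n + 1) / l * t / d x ^ (n + 1)) ^ p *
        (ENNReal.ofReal (C₀ * (2 * Λ) ^ n * d x ^ n) ^ (p - 1) *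
        (ENNReal.ofReal (Λ / (l * d x ^ n)) * ∫⁻ w in B ×ˢ B, ‖f w.1 - f w.2‖ₑ ^ p ∂(μ.prod μ))) := by
        gcongr
        refine (rpow_lintegral_le_mul_lintegral_rpow hp hmB.aemeasurable).trans ?_
        gcongr
        · rw [Measure.restrict_apply_univ]
          refine (hA.measure_embBall_le x (by positivity)).trans (le_of_eq ?_)
          rw [mul_pow _ (d x), mul_assoc]
        · exact h.setLIntegral_enorm_sub_avg_rpow_le he hf hb hp hx hd
    _ = _ := by
        rw [← mul_assoc, ← mul_assoc, ENNReal.ofReal_rpow_of_nonneg (by positivity) hp0,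
          ENNReal.ofReal_rpow_of_nonneg (by positivity) hp1, ← ENNReal.ofReal_mul (by positivity),
          ← ENNReal.ofReal_mul (by positivity),
          ← near_pair_exponents n (by positivity) (by positivity) (norm_nonneg _) hd0, div_div]

end IsAveraging

end NearPairs

/-! ### Summing the near-pair bounds over all base points -/

section EnergyEstimate

variable {X : Type*} [MeasurableSpace X]
  {E : Type*} [NormedAddCommGroup E] [MeasurableSpace E] [BorelSpace E]
  [SecondCountableTopology E]
  {V : Type*} [NormedAddCommGroup V] [NormedSpace ℝ V] [CompleteSpace V] [MeasurableSpace V]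
  [BorelSpace V] [SecondCountableTopology V]

/-- The part of the Gagliardo energy of `f` that comes from the pairs in `T`. -/
noncomputable def energyOn (μ : Measure X) (n : ℕ) (e : X → E) (p : ℝ) (f : X → V)
    (T : Set (X × X)) : ℝ≥0∞ :=
  ∫⁻ w in T, ‖f w.1 - f w.2‖ₑ ^ p * gagliardoWeight n e w.1 w.2 ∂(μ.prod μ)

/-- The pairs of points at distance less than `δ`. -/
def closePairs (e : X → E) (δ : ℝ) : Set (X × X) := {w | ‖e w.1 - e w.2‖ < δ}

theorem measurableSet_closePairs {e : X → E} (he : Measurable e) (δ : ℝ) :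
    MeasurableSet (closePairs e δ) :=
  measurableSet_lt (measurable_emb_dist he) measurable_const

theorem measurable_energyDensity {e : X → E} (he : Measurable e) {f : X → V} (hf : Measurable f)
    (n : ℕ) (p : ℝ) :
    Measurable (fun w : X × X => ‖f w.1 - f w.2‖ₑ ^ p * gagliardoWeight n e w.1 w.2) :=
  (measurable_enorm_sub_rpow hf p).mul (measurable_gagliardoWeight he)

variable {μ : Measure X} [IsFiniteMeasure μ] {n : ℕ} {e : X → E} {X₀ : Set X} {d : X → ℝ}
  {k : X → X → ℝ} {Λ l c₀ C₀ : ℝ}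

namespace IsAveraging

variable (h : IsAveraging μ n e X₀ d k Λ l)
include h

/-- Let `τ` be the distance of the two points `y, z` of `w`. A base point `x` whose ball contains
both has `d x ≥ τ / (4Λ)` and `d x ≥ ‖e y - e x‖ / (4Λ)`. Within `τ` of `y` all `3n` factors are
bounded by the first inequality and the mass is of order `τ ^ n`. Further out, `n` factors use the
first and `2n` the second, and the tail of the weight is of order `τ ^ (-n)`. Both parts are of
order `τ ^ (-2n)`. -/
theorem lintegral_inv_scale_le (hA : IsAhlfors n μ e c₀ C₀) (he : Measurable e) (hn : 1 ≤ n)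
    {w : X × X} (hw : 0 < ‖e w.1 - e w.2‖) :
    ∫⁻ x in X₀, {x | d x ≠ 0 ∧ w ∈ embBall e x (2 * Λ * d x) ×ˢ embBall e x (2 * Λ * d x)}.indicator
        (fun x => ENNReal.ofReal (1 / d x ^ (3 * n))) x ∂μ ≤
      ENNReal.ofReal (C₀ * (4 * Λ) ^ (3 * n) * 2 ^ (n + 2)) * gagliardoWeight n e w.1 w.2 := by
  obtain ⟨y, z⟩ := w
  simp only at hw ⊢
  set τ := ‖e y - e z‖ with hτ
  have hΛ := h.one_le
  have hC := hA.C_pos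
  have hΛ0 : 0 < Λ := by linarith
  set B := embBall e y τ with hB
  have hBm : MeasurableSet B := measurableSet_embBall he _ _
  have hpt : ∀ x, {x | d x ≠ 0 ∧ (y, z) ∈ embBall e x (2 * Λ * d x) ×ˢ
      embBall e x (2 * Λ * d x)}.indicator (fun x => ENNReal.ofReal (1 / d x ^ (3 * n))) x ≤
      B.indicator (fun _ => ENNReal.ofReal ((4 * Λ / τ) ^ (3 * n))) x +
      Bᶜ.indicator (fun x => ENNReal.ofReal ((4 * Λ) ^ (3 * n) / τ ^ n) *
        gagliardoWeight n e y x) x := by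
    intro x
    by_cases hx : x ∈ {x | d x ≠ 0 ∧ (y, z) ∈ embBall e x (2 * Λ * d x) ×ˢ
      embBall e x (2 * Λ * d x)}
    · rw [indicator_of_mem hx]
      obtain ⟨hd, hy, hz⟩ := hx
      have hd0 := lt_of_le_of_ne (h.d_nonneg x) (Ne.symm hd)
      rw [mem_embBall] at hy hz
      simp only at hy hz
      have h1 : τ ≤ 4 * Λ * d x := by
        have : τ ≤ ‖e y - e x‖ + ‖e x - e z‖ := norm_sub_le_norm_sub_add_norm_sub ..
        rw [norm_sub_rev (e x)] at this
        linarith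
      by_cases hxB : x ∈ B
      · rw [indicator_of_mem hxB, indicator_of_notMem (by simpa using hxB), add_zero]
        apply ENNReal.ofReal_le_ofReal
        rw [← one_div_pow]
        refine pow_le_pow_left₀ (by positivity) ?_ _
        rw [div_le_div_iff₀ hd0 hw]
        linarith
      · rw [indicator_of_notMem hxB, indicator_of_mem (by simpa using hxB), zero_add,
          gagliardoWeight, ← ENNReal.ofReal_mul (by positivity)]
        rw [hB, mem_embBall', not_lt] at hxB
        have hyx : 0 < ‖e y - e x‖ := hw.trans_le hxB
        apply ENNReal.ofReal_le_ofReal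
        have h2 : 1 / d x ≤ 4 * Λ / τ := by
          rw [div_le_div_iff₀ hd0 hw]; linarith
        have h3 : 1 / d x ≤ 4 * Λ / ‖e y - e x‖ := by
          rw [div_le_div_iff₀ hd0 hyx]; nlinarith
        calc 1 / d x ^ (3 * n) = (1 / d x) ^ n * (1 / d x) ^ (2 * n) := by
              rw [← pow_add, one_div_pow]; congr 2; ring
          _ ≤ (4 * Λ / τ) ^ n * (4 * Λ / ‖e y - e x‖) ^ (2 * n) := by gcongr
          _ = _ := by
              rw [div_pow, div_pow, show 3 * n = n + 2 * n by ring, pow_add]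
              field_simp
    · rw [indicator_of_notMem hx]
      exact zero_le
  have hm : Measurable (gagliardoWeight n e y) :=
    (measurable_gagliardoWeight he).comp measurable_prodMk_left
  calc _ ≤ ∫⁻ x, (B.indicator (fun _ => ENNReal.ofReal ((4 * Λ / τ) ^ (3 * n))) x +
      Bᶜ.indicator (fun x => ENNReal.ofReal ((4 * Λ) ^ (3 * n) / τ ^ n) *
        gagliardoWeight n e y x) x) ∂μ :=
        (setLIntegral_le_lintegral _ _).trans (lintegral_mono hpt)
    _ = ENNReal.ofReal ((4 * Λ / τ) ^ (3 * n)) * μ B +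
        ENNReal.ofReal ((4 * Λ) ^ (3 * n) / τ ^ n) * ∫⁻ x in Bᶜ, gagliardoWeight n e y x ∂μ := by
        rw [lintegral_add_left (measurable_const.indicator hBm), lintegral_indicator hBm,
          lintegral_indicator hBm.compl, lintegral_const_mul _ hm, setLIntegral_const]
    _ ≤ ENNReal.ofReal ((4 * Λ / τ) ^ (3 * n)) * ENNReal.ofReal (C₀ * τ ^ n) +
        ENNReal.ofReal ((4 * Λ) ^ (3 * n) / τ ^ n) * ENNReal.ofReal (C₀ * 2 ^ (n + 1) / τ ^ n) := by
        gcongr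
        · exact hA.measure_embBall_le y hw
        · exact lintegral_gagliardoWeight_compl_embBall_le hA he hn y hw
    _ ≤ _ := by
        rw [gagliardoWeight, ← ENNReal.ofReal_mul (by positivity),
          ← ENNReal.ofReal_mul (by positivity), ← ENNReal.ofReal_mul (by positivity),
          ← ENNReal.ofReal_add (by positivity) (by positivity)]
        apply ENNReal.ofReal_le_ofReal
        have e1 : (4 * Λ / τ) ^ (3 * n) * (C₀ * τ ^ n) + (4 * Λ) ^ (3 * n) / τ ^ n *
            (C₀ * 2 ^ (n + 1) / τ ^ n) =
            C₀ * (4 * Λ) ^ (3 * n) * (1 + 2 ^ (n + 1)) * (τ ^ (2 * n))⁻¹ := by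
          rw [div_pow, show 3 * n = n + (n + n) by ring, show 2 * n = n + n by ring, pow_add τ,
            pow_add τ]
          field_simp
        rw [e1]
        have e2 : (1 : ℝ) + 2 ^ (n + 1) ≤ 2 ^ (n + 2) := by
          have : (1 : ℝ) ≤ 2 ^ (n + 1) := one_le_pow₀ (by norm_num)
          rw [pow_succ _ (n + 1)]; linarith
        gcongr

variable {f : X → V} {b : ℝ}

/-- Tonelli, integrating over the base point first. A ball of radius `2 * Λ * d x` contains only
pairs at distance below `4 * Λ * D`, which is why only the energy of close pairs appears. -/
theorem lintegral_scale_mul_le (hA : IsAhlfors n μ e c₀ C₀) (he : Measurable e)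
    (hinj : Function.Injective e) (hn : 1 ≤ n) (hf : Measurable f) {p : ℝ} (hp : 0 < p) {D δ : ℝ}
    (hD : ∀ x ∈ X₀, d x ≤ D) (hδ : 4 * Λ * D ≤ δ) :
    ∫⁻ x in X₀, {x | d x ≠ 0}.indicator (fun x => ENNReal.ofReal (1 / d x ^ (3 * n)) *
        ∫⁻ w in embBall e x (2 * Λ * d x) ×ˢ embBall e x (2 * Λ * d x),
          ‖f w.1 - f w.2‖ₑ ^ p ∂(μ.prod μ)) x ∂μ ≤
      ENNReal.ofReal (C₀ * (4 * Λ) ^ (3 * n) * 2 ^ (n + 2)) *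
        energyOn μ n e p f (closePairs e δ) := by
  have hΛ := h.one_le
  set S : Set (X × (X × X)) := {q | d q.1 ≠ 0 ∧
    q.2 ∈ embBall e q.1 (2 * Λ * d q.1) ×ˢ embBall e q.1 (2 * Λ * d q.1)} with hS
  have hd1 : Measurable fun q : X × (X × X) => d q.1 := h.d_meas.comp measurable_fst
  have hSm : MeasurableSet S := by
    refine MeasurableSet.inter (hd1 (measurableSet_singleton 0)).compl ?_
    refine MeasurableSet.inter (s₁ := {q : X × (X × X) | ‖e q.2.1 - e q.1‖ < 2 * Λ * d q.1})
      (s₂ := {q : X × (X × X) | ‖e q.2.2 - e q.1‖ < 2 * Λ * d q.1}) ?_ ?_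
    · exact measurableSet_lt ((he.comp (measurable_fst.comp measurable_snd)).sub
        (he.comp measurable_fst)).norm (hd1.const_mul _)
    · exact measurableSet_lt ((he.comp (measurable_snd.comp measurable_snd)).sub
        (he.comp measurable_fst)).norm (hd1.const_mul _)
  have hmf := measurable_enorm_sub_rpow hf p
  set g : X → X × X → ℝ≥0∞ := fun x w => S.indicator (fun q =>
    ENNReal.ofReal (1 / d q.1 ^ (3 * n)) * ‖f q.2.1 - f q.2.2‖ₑ ^ p) (x, w) with hg
  have hd3 : Measurable fun x => ENNReal.ofReal (1 / d x ^ (3 * n)) :=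
    ((h.d_meas.pow_const _).const_div _).ennreal_ofReal
  have hgm : Measurable (Function.uncurry g) :=
    (((hd3.comp measurable_fst).mul (hmf.comp measurable_snd))).indicator hSm
  have e1 : ∀ x, {x | d x ≠ 0}.indicator (fun x => ENNReal.ofReal (1 / d x ^ (3 * n)) *
        ∫⁻ w in embBall e x (2 * Λ * d x) ×ˢ embBall e x (2 * Λ * d x),
          ‖f w.1 - f w.2‖ₑ ^ p ∂(μ.prod μ)) x ≤ ∫⁻ w, g x w ∂(μ.prod μ) := by
    intro x
    by_cases hx : d x = 0
    · rw [indicator_of_notMem (by simpa using hx)]; exact zero_le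
    rw [indicator_of_mem (by exact hx), ← lintegral_const_mul _ hmf,
      ← lintegral_indicator ((measurableSet_embBall he _ _).prod (measurableSet_embBall he _ _))]
    refine lintegral_mono fun w => ?_
    by_cases hw : w ∈ embBall e x (2 * Λ * d x) ×ˢ embBall e x (2 * Λ * d x)
    · rw [indicator_of_mem hw, hg]
      have : (x, w) ∈ S := ⟨hx, hw⟩
      simp only [indicator_of_mem this, le_refl]
    · rw [indicator_of_notMem hw]; exact zero_le
  calc _ ≤ ∫⁻ x in X₀, ∫⁻ w, g x w ∂(μ.prod μ) ∂μ := lintegral_mono e1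
    _ = ∫⁻ w, ∫⁻ x in X₀, g x w ∂μ ∂(μ.prod μ) := lintegral_lintegral_swap hgm.aemeasurable
    _ ≤ ∫⁻ w, ENNReal.ofReal (C₀ * (4 * Λ) ^ (3 * n) * 2 ^ (n + 2)) *
        (closePairs e δ).indicator
          (fun w => ‖f w.1 - f w.2‖ₑ ^ p * gagliardoWeight n e w.1 w.2) w ∂(μ.prod μ) := by
        refine lintegral_mono fun w => ?_
        -- Diagonal pairs are set aside: there the integrand vanishes, and the scale estimate needs
        -- a positive distance.
        rcases (norm_nonneg (e w.1 - e w.2)).eq_or_lt with hw | hw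
        · have h12 : w.1 = w.2 := hinj (sub_eq_zero.1 (norm_eq_zero.1 hw.symm))
          refine le_trans (le_of_eq ?_) (zero_le)
          refine (lintegral_congr fun x => ?_).trans lintegral_zero
          rw [hg]
          simp only [indicator]
          simp [h12, hp]
        by_cases hwδ : w ∈ closePairs e δ
        · rw [indicator_of_mem hwδ]
          have e2 : ∀ x, g x w = ‖f w.1 - f w.2‖ₑ ^ p * {x | d x ≠ 0 ∧
              w ∈ embBall e x (2 * Λ * d x) ×ˢ embBall e x (2 * Λ * d x)}.indicator
              (fun x => ENNReal.ofReal (1 / d x ^ (3 * n))) x := by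
            intro x
            by_cases hx : d x ≠ 0 ∧ w ∈ embBall e x (2 * Λ * d x) ×ˢ embBall e x (2 * Λ * d x)
            · rw [indicator_of_mem (by exact hx), hg]
              have : (x, w) ∈ S := hx
              simp only [indicator_of_mem this, mul_comm]
            · rw [indicator_of_notMem (by exact hx), hg]
              have : (x, w) ∉ S := hx
              simp only [indicator_of_notMem this, mul_zero]
          simp_rw [e2]
          rw [lintegral_const_mul, mul_left_comm]
          · exact mul_le_mul_right (h.lintegral_inv_scale_le hA he hn hw) _
          · refine hd3.indicator ?_
            exact hSm.preimage (measurable_prodMk_right (y := w))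
        · refine le_trans (le_of_eq ?_) (zero_le)
          rw [← lintegral_zero (μ := μ.restrict X₀)]
          refine setLIntegral_congr_fun h.measurableSet fun x hx => ?_
          have : (x, w) ∉ S := by
            rintro ⟨h1, h2, h3⟩
            apply hwδ
            rw [mem_embBall] at h2 h3
            simp only at h2 h3
            have h4 : ‖e w.1 - e w.2‖ ≤ ‖e w.1 - e x‖ + ‖e x - e w.2‖ :=
              norm_sub_le_norm_sub_add_norm_sub ..
            rw [norm_sub_rev (e x)] at h4
            have h5 : 4 * Λ * d x ≤ 4 * Λ * D := by gcongr; exact hD x hx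
            change ‖e w.1 - e w.2‖ < δ
            linarith
          rw [hg]
          simp only [indicator_of_notMem this]
    _ = _ := by
        rw [lintegral_const_mul _ ((measurable_energyDensity he hf n p).indicator
          (measurableSet_closePairs he δ)), lintegral_indicator (measurableSet_closePairs he δ),
          energyOn]

end IsAveraging

end EnergyEstimate

/-! ### The energy of an average is bounded by the energy of close pairs -/

section EnergyEstimateMain

variable {X : Type*} [MeasurableSpace X]
  {E : Type*} [NormedAddCommGroup E] [MeasurableSpace E] [BorelSpace E]
  [SecondCountableTopology E]
  {V : Type*} [NormedAddCommGroup V] [NormedSpace ℝ V] [CompleteSpace V] [MeasurableSpace V]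
  [BorelSpace V] [SecondCountableTopology V]
  {μ : Measure X} [IsFiniteMeasure μ] {n : ℕ} {e : X → E} {X₀ : Set X} {d : X → ℝ}
  {k : X → X → ℝ} {Λ l c₀ C₀ : ℝ}

namespace IsAveraging

variable {f : X → V} {b : ℝ}

/-- The pairs `(x, x')` with `x'` within the scale `d x / 2` of `x`. -/
def nearPairs (e : X → E) (d : X → ℝ) : Set (X × X) :=
  {w | d w.1 ≠ 0 ∧ ‖e w.1 - e w.2‖ < d w.1 / 2}

theorem measurableSet_nearPairs (he : Measurable e) (hd : Measurable d) :
    MeasurableSet (nearPairs e d) :=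
  ((hd.comp measurable_fst) (measurableSet_singleton 0)).compl.inter
    (measurableSet_lt (measurable_emb_dist he) ((hd.comp measurable_fst).div_const _))

/-- The bound for one near pair is integrated over `x'` against the weight, which is finite because
`p > n` and contributes `d x ^ (p - n)`; together with `d x ^ (-p - 2n)` this leaves `d x ^ (-3n)`.
The constant depends only on `Λ` and `l`, so the scale can be chosen afterwards. -/
theorem exists_near_energy_le (hA : IsAhlfors n μ e c₀ C₀) (he : Measurable e)
    (hinj : Function.Injective e) (hn : 1 ≤ n) {p : ℝ} (hp : (n : ℝ) < p) (Λ l : ℝ) (hΛ : 1 ≤ Λ)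
    (hl : 0 < l) :
    ∃ C : ℝ, 0 < C ∧ ∀ (X₀ : Set X) (d : X → ℝ) (k : X → X → ℝ)
      (_ : IsAveraging μ n e X₀ d k Λ l) (f : X → V) (b D δ : ℝ), Measurable f →
      (∀ y, ‖f y‖ ≤ b) → (∀ x ∈ X₀, d x ≤ D) → 4 * Λ * D ≤ δ →
      ∫⁻ x in X₀, ∫⁻ x' in X₀, (nearPairs e d).indicator (fun w =>
        ‖avg μ d k f w.1 - avg μ d k f w.2‖ₑ ^ p * gagliardoWeight n e w.1 w.2) (x, x') ∂μ ∂μ ≤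
      ENNReal.ofReal C * energyOn μ n e p f (closePairs e δ) := by
  obtain ⟨C₁, hC₁, hC₁'⟩ := exists_lintegral_rpow_mul_gagliardoWeight_le hA he hp
  have hC := hA.C_pos
  have hp1 : 1 ≤ p := le_trans (by exact_mod_cast hn) hp.le
  have hp0 : 0 < p := by linarith
  set A : ℝ := (Λ * 2 ^ (n + 1) / l) ^ p * (C₀ * (2 * Λ) ^ n) ^ (p - 1) * (Λ / l) with hAdef
  have hApos : 0 < A := by positivity
  set B : ℝ := C₀ * (4 * Λ) ^ (3 * n) * 2 ^ (n + 2) with hB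
  have hBpos : 0 < B := by positivity
  refine ⟨A * C₁ * B, by positivity, fun X₀ d k h f b D δ hf hb hD hδ => ?_⟩
  have hmf := measurable_enorm_sub_rpow hf p
  have hF := h.measurable_avg hf
  have key : ∀ x ∈ X₀, ∫⁻ x' in X₀, (nearPairs e d).indicator (fun w =>
        ‖avg μ d k f w.1 - avg μ d k f w.2‖ₑ ^ p * gagliardoWeight n e w.1 w.2) (x, x') ∂μ ≤
      ENNReal.ofReal (A * C₁) * {x | d x ≠ 0}.indicator (fun x =>
        ENNReal.ofReal (1 / d x ^ (3 * n)) *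
        ∫⁻ w in embBall e x (2 * Λ * d x) ×ˢ embBall e x (2 * Λ * d x),
          ‖f w.1 - f w.2‖ₑ ^ p ∂(μ.prod μ)) x := by
    intro x hx
    by_cases hd : d x = 0
    · refine le_trans (le_of_eq ?_) zero_le
      refine (lintegral_congr fun x' => ?_).trans lintegral_zero
      rw [indicator_of_notMem fun hw => hw.1 hd]
    have hd0 := lt_of_le_of_ne (h.d_nonneg x) (Ne.symm hd)
    rw [indicator_of_mem (by exact hd)]
    set I := ∫⁻ w in embBall e x (2 * Λ * d x) ×ˢ embBall e x (2 * Λ * d x),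
          ‖f w.1 - f w.2‖ₑ ^ p ∂(μ.prod μ) with hI
    have hmw : Measurable fun x' => ENNReal.ofReal (‖e x - e x'‖ ^ p) * gagliardoWeight n e x x' :=
      ((measurable_emb_dist he).comp (measurable_prodMk_left (x := x))).pow_const p
        |>.ennreal_ofReal.mul
        ((measurable_gagliardoWeight he).comp (measurable_prodMk_left (x := x)))
    calc _ ≤ ∫⁻ x' in X₀, (embBall e x (d x / 2)).indicator (fun x' =>
          (ENNReal.ofReal (A / (d x ^ p * d x ^ (2 * n))) * I) *
          (ENNReal.ofReal (‖e x - e x'‖ ^ p) * gagliardoWeight n e x x')) x' ∂μ := by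
          refine setLIntegral_mono' h.measurableSet fun x' hx' => ?_
          by_cases hw : (x, x') ∈ nearPairs e d
          · have hxb : x' ∈ embBall e x (d x / 2) := mem_embBall'.2 hw.2
            rw [indicator_of_mem hw, indicator_of_mem hxb]
            simp only
            rw [← mul_assoc]
            refine mul_le_mul_left ?_ _
            rw [enorm_sub_rev]
            refine (h.near_pair_le hA he hf hb hp1 hx hx' hd hw.2).trans ?_
            rw [← hI, ← hAdef, mul_right_comm (ENNReal.ofReal _) I, ← ENNReal.ofReal_mul (by positivity)]
            refine le_of_eq ?_
            congr 2
            ring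
          · rw [indicator_of_notMem hw]; exact zero_le
      _ ≤ (ENNReal.ofReal (A / (d x ^ p * d x ^ (2 * n))) * I) *
          ∫⁻ x' in embBall e x (d x / 2), ENNReal.ofReal (‖e x - e x'‖ ^ p) *
            gagliardoWeight n e x x' ∂μ := by
          rw [← lintegral_const_mul _ hmw, ← lintegral_indicator (measurableSet_embBall he _ _)]
          exact setLIntegral_le_lintegral _ _
      _ ≤ (ENNReal.ofReal (A / (d x ^ p * d x ^ (2 * n))) * I) *
          ENNReal.ofReal (C₁ * (d x) ^ (p - n)) := by
          refine mul_le_mul_right ((hC₁' x (d x / 2) (by positivity)).trans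
            (ENNReal.ofReal_le_ofReal ?_)) _
          have : (d x / 2) ^ (p - n) ≤ d x ^ (p - n) :=
            Real.rpow_le_rpow (by positivity) (by linarith) (by linarith)
          gcongr
      _ = _ := by
          rw [mul_right_comm (ENNReal.ofReal _) I, ← ENNReal.ofReal_mul (by positivity),
            ← mul_assoc (ENNReal.ofReal (A * C₁)), ← ENNReal.ofReal_mul (by positivity)]
          congr 2
          rw [Real.rpow_sub hd0, Real.rpow_natCast, show 3 * n = n + 2 * n by ring, pow_add]
          have : 0 < d x ^ p := by positivity
          field_simp
  calc _ ≤ ∫⁻ x in X₀, ENNReal.ofReal (A * C₁) * {x | d x ≠ 0}.indicator (fun x =>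
        ENNReal.ofReal (1 / d x ^ (3 * n)) *
        ∫⁻ w in embBall e x (2 * Λ * d x) ×ˢ embBall e x (2 * Λ * d x),
          ‖f w.1 - f w.2‖ₑ ^ p ∂(μ.prod μ)) x ∂μ := setLIntegral_mono' h.measurableSet key
    _ = ENNReal.ofReal (A * C₁) * ∫⁻ x in X₀, {x | d x ≠ 0}.indicator (fun x =>
        ENNReal.ofReal (1 / d x ^ (3 * n)) *
        ∫⁻ w in embBall e x (2 * Λ * d x) ×ˢ embBall e x (2 * Λ * d x),
          ‖f w.1 - f w.2‖ₑ ^ p ∂(μ.prod μ)) x ∂μ := lintegral_const_mul' _ _ ENNReal.ofReal_ne_top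
    _ ≤ ENNReal.ofReal (A * C₁) * (ENNReal.ofReal B * energyOn μ n e p f (closePairs e δ)) :=
        mul_le_mul_right (h.lintegral_scale_mul_le hA he hinj hn hf hp0 hD hδ) _
    _ = _ := by rw [← mul_assoc, ← ENNReal.ofReal_mul (by positivity)]

variable (h : IsAveraging μ n e X₀ d k Λ l)
include h

/-- When both scales are at most `2 ‖e x - e x'‖`, points `y, y'` drawn from the two averaging
measures are at distance at most `(4Λ + 1) ‖e x - e x'‖`. The weight at `(x, x')` is then at most
`(4Λ + 1) ^ (2n)` times that at `(y, y')`, and Jensen applies in each variable. -/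
theorem far_pair_le (he : Measurable e) (hinj : Function.Injective e)
    (hf : Measurable f) (hb : ∀ y, ‖f y‖ ≤ b) {p : ℝ} (hp : 1 ≤ p) {x x' : X} (hx : x ∈ X₀)
    (hx' : x' ∈ X₀) {δ δ' : ℝ} (ht : ‖e x - e x'‖ < δ) (h1 : d x / 2 ≤ ‖e x - e x'‖)
    (h2 : d x' / 2 ≤ ‖e x - e x'‖) (hδ : (4 * Λ + 1) * δ ≤ δ') :
    ‖avg μ d k f x - avg μ d k f x'‖ₑ ^ p * gagliardoWeight n e x x' ≤
      ENNReal.ofReal ((4 * Λ + 1) ^ (2 * n)) *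
      ∫⁻ y, ∫⁻ y', (closePairs e δ').indicator
        (fun w => ‖f w.1 - f w.2‖ₑ ^ p * gagliardoWeight n e w.1 w.2) (y, y')
        ∂(avgKernel μ h.d_meas k x') ∂(avgKernel μ h.d_meas k x) := by
  have hΛ := h.one_le
  have hp0 : 0 < p := by linarith
  rcases (norm_nonneg (e x - e x')).eq_or_lt with h0 | h0
  · have : x = x' := hinj (sub_eq_zero.1 (norm_eq_zero.1 h0.symm))
    subst this
    simp [hp0]
  set F := avg μ d k f with hF
  have hm1 : Measurable fun y => ‖f y - F x'‖ₑ ^ p := (hf.sub_const _).enorm.pow_const _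
  have hm2 : ∀ y, Measurable fun y' => ‖f y' - f y‖ₑ ^ p := fun y =>
    (hf.sub_const _).enorm.pow_const _
  have hstep : ∀ᵐ y ∂(avgKernel μ h.d_meas k x), ‖f y - F x'‖ₑ ^ p * gagliardoWeight n e x x' ≤
      ENNReal.ofReal ((4 * Λ + 1) ^ (2 * n)) * ∫⁻ y', (closePairs e δ').indicator
        (fun w => ‖f w.1 - f w.2‖ₑ ^ p * gagliardoWeight n e w.1 w.2) (y, y')
        ∂(avgKernel μ h.d_meas k x') := by
    filter_upwards [h.ae_avgKernel he hx] with y hy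
    rw [enorm_sub_rev]
    have hGm : Measurable fun y' => (closePairs e δ').indicator
        (fun w : X × X => ‖f w.1 - f w.2‖ₑ ^ p * gagliardoWeight n e w.1 w.2) (y, y') :=
      ((measurable_energyDensity he hf n p).indicator (measurableSet_closePairs he δ')).comp
        (measurable_prodMk_left (x := y))
    calc _ ≤ (∫⁻ y', ‖f y' - f y‖ₑ ^ p ∂(avgKernel μ h.d_meas k x')) * gagliardoWeight n e x x' :=
          mul_le_mul_left (h.enorm_avg_sub_rpow_le hf hb hx' hp (f y)) _
      _ = ∫⁻ y', ‖f y' - f y‖ₑ ^ p * gagliardoWeight n e x x' ∂(avgKernel μ h.d_meas k x') := by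
          rw [lintegral_mul_const _ (hm2 y)]
      _ ≤ ∫⁻ y', ENNReal.ofReal ((4 * Λ + 1) ^ (2 * n)) * (closePairs e δ').indicator
        (fun w => ‖f w.1 - f w.2‖ₑ ^ p * gagliardoWeight n e w.1 w.2) (y, y')
        ∂(avgKernel μ h.d_meas k x') := by
          refine lintegral_mono_ae ?_
          filter_upwards [h.ae_avgKernel he hx'] with y' hy'
          have h3 : ‖e y - e y'‖ ≤ (4 * Λ + 1) * ‖e x - e x'‖ := by
            have e1 : ‖e y - e y'‖ ≤ ‖e y - e x‖ + ‖e x - e y'‖ :=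
              norm_sub_le_norm_sub_add_norm_sub ..
            have e2 : ‖e x - e y'‖ ≤ ‖e x - e x'‖ + ‖e x' - e y'‖ :=
              norm_sub_le_norm_sub_add_norm_sub ..
            rw [norm_sub_rev (e y) (e x)] at e1
            nlinarith
          have hmem : (y, y') ∈ closePairs e δ' := by
            change ‖e y - e y'‖ < δ'
            refine lt_of_lt_of_le (h3.trans_lt ?_) hδ
            gcongr
          rw [indicator_of_mem hmem]
          rcases (norm_nonneg (e y - e y')).eq_or_lt with h4 | h4
          · have : y = y' := hinj (sub_eq_zero.1 (norm_eq_zero.1 h4.symm))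
            subst this
            simp [hp0]
          · rw [enorm_sub_rev, mul_left_comm]
            refine mul_le_mul_right ?_ _
            rw [gagliardoWeight, gagliardoWeight, ← ENNReal.ofReal_mul (by positivity)]
            apply ENNReal.ofReal_le_ofReal
            rw [← div_eq_mul_inv, ← div_pow, ← inv_pow]
            refine pow_le_pow_left₀ (by positivity) ?_ _
            rw [le_div_iff₀ h4, inv_mul_le_iff₀ h0]
            linarith
      _ = _ := by rw [lintegral_const_mul _ hGm]
  calc _ ≤ (∫⁻ y, ‖f y - F x'‖ₑ ^ p ∂(avgKernel μ h.d_meas k x)) * gagliardoWeight n e x x' :=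
        mul_le_mul_left (h.enorm_avg_sub_rpow_le hf hb hx hp (F x')) _
    _ = ∫⁻ y, ‖f y - F x'‖ₑ ^ p * gagliardoWeight n e x x' ∂(avgKernel μ h.d_meas k x) := by
        rw [lintegral_mul_const _ hm1]
    _ ≤ _ := lintegral_mono_ae hstep
    _ = _ := lintegral_const_mul' _ _ ENNReal.ofReal_ne_top

/-- The bound `lintegral_lintegral_avgKernel_le` removes the averaging in one variable and then in
the other, each time at the cost of a factor `1 + Λ / l`. -/
theorem far_energy_le (he : Measurable e) (hf : Measurable f) {p : ℝ} (δ : ℝ) :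
    ∫⁻ x in X₀, ∫⁻ x' in X₀, ∫⁻ y, ∫⁻ y', (closePairs e δ).indicator
        (fun w => ‖f w.1 - f w.2‖ₑ ^ p * gagliardoWeight n e w.1 w.2) (y, y')
        ∂(avgKernel μ h.d_meas k x') ∂(avgKernel μ h.d_meas k x) ∂μ ∂μ ≤
      ENNReal.ofReal ((1 + Λ / l) ^ 2) * energyOn μ n e p f (closePairs e δ) := by
  have hΛ := h.one_le
  have hl := h.l_pos
  set G : X → X → ℝ≥0∞ := fun y y' => (closePairs e δ).indicator
        (fun w => ‖f w.1 - f w.2‖ₑ ^ p * gagliardoWeight n e w.1 w.2) (y, y') with hG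
  have hGm : Measurable (Function.uncurry G) :=
    (measurable_energyDensity he hf n p).indicator (measurableSet_closePairs he δ)
  have hGy : ∀ y, Measurable (G y) := fun y => hGm.comp (measurable_prodMk_left (x := y))
  have hm1 : Measurable fun q : X × X => ∫⁻ y', G q.1 y' ∂(avgKernel μ h.d_meas k q.2) := by
    have : Measurable (Function.uncurry fun (q : X × X) (y' : X) => G q.1 y') :=
      hGm.comp ((measurable_fst.comp measurable_fst).prodMk measurable_snd)
    exact Measurable.lintegral_kernel_prod_right
      (κ := (avgKernel μ h.d_meas k).comap Prod.snd measurable_snd) this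
  have hm2 : Measurable fun y => ∫⁻ y', G y y' ∂μ := hGm.lintegral_prod_right'
  have key : ∀ x, ∫⁻ x' in X₀, ∫⁻ y, ∫⁻ y', G y y' ∂(avgKernel μ h.d_meas k x')
      ∂(avgKernel μ h.d_meas k x) ∂μ ≤
      ENNReal.ofReal (1 + Λ / l) * ∫⁻ y, ∫⁻ y', G y y' ∂μ ∂(avgKernel μ h.d_meas k x) := by
    intro x
    have hm3 : Measurable (Function.uncurry fun x' y =>
        ∫⁻ y', G y y' ∂(avgKernel μ h.d_meas k x')) := hm1.comp measurable_swap
    rw [lintegral_lintegral_swap hm3.aemeasurable,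
      ← lintegral_const_mul _ hm2]
    exact lintegral_mono fun y => h.lintegral_lintegral_avgKernel_le (hGy y)
  calc _ ≤ ∫⁻ x in X₀, ENNReal.ofReal (1 + Λ / l) *
        ∫⁻ y, ∫⁻ y', G y y' ∂μ ∂(avgKernel μ h.d_meas k x) ∂μ := lintegral_mono key
    _ = ENNReal.ofReal (1 + Λ / l) *
        ∫⁻ x in X₀, ∫⁻ y, ∫⁻ y', G y y' ∂μ ∂(avgKernel μ h.d_meas k x) ∂μ :=
        lintegral_const_mul' _ _ ENNReal.ofReal_ne_top
    _ ≤ ENNReal.ofReal (1 + Λ / l) * (ENNReal.ofReal (1 + Λ / l) *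
        ∫⁻ y, ∫⁻ y', G y y' ∂μ ∂μ) :=
        mul_le_mul_right (h.lintegral_lintegral_avgKernel_le hm2) _
    _ = _ := by
        have e1 : energyOn μ n e p f (closePairs e δ) = ∫⁻ y, ∫⁻ y', G y y' ∂μ ∂μ := by
          rw [energyOn, ← lintegral_indicator (measurableSet_closePairs he δ)]
          exact lintegral_prod _ hGm.aemeasurable
        rw [← mul_assoc, ← ENNReal.ofReal_mul (by positivity), e1, sq]

omit h in
/-- The Gagliardo energy of an average is controlled by that of the function. -/
theorem exists_energyOn_avg_le (hA : IsAhlfors n μ e c₀ C₀) (he : Measurable e)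
    (hinj : Function.Injective e) (hn : 1 ≤ n) {p : ℝ} (hp : (n : ℝ) < p) (Λ l : ℝ) (hΛ : 1 ≤ Λ)
    (hl : 0 < l) :
    ∃ C : ℝ, 0 < C ∧ ∀ (X₀ : Set X) (d : X → ℝ) (k : X → X → ℝ)
      (_ : IsAveraging μ n e X₀ d k Λ l) (f : X → V) (b D δ δ' : ℝ), Measurable f →
      (∀ y, ‖f y‖ ≤ b) → (∀ x ∈ X₀, d x ≤ D) → 4 * Λ * D ≤ δ' → (4 * Λ + 1) * δ ≤ δ' →
      energyOn μ n e p (avg μ d k f) (X₀ ×ˢ X₀ ∩ closePairs e δ) ≤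
      ENNReal.ofReal C * energyOn μ n e p f (closePairs e δ') := by
  obtain ⟨C, hC, hC'⟩ := exists_near_energy_le (V := V) hA he hinj hn hp Λ l hΛ hl
  have hp1 : 1 ≤ p := le_trans (by exact_mod_cast hn) hp.le
  refine ⟨2 * C + (4 * Λ + 1) ^ (2 * n) * (1 + Λ / l) ^ 2, by positivity,
    fun X₀ d k h f b D δ δ' hf hb hD hδ1 hδ2 => ?_⟩
  set F := avg μ d k f with hF
  have hFm : Measurable F := h.measurable_avg hf
  set g : X × X → ℝ≥0∞ := fun w => ‖F w.1 - F w.2‖ₑ ^ p * gagliardoWeight n e w.1 w.2 with hg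
  have hgm : Measurable g := measurable_energyDensity he hFm n p
  have hgs : ∀ x x', g (x, x') = g (x', x) := fun x x' => by
    simp only [hg]; rw [enorm_sub_rev, gagliardoWeight_comm]
  set N : X × X → ℝ≥0∞ := (nearPairs e d).indicator g with hN
  have hNm : Measurable N := hgm.indicator (measurableSet_nearPairs he h.d_meas)
  set P := avgKernel μ h.d_meas k with hP
  set G : X × X → ℝ≥0∞ := (closePairs e δ').indicator
        (fun w => ‖f w.1 - f w.2‖ₑ ^ p * gagliardoWeight n e w.1 w.2) with hG
  -- A pair is near as seen from `x`, near as seen from `x'`, or far from both; the second case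
  -- reduces to the first by symmetry.
  have hpt : ∀ x ∈ X₀, ∀ x' ∈ X₀, (closePairs e δ).indicator g (x, x') ≤
      N (x, x') + (N (x', x) + ENNReal.ofReal ((4 * Λ + 1) ^ (2 * n)) *
      ∫⁻ y, ∫⁻ y', G (y, y') ∂(P x') ∂(P x)) := by
    intro x hx x' hx'
    by_cases hδ : (x, x') ∈ closePairs e δ
    swap
    · rw [indicator_of_notMem hδ]; exact zero_le
    rw [indicator_of_mem hδ]
    by_cases h1 : (x, x') ∈ nearPairs e d
    · rw [hN, indicator_of_mem h1]; exact le_self_add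
    by_cases h2 : (x', x) ∈ nearPairs e d
    · rw [hN, indicator_of_mem h2, hgs]
      exact le_trans le_self_add le_add_self
    refine le_trans ?_ (le_trans le_add_self le_add_self)
    -- If the scale is zero the point has no near pairs by definition, and the inequality is
    -- trivial.
    have e1 : d x / 2 ≤ ‖e x - e x'‖ := by
      by_contra hcon
      push Not at hcon
      by_cases hd : d x = 0
      · rw [hd] at hcon
        exact absurd hcon (by simp)
      · exact h1 ⟨hd, hcon⟩
    have e2 : d x' / 2 ≤ ‖e x - e x'‖ := by
      rw [norm_sub_rev]
      by_contra hcon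
      push Not at hcon
      by_cases hd : d x' = 0
      · rw [hd] at hcon
        exact absurd hcon (by simp)
      · exact h2 ⟨hd, hcon⟩
    exact h.far_pair_le he hinj hf hb hp1 hx hx' hδ e1 e2 hδ2
  have hNx : ∀ x, Measurable fun x' => N (x, x') := fun x => hNm.comp measurable_prodMk_left
  have hNx' : ∀ x, Measurable fun x' => N (x', x) := fun x => hNm.comp measurable_prodMk_right
  have hN1 : ∫⁻ x in X₀, ∫⁻ x' in X₀, N (x, x') ∂μ ∂μ ≤
      ENNReal.ofReal C * energyOn μ n e p f (closePairs e δ') :=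
    hC' X₀ d k h f b D δ' hf hb hD hδ1
  calc energyOn μ n e p F (X₀ ×ˢ X₀ ∩ closePairs e δ)
      = ∫⁻ w in X₀ ×ˢ X₀, (closePairs e δ).indicator g w ∂(μ.prod μ) := by
        rw [setLIntegral_indicator (measurableSet_closePairs he δ), inter_comm, energyOn]
    _ = ∫⁻ x in X₀, ∫⁻ x' in X₀, (closePairs e δ).indicator g (x, x') ∂μ ∂μ := by
        rw [← Measure.prod_restrict, lintegral_prod _
          (hgm.indicator (measurableSet_closePairs he δ)).aemeasurable]
    _ ≤ ∫⁻ x in X₀, ∫⁻ x' in X₀, (N (x, x') + (N (x', x) +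
        ENNReal.ofReal ((4 * Λ + 1) ^ (2 * n)) * ∫⁻ y, ∫⁻ y', G (y, y') ∂(P x') ∂(P x))) ∂μ ∂μ :=
        setLIntegral_mono' h.measurableSet fun x hx =>
          setLIntegral_mono' h.measurableSet fun x' hx' => hpt x hx x' hx'
    _ = ∫⁻ x in X₀, ∫⁻ x' in X₀, N (x, x') ∂μ ∂μ + (∫⁻ x in X₀, ∫⁻ x' in X₀, N (x', x) ∂μ ∂μ +
        ENNReal.ofReal ((4 * Λ + 1) ^ (2 * n)) * ∫⁻ x in X₀, ∫⁻ x' in X₀,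
          ∫⁻ y, ∫⁻ y', G (y, y') ∂(P x') ∂(P x) ∂μ ∂μ) := by
        have e1 : ∀ x, ∫⁻ x' in X₀, (N (x, x') + (N (x', x) +
            ENNReal.ofReal ((4 * Λ + 1) ^ (2 * n)) *
              ∫⁻ y, ∫⁻ y', G (y, y') ∂(P x') ∂(P x))) ∂μ =
            ∫⁻ x' in X₀, N (x, x') ∂μ + (∫⁻ x' in X₀, N (x', x) ∂μ +
            ENNReal.ofReal ((4 * Λ + 1) ^ (2 * n)) * ∫⁻ x' in X₀,
              ∫⁻ y, ∫⁻ y', G (y, y') ∂(P x') ∂(P x) ∂μ) := by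
          intro x
          rw [lintegral_add_left (hNx x), lintegral_add_left (hNx' x),
            lintegral_const_mul' _ _ ENNReal.ofReal_ne_top]
        simp_rw [e1]
        have m1 : Measurable fun x => ∫⁻ x' in X₀, N (x, x') ∂μ := hNm.lintegral_prod_right'
        have m2 : Measurable fun x => ∫⁻ x' in X₀, N (x', x) ∂μ := hNm.lintegral_prod_left'
        rw [lintegral_add_left m1, lintegral_add_left m2,
          lintegral_const_mul' _ _ ENNReal.ofReal_ne_top]
    _ ≤ ENNReal.ofReal C * energyOn μ n e p f (closePairs e δ') +
        (ENNReal.ofReal C * energyOn μ n e p f (closePairs e δ') +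
        ENNReal.ofReal ((4 * Λ + 1) ^ (2 * n)) * (ENNReal.ofReal ((1 + Λ / l) ^ 2) *
          energyOn μ n e p f (closePairs e δ'))) := by
        refine add_le_add hN1 (add_le_add ?_ (mul_le_mul_right (h.far_energy_le he hf δ') _))
        have hm3 : Measurable (Function.uncurry fun x x' => N (x', x)) := hNm.comp measurable_swap
        rw [lintegral_lintegral_swap hm3.aemeasurable]
        exact hN1
    _ = _ := by
        rw [ENNReal.ofReal_add (by positivity) (by positivity), two_mul C,
          ENNReal.ofReal_add hC.le hC.le, ENNReal.ofReal_mul (by positivity), add_mul, add_mul]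
        ring

/-- Averages are close to values of the function. -/
theorem exists_enorm_avg_sub_le (he : Measurable e) (hinj : Function.Injective e)
    (hf : Measurable f) (hb : ∀ y, ‖f y‖ ≤ b)
    {p : ℝ} (hp : 1 ≤ p) {x : X} (hx : x ∈ X₀) (hd : d x ≠ 0) {D : ℝ} (hD : 2 * Λ * d x ≤ D)
    {Q : X → Prop} (hQ : ∀ᵐ y ∂μ, Q y) :
    ∃ y, Q y ∧ ‖e x - e y‖ ≤ Λ * d x ∧ ‖avg μ d k f x - f y‖ₑ ^ p ≤
      ENNReal.ofReal ((Λ / l) ^ 2 * (2 * Λ) ^ (2 * n)) * energyOn μ n e p f (closePairs e D) := by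
  have hd0 := lt_of_le_of_ne (h.d_nonneg x) (Ne.symm hd)
  have hΛ := h.one_le
  have hl := h.l_pos
  have hp0 : 0 < p := by linarith
  set F := avg μ d k f with hF
  set P := avgKernel μ h.d_meas k with hP
  set B := embBall e x (Λ * d x) with hB
  have hBm : MeasurableSet B := measurableSet_embBall he _ _
  have hm1 : Measurable fun y => ‖F x - f y‖ₑ ^ p := (hf.const_sub _).enorm.pow_const _
  have hm2 : ∀ y, Measurable fun y' => ‖f y' - f y‖ₑ ^ p := fun y =>
    (hf.sub_const _).enorm.pow_const _
  have hmf := measurable_enorm_sub_rpow hf p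
  -- A double average over `B × B`: each density is at most of order `d x ^ (-n)`, while inserting
  -- the weight costs `(2 * Λ * d x) ^ (2 * n)`. The powers of `d x` cancel, by scale invariance.
  have hint : ∫⁻ y, ‖F x - f y‖ₑ ^ p ∂(P x) ≤
      ENNReal.ofReal ((Λ / l) ^ 2 * (2 * Λ) ^ (2 * n)) * energyOn μ n e p f (closePairs e D) := by
    calc ∫⁻ y, ‖F x - f y‖ₑ ^ p ∂(P x)
        ≤ ENNReal.ofReal (Λ / (l * d x ^ n)) * ∫⁻ y in B, ‖F x - f y‖ₑ ^ p ∂μ :=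
          h.lintegral_avgKernel_le he hx hd hm1
      _ ≤ ENNReal.ofReal (Λ / (l * d x ^ n)) * ∫⁻ y in B,
            (ENNReal.ofReal (Λ / (l * d x ^ n)) * ∫⁻ y' in B, ‖f y' - f y‖ₑ ^ p ∂μ) ∂μ :=
          mul_le_mul_right (lintegral_mono fun y =>
            (h.enorm_avg_sub_rpow_le hf hb hx hp (f y)).trans
              (h.lintegral_avgKernel_le he hx hd (hm2 y))) _
      _ = ENNReal.ofReal (Λ / (l * d x ^ n)) * (ENNReal.ofReal (Λ / (l * d x ^ n)) *
            ∫⁻ w in B ×ˢ B, ‖f w.1 - f w.2‖ₑ ^ p ∂(μ.prod μ)) := by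
          rw [lintegral_const_mul' _ _ ENNReal.ofReal_ne_top, ← Measure.prod_restrict,
            lintegral_prod _ hmf.aemeasurable]
          simp_rw [enorm_sub_rev (f _) (f _)]
      _ ≤ ENNReal.ofReal (Λ / (l * d x ^ n)) * (ENNReal.ofReal (Λ / (l * d x ^ n)) *
            ∫⁻ w in B ×ˢ B, ENNReal.ofReal ((2 * Λ * d x) ^ (2 * n)) *
              (‖f w.1 - f w.2‖ₑ ^ p * gagliardoWeight n e w.1 w.2) ∂(μ.prod μ)) := by
          refine mul_le_mul_right (mul_le_mul_right
            (setLIntegral_mono' (hBm.prod hBm) fun w hw => ?_) _) _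
          rcases (norm_nonneg (e w.1 - e w.2)).eq_or_lt with h0 | h0
          · have : w.1 = w.2 := hinj (sub_eq_zero.1 (norm_eq_zero.1 h0.symm))
            simp [this, hp0]
          · have h1 : ‖e w.1 - e w.2‖ ≤ 2 * Λ * d x := by
              have e0 : ‖e w.1 - e w.2‖ ≤ ‖e w.1 - e x‖ + ‖e x - e w.2‖ :=
                norm_sub_le_norm_sub_add_norm_sub ..
              have e1 := mem_embBall.1 hw.1
              have e2 := mem_embBall'.1 hw.2
              linarith
            rw [mul_left_comm, gagliardoWeight, ← ENNReal.ofReal_mul (by positivity),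
              ← div_eq_mul_inv, ← div_pow]
            refine le_mul_of_one_le_right' ?_
            rw [ENNReal.one_le_ofReal]
            refine one_le_pow₀ ?_
            rw [le_div_iff₀ h0]; linarith
      _ ≤ ENNReal.ofReal (Λ / (l * d x ^ n)) * (ENNReal.ofReal (Λ / (l * d x ^ n)) *
            (ENNReal.ofReal ((2 * Λ * d x) ^ (2 * n)) * energyOn μ n e p f (closePairs e D))) := by
          rw [lintegral_const_mul' _ _ ENNReal.ofReal_ne_top]
          refine mul_le_mul_right (mul_le_mul_right (mul_le_mul_right
            (lintegral_mono_set fun w hw => ?_) _) _) _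
          have e0 : ‖e w.1 - e w.2‖ ≤ ‖e w.1 - e x‖ + ‖e x - e w.2‖ :=
            norm_sub_le_norm_sub_add_norm_sub ..
          have e1 := mem_embBall.1 hw.1
          have e2 := mem_embBall'.1 hw.2
          change ‖e w.1 - e w.2‖ < D
          linarith
      _ = _ := by
          rw [← mul_assoc, ← mul_assoc, ← ENNReal.ofReal_mul (by positivity),
            ← ENNReal.ofReal_mul (by positivity)]
          congr 2
          rw [mul_pow _ (d x), two_mul n, pow_add (d x)]
          field_simp
  have := h.isProbabilityMeasure_avgKernel hx
  -- Away from the zeros of the scale the averaging measure has a density, so the point `y`, found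
  -- below the mean, can also avoid a `μ`-null set.
  have hac : P x ≪ μ := by
    refine Measure.AbsolutelyContinuous.mk fun s hs hs0 => ?_
    rw [← setLIntegral_one, ← lintegral_indicator hs]
    refine le_antisymm ((h.lintegral_avgKernel_le he hx hd (measurable_const.indicator hs)).trans
      (le_of_eq ?_)) zero_le
    rw [lintegral_indicator hs, setLIntegral_one,
      Measure.absolutelyContinuous_of_le Measure.restrict_le_self hs0, mul_zero]
  have hbad : (P x) {y | ¬(Q y ∧ ‖e x - e y‖ ≤ Λ * d x)} = 0 :=
    (show ∀ᵐ y ∂(P x), Q y ∧ ‖e x - e y‖ ≤ Λ * d x from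
      Filter.Eventually.and (hac.ae_le hQ) (h.ae_avgKernel he hx))
  obtain ⟨y, hy, hy'⟩ := exists_notMem_null_le_lintegral hm1.aemeasurable hbad
  simp only [mem_ofPred_eq, not_not] at hy
  exact ⟨y, hy.1, hy.2, hy'.trans hint⟩

end IsAveraging

end EnergyEstimateMain

/-! ### Minkowski, smallness near the diagonal, and truncation -/

section EnergyTools

variable {X : Type*} [MeasurableSpace X]
  {E : Type*} [NormedAddCommGroup E] [MeasurableSpace E] [BorelSpace E]
  [SecondCountableTopology E]
  {V : Type*} [NormedAddCommGroup V] [NormedSpace ℝ V] [CompleteSpace V] [MeasurableSpace V]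
  [BorelSpace V] [SecondCountableTopology V]
  {μ : Measure X} [IsFiniteMeasure μ] {n : ℕ} {e : X → E} {c₀ C₀ p : ℝ}

theorem energyOn_mono_set {f : X → V} {T T' : Set (X × X)} (h : T ⊆ T') :
    energyOn μ n e p f T ≤ energyOn μ n e p f T' := lintegral_mono_set h

theorem energyOn_le_of_norm_sub_le {W : Type*} [NormedAddCommGroup W] {f : X → V} {g : X → W}
    {T : Set (X × X)} (hT : MeasurableSet T) {K : ℝ} (hK : 0 ≤ K) (hp : 0 ≤ p)
    (h : ∀ w ∈ T, ‖f w.1 - f w.2‖ ≤ K * ‖g w.1 - g w.2‖) :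
    energyOn μ n e p f T ≤ ENNReal.ofReal (K ^ p) *
      ∫⁻ w in T, ‖g w.1 - g w.2‖ₑ ^ p * gagliardoWeight n e w.1 w.2 ∂(μ.prod μ) := by
  rw [← lintegral_const_mul' _ _ ENNReal.ofReal_ne_top, energyOn]
  refine setLIntegral_mono' hT fun w hw => ?_
  rw [← mul_assoc]
  refine mul_le_mul_left ?_ _
  rw [← ENNReal.ofReal_rpow_of_nonneg hK hp, ← ENNReal.mul_rpow_of_nonneg _ _ hp]
  refine ENNReal.rpow_le_rpow ?_ hp
  rw [← ofReal_norm, ← ofReal_norm, ← ENNReal.ofReal_mul hK]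
  exact ENNReal.ofReal_le_ofReal (h w hw)

/-- Minkowski's inequality for the Gagliardo energy. -/
theorem energyOn_add_rpow_le (he : Measurable e) (hp : 1 ≤ p) {f g : X → V} (hf : Measurable f)
    (hg : Measurable g) (T : Set (X × X)) :
    energyOn μ n e p (fun x => f x + g x) T ^ (1 / p) ≤
      energyOn μ n e p f T ^ (1 / p) + energyOn μ n e p g T ^ (1 / p) := by
  have hp0 : 0 < p := by linarith
  have hw : Measurable fun w : X × X => gagliardoWeight n e w.1 w.2 ^ (1 / p) :=
    (measurable_gagliardoWeight he).pow_const _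
  have hm : ∀ {h : X → V}, Measurable h → Measurable fun w : X × X => ‖h w.1 - h w.2‖ₑ :=
    fun {h} hh => ((hh.comp measurable_fst).sub (hh.comp measurable_snd)).enorm
  have hE : ∀ h : X → V, energyOn μ n e p h T =
      ∫⁻ w in T, (‖h w.1 - h w.2‖ₑ * gagliardoWeight n e w.1 w.2 ^ (1 / p)) ^ p ∂(μ.prod μ) := by
    intro h
    refine lintegral_congr fun w => ?_
    rw [ENNReal.mul_rpow_of_nonneg _ _ hp0.le, ← ENNReal.rpow_mul, one_div,
      inv_mul_cancel₀ hp0.ne', ENNReal.rpow_one]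
  rw [hE, hE, hE]
  refine le_trans ?_ (ENNReal.lintegral_Lp_add_le ((hm hf).mul hw).aemeasurable
    ((hm hg).mul hw).aemeasurable hp)
  refine ENNReal.rpow_le_rpow (lintegral_mono fun w => ENNReal.rpow_le_rpow ?_ hp0.le)
    (by positivity)
  simp only [Pi.add_apply]
  rw [← add_mul]
  refine mul_le_mul_left ?_ _
  rw [add_sub_add_comm]
  exact enorm_add_le _ _

theorem energyOn_add_le (he : Measurable e) (hp : 1 ≤ p) {f g : X → V} (hf : Measurable f)
    (T : Set (X × X)) :
    energyOn μ n e p (fun x => f x + g x) T ≤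
      2 ^ (p - 1) * (energyOn μ n e p f T + energyOn μ n e p g T) := by
  rw [energyOn, energyOn, energyOn, ← lintegral_add_left (measurable_energyDensity he hf n p),
    ← lintegral_const_mul' _ _ (by simp)]
  refine lintegral_mono fun w => ?_
  rw [← add_mul, ← mul_assoc]
  refine mul_le_mul_left ?_ _
  refine le_trans (ENNReal.rpow_le_rpow ?_ (by linarith))
    (ENNReal.rpow_add_le_mul_rpow_add_rpow _ _ hp)
  rw [add_sub_add_comm]
  exact enorm_add_le _ _

theorem energyOn_neg (f : X → V) (T : Set (X × X)) :
    energyOn μ n e p (fun x => -f x) T = energyOn μ n e p f T := by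
  refine lintegral_congr fun w => ?_
  rw [← neg_sub', enorm_neg]

theorem energyOn_sub_le (he : Measurable e) (hp : 1 ≤ p) {f g : X → V} (hf : Measurable f)
    (T : Set (X × X)) :
    energyOn μ n e p (fun x => f x - g x) T ≤
      2 ^ (p - 1) * (energyOn μ n e p f T + energyOn μ n e p g T) := by
  simpa only [sub_eq_add_neg, energyOn_neg] using
    energyOn_add_le (μ := μ) (n := n) (g := fun x => -g x) he hp hf T

/-- The energy of close pairs is small. -/
theorem exists_energyOn_closePairs_le (hA : IsAhlfors n μ e c₀ C₀) (he : Measurable e)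
    (hn : 1 ≤ n) {f : X → V} (hf : energyOn μ n e p f univ ≠ ⊤) {κ : ℝ≥0∞} (hκ : κ ≠ 0) :
    ∃ δ : ℝ, 0 < δ ∧ energyOn μ n e p f (closePairs e δ) < κ := by
  rw [energyOn, Measure.restrict_univ] at hf
  obtain ⟨η, hη, h⟩ := exists_pos_setLIntegral_lt_of_measure_lt hf hκ
  have hC := hA.C_pos
  -- By Ahlfors regularity the product measure of the `δ`-close pairs is at most this quantity;
  -- absolute continuity of the integral does the rest.
  have hlim : Tendsto (fun δ : ℝ => ENNReal.ofReal (C₀ * δ ^ n) * μ univ) (𝓝[>] 0) (𝓝 0) := by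
    have h1 : Tendsto (fun δ : ℝ => C₀ * δ ^ n) (𝓝[>] 0) (𝓝 0) := by
      have : Continuous fun δ : ℝ => C₀ * δ ^ n := by fun_prop
      have h2 := this.tendsto 0
      simp only [zero_pow (by lia : n ≠ 0), mul_zero] at h2
      exact h2.mono_left nhdsWithin_le_nhds
    have h2 := ENNReal.tendsto_ofReal h1
    rw [ENNReal.ofReal_zero] at h2
    simpa using ENNReal.Tendsto.mul_const h2 (b := μ univ) (Or.inr (measure_ne_top μ univ))
  obtain ⟨δ, hδ, hδ0⟩ := ((hlim.eventually (gt_mem_nhds hη)).and self_mem_nhdsWithin).exists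
  refine ⟨δ, hδ0, h _ (lt_of_le_of_lt ?_ hδ)⟩
  rw [Measure.prod_apply (measurableSet_closePairs he δ)]
  refine (lintegral_mono (g := fun _ => ENNReal.ofReal (C₀ * δ ^ n)) fun x => ?_).trans
    (by rw [lintegral_const])
  refine le_trans (measure_mono fun y hy => ?_) (hA.measure_embBall_le x hδ0)
  exact mem_embBall'.2 hy

theorem enorm_sub_rpow_le_mul_gagliardoWeight (hinj : Function.Injective e) (hp : 0 < p)
    (f : X → V) {x y : X} {a : ℝ} (ha : ‖e x - e y‖ ≤ a) :
    ‖f x - f y‖ₑ ^ p ≤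
      ENNReal.ofReal (a ^ (2 * n)) * (‖f x - f y‖ₑ ^ p * gagliardoWeight n e x y) := by
  rcases (norm_nonneg (e x - e y)).eq_or_lt with h0 | h0
  · have : x = y := hinj (sub_eq_zero.1 (norm_eq_zero.1 h0.symm))
    simp [this, hp]
  · have : 0 < a := h0.trans_le ha
    rw [mul_left_comm, gagliardoWeight, ← ENNReal.ofReal_mul (by positivity),
      ← div_eq_mul_inv, ← div_pow]
    refine le_mul_of_one_le_right' ?_
    rw [ENNReal.one_le_ofReal]
    exact one_le_pow₀ ((one_le_div₀ h0).2 ha)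

/-- Truncation to a set `D` that is separated, by a set `A` where `g` is constant, from the rest of
the space. -/
theorem energyOn_indicator_le (hA : IsAhlfors n μ e c₀ C₀) (he : Measurable e)
    (hinj : Function.Injective e) (hn : 1 ≤ n) (hp : 0 < p) {g : X → V} (hg : Measurable g)
    {D A : Set X} (hD : MeasurableSet D) (hAm : MeasurableSet A) {q : V} (hq : ∀ x ∈ A, g x = q)
    {σ a m : ℝ} (hσ : 0 < σ) (hm : 0 < m)
    (hsep : ∀ x ∈ D, ∀ y, y ∉ D ∪ A → σ ≤ ‖e x - e y‖)
    (hdiam : ∀ x ∈ D, ∀ y ∈ A, ‖e x - e y‖ ≤ a) (hmA : ENNReal.ofReal m ≤ μ A) :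
    energyOn μ n e p (D.indicator fun x => g x - q) univ ≤
      ENNReal.ofReal (1 + 2 * (C₀ * 2 ^ (n + 1) / σ ^ n * (a ^ (2 * n) / m))) *
        energyOn μ n e p g ((D ∪ A) ×ˢ (D ∪ A)) := by
  have hC := hA.C_pos
  have ha : 0 ≤ a ^ (2 * n) := by rw [pow_mul]; positivity
  set h := D.indicator fun x => g x - q with hh
  set U := D ∪ A with hU
  have hUm : MeasurableSet U := hD.union hAm
  have hhU : ∀ x ∈ U, h x = g x - q := by
    intro x hx
    by_cases hxD : x ∈ D
    · rw [hh, indicator_of_mem hxD]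
    · rw [hh, indicator_of_notMem hxD, hq x (hx.resolve_left hxD), sub_self]
  set G : X × X → ℝ≥0∞ := fun w => ‖g w.1 - g w.2‖ₑ ^ p * gagliardoWeight n e w.1 w.2 with hG
  have hGm : Measurable G := measurable_energyDensity he hg n p
  -- Within `U` the truncated function has the differences of `g`, and off `U` it vanishes; only the
  -- pairs joining `D` to the complement of `U` produce new energy.
  set T : X × X → ℝ≥0∞ := (D ×ˢ Uᶜ).indicator
    fun w => ‖g w.1 - q‖ₑ ^ p * gagliardoWeight n e w.1 w.2 with hT
  have hTm : Measurable T :=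
    ((((hg.comp measurable_fst).sub_const q).enorm.pow_const p).mul
      (measurable_gagliardoWeight he)).indicator (hD.prod hUm.compl)
  have hpt : ∀ w : X × X, ‖h w.1 - h w.2‖ₑ ^ p * gagliardoWeight n e w.1 w.2 ≤
      (U ×ˢ U).indicator G w + (T w + T w.swap) := by
    have aux : ∀ x y, x ∈ U → y ∉ U →
        ‖h x - h y‖ₑ ^ p * gagliardoWeight n e x y ≤ T (x, y) := by
      intro x y hx hy
      have hy0 : h y = 0 := indicator_of_notMem (fun hyD => hy (Or.inl hyD)) _
      by_cases hxD : x ∈ D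
      · rw [hT, indicator_of_mem (show (x, y) ∈ D ×ˢ Uᶜ from ⟨hxD, hy⟩), hhU x hx, hy0, sub_zero]
      · rw [hy0, hh, indicator_of_notMem hxD]; simp [hp]
    rintro ⟨x, y⟩
    by_cases hx : x ∈ U <;> by_cases hy : y ∈ U
    · rw [indicator_of_mem (show (x, y) ∈ U ×ˢ U from ⟨hx, hy⟩)]
      refine le_trans (le_of_eq ?_) le_self_add
      simp only [hG]
      rw [hhU x hx, hhU y hy, sub_sub_sub_cancel_right]
    · exact (aux x y hx hy).trans (le_self_add.trans le_add_self)
    · have := aux y x hy hx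
      rw [enorm_sub_rev, gagliardoWeight_comm] at this
      exact this.trans (le_add_self.trans le_add_self)
    · have e1 : h x = 0 := indicator_of_notMem (fun hyD => hx (Or.inl hyD)) _
      have e2 : h y = 0 := indicator_of_notMem (fun hyD => hy (Or.inl hyD)) _
      simp [e1, e2, hp]
  -- A Poincaré inequality: since `g = q` on `A`, averaging over `y ∈ A` replaces `g x - q` by `g x
  -- - g y`.
  have hD1 : ∫⁻ x in D, ‖g x - q‖ₑ ^ p ∂μ ≤
      ENNReal.ofReal (a ^ (2 * n) / m) * energyOn μ n e p g (U ×ˢ U) := by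
    have hx : ∀ x ∈ D, ‖g x - q‖ₑ ^ p ≤ ENNReal.ofReal (a ^ (2 * n) / m) *
        ∫⁻ y in A, G (x, y) ∂μ := by
      intro x hx
      have h1 : ENNReal.ofReal m * ‖g x - q‖ₑ ^ p ≤
          ENNReal.ofReal (a ^ (2 * n)) * ∫⁻ y in A, G (x, y) ∂μ := by
        calc ENNReal.ofReal m * ‖g x - q‖ₑ ^ p ≤ μ A * ‖g x - q‖ₑ ^ p := mul_le_mul_left hmA _
          _ = ∫⁻ _ in A, ‖g x - q‖ₑ ^ p ∂μ := by rw [setLIntegral_const, mul_comm]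
          _ ≤ ∫⁻ y in A, ENNReal.ofReal (a ^ (2 * n)) * G (x, y) ∂μ := by
            refine setLIntegral_mono' hAm fun y hy => ?_
            rw [← hq y hy]
            exact enorm_sub_rpow_le_mul_gagliardoWeight hinj hp g (hdiam x hx y hy)
          _ = _ := lintegral_const_mul' _ _ ENNReal.ofReal_ne_top
      have hm' : ENNReal.ofReal m⁻¹ * ENNReal.ofReal m = 1 := by
        rw [← ENNReal.ofReal_mul (by positivity), inv_mul_cancel₀ hm.ne', ENNReal.ofReal_one]
      calc ‖g x - q‖ₑ ^ p = ENNReal.ofReal m⁻¹ * (ENNReal.ofReal m * ‖g x - q‖ₑ ^ p) := by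
            rw [← mul_assoc, hm', one_mul]
        _ ≤ ENNReal.ofReal m⁻¹ * (ENNReal.ofReal (a ^ (2 * n)) * ∫⁻ y in A, G (x, y) ∂μ) :=
            mul_le_mul_right h1 _
        _ = _ := by
            rw [← mul_assoc, ← ENNReal.ofReal_mul (by positivity), div_eq_inv_mul]
    calc ∫⁻ x in D, ‖g x - q‖ₑ ^ p ∂μ ≤ ∫⁻ x in D, ENNReal.ofReal (a ^ (2 * n) / m) *
          ∫⁻ y in A, G (x, y) ∂μ ∂μ := setLIntegral_mono' hD hx
      _ = ENNReal.ofReal (a ^ (2 * n) / m) * ∫⁻ x in D, ∫⁻ y in A, G (x, y) ∂μ ∂μ :=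
          lintegral_const_mul' _ _ ENNReal.ofReal_ne_top
      _ = ENNReal.ofReal (a ^ (2 * n) / m) * energyOn μ n e p g (D ×ˢ A) := by
          rw [energyOn, ← Measure.prod_restrict, lintegral_prod _ hGm.aemeasurable]
      _ ≤ _ := mul_le_mul_right (energyOn_mono_set
          (prod_mono subset_union_left subset_union_right)) _
  -- The separation `σ` makes the weight integrable over the complement of `U`, uniformly in `x ∈
  -- D`.
  have hTI : ∫⁻ w, T w ∂(μ.prod μ) ≤
      ENNReal.ofReal (C₀ * 2 ^ (n + 1) / σ ^ n * (a ^ (2 * n) / m)) *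
        energyOn μ n e p g (U ×ˢ U) := by
    have hwm : ∀ x, Measurable fun y => gagliardoWeight n e x y := fun x =>
      (measurable_gagliardoWeight he).comp (measurable_prodMk_left (x := x))
    calc ∫⁻ w, T w ∂(μ.prod μ) = ∫⁻ x in D, ∫⁻ y in Uᶜ,
          ‖g x - q‖ₑ ^ p * gagliardoWeight n e x y ∂μ ∂μ := by
          rw [hT, lintegral_indicator (hD.prod hUm.compl), ← Measure.prod_restrict,
            lintegral_prod]
          exact ((((hg.comp measurable_fst).sub_const q).enorm.pow_const p).mul
            (measurable_gagliardoWeight he)).aemeasurable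
      _ ≤ ∫⁻ x in D, ENNReal.ofReal (C₀ * 2 ^ (n + 1) / σ ^ n) * ‖g x - q‖ₑ ^ p ∂μ := by
          refine setLIntegral_mono' hD fun x hx => ?_
          rw [lintegral_const_mul _ (hwm x), mul_comm]
          refine mul_le_mul_left (le_trans (lintegral_mono_set fun y hy => ?_)
            (lintegral_gagliardoWeight_compl_embBall_le hA he hn x hσ)) _
          exact fun hy' => absurd (mem_embBall'.1 hy') (not_lt.2 (hsep x hx y hy))
      _ = ENNReal.ofReal (C₀ * 2 ^ (n + 1) / σ ^ n) * ∫⁻ x in D, ‖g x - q‖ₑ ^ p ∂μ :=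
          lintegral_const_mul' _ _ ENNReal.ofReal_ne_top
      _ ≤ ENNReal.ofReal (C₀ * 2 ^ (n + 1) / σ ^ n) * (ENNReal.ofReal (a ^ (2 * n) / m) *
          energyOn μ n e p g (U ×ˢ U)) := mul_le_mul_right hD1 _
      _ = _ := by rw [← mul_assoc, ← ENNReal.ofReal_mul (by positivity)]
  calc energyOn μ n e p h univ
      ≤ ∫⁻ w, ((U ×ˢ U).indicator G w + (T w + T w.swap)) ∂(μ.prod μ) := by
        rw [energyOn, Measure.restrict_univ]; exact lintegral_mono hpt
    _ = energyOn μ n e p g (U ×ˢ U) + (∫⁻ w, T w ∂(μ.prod μ) + ∫⁻ w, T w ∂(μ.prod μ)) := by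
        rw [lintegral_add_left (hGm.indicator (hUm.prod hUm)), lintegral_add_left hTm,
          lintegral_indicator (hUm.prod hUm), lintegral_prod_swap T, energyOn]
    _ ≤ energyOn μ n e p g (U ×ˢ U) + (ENNReal.ofReal (C₀ * 2 ^ (n + 1) / σ ^ n *
        (a ^ (2 * n) / m)) * energyOn μ n e p g (U ×ˢ U) + ENNReal.ofReal (C₀ * 2 ^ (n + 1) /
        σ ^ n * (a ^ (2 * n) / m)) * energyOn μ n e p g (U ×ˢ U)) :=
        add_le_add le_rfl (add_le_add hTI hTI)
    _ = _ := by
        have hB : 0 ≤ C₀ * 2 ^ (n + 1) / σ ^ n * (a ^ (2 * n) / m) := by positivity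
        rw [ENNReal.ofReal_add zero_le_one (by positivity), two_mul (C₀ * 2 ^ (n + 1) / σ ^ n * _),
          ENNReal.ofReal_add hB hB, add_mul, add_mul, ENNReal.ofReal_one, one_mul]

end EnergyTools

/-! ### Points have zero capacity -/

section Cutoff

variable {X : Type*} [MeasurableSpace X]
  {E : Type*} [NormedAddCommGroup E] [MeasurableSpace E] [BorelSpace E]
  [SecondCountableTopology E]
  {μ : Measure X} [IsFiniteMeasure μ] {n : ℕ} {e : X → E} {c₀ C₀ p : ℝ}

/-- The piecewise linear cutoff that is `1` up to distance `σ` from `x₀` and vanishes from distance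
`2 * σ` on. -/
noncomputable def hat (e : X → E) (x₀ : X) (σ : ℝ) (x : X) : ℝ :=
  max 0 (min 1 (2 - ‖e x - e x₀‖ / σ))

theorem measurable_hat (he : Measurable e) (x₀ : X) (σ : ℝ) : Measurable (hat e x₀ σ) :=
  measurable_const.max (measurable_const.min (((he.sub_const _).norm.div_const _).const_sub _))

theorem hat_nonneg (x₀ : X) (σ : ℝ) (x : X) : 0 ≤ hat e x₀ σ x := le_max_left _ _

theorem hat_le_one (x₀ : X) (σ : ℝ) (x : X) : hat e x₀ σ x ≤ 1 :=
  max_le zero_le_one (min_le_left _ _)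

theorem hat_eq_one {x₀ x : X} {σ : ℝ} (hσ : 0 < σ) (hx : x ∈ embBall e x₀ σ) :
    hat e x₀ σ x = 1 := by
  have : ‖e x - e x₀‖ / σ < 1 := (div_lt_one hσ).2 hx
  rw [hat, min_eq_left (by linarith), max_eq_right zero_le_one]

theorem hat_eq_zero {x₀ x : X} {σ : ℝ} (hσ : 0 < σ) (hx : x ∉ embBall e x₀ (2 * σ)) :
    hat e x₀ σ x = 0 := by
  have : 2 ≤ ‖e x - e x₀‖ / σ := (le_div_iff₀ hσ).2 (not_lt.1 hx)
  rw [hat, max_eq_left]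
  exact (min_le_right _ _).trans (by linarith)

theorem abs_hat_sub_le {x₀ x y : X} {σ : ℝ} (hσ : 0 < σ) :
    |hat e x₀ σ x - hat e x₀ σ y| ≤ ‖e x - e y‖ / σ := by
  unfold hat
  rw [max_comm 0, max_comm 0, min_comm 1, min_comm 1]
  refine (abs_max_sub_max_le_abs _ _ _).trans ((abs_min_sub_min_le_max _ _ _ _).trans ?_)
  rw [sub_self, abs_zero, sub_sub_sub_cancel_left, ← sub_div, abs_div, abs_of_pos hσ,
    max_eq_left (by positivity)]
  refine div_le_div_of_nonneg_right ?_ hσ.le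
  have := abs_norm_sub_norm_le (e y - e x₀) (e x - e x₀)
  rwa [sub_sub_sub_cancel_right, norm_sub_rev (e y) (e x)] at this

/-- Scale invariance of the critical energy. For fixed `x` the inner integral is of order `σ ^
(-n)`, by the Lipschitz constant `1 / σ` at distances below `σ` and by boundedness beyond. Up to
symmetry `x` runs over a ball of mass of order `σ ^ n`. -/
theorem exists_energyOn_hat_le (hA : IsAhlfors n μ e c₀ C₀) (he : Measurable e) (hn : 1 ≤ n)
    (hp : (n : ℝ) < p) (x₀ : X) :
    ∃ C : ℝ, 0 < C ∧ ∀ σ : ℝ, 0 < σ →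
      energyOn μ n e p (hat e x₀ σ) univ ≤ ENNReal.ofReal C := by
  obtain ⟨C₁, hC₁, hC₁'⟩ := exists_lintegral_rpow_mul_gagliardoWeight_le hA he hp
  have hC := hA.C_pos
  have hp0 : 0 < p := lt_of_le_of_lt (Nat.cast_nonneg n) hp
  refine ⟨2 * ((C₁ + C₀ * 2 ^ (n + 1)) * (C₀ * 2 ^ n)), by positivity, fun σ hσ => ?_⟩
  have hwm : ∀ x, Measurable fun y => gagliardoWeight n e x y := fun x =>
    (measurable_gagliardoWeight he).comp (measurable_prodMk_left (x := x))
  set B := embBall e x₀ (2 * σ) with hB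
  have hBm : MeasurableSet B := measurableSet_embBall he _ _
  set G : X × X → ℝ≥0∞ := fun w => ‖hat e x₀ σ w.1 - hat e x₀ σ w.2‖ₑ ^ p *
    gagliardoWeight n e w.1 w.2 with hG
  have hGm : Measurable G := measurable_energyDensity he (measurable_hat he _ _) n p
  set T : X × X → ℝ≥0∞ := (Prod.fst ⁻¹' B).indicator G with hT
  have hTm : Measurable T := hGm.indicator (measurable_fst hBm)
  have hpt : ∀ w, G w ≤ T w + T w.swap := by
    rintro ⟨x, y⟩
    by_cases hx : x ∈ B
    · rw [hT, indicator_of_mem (show (x, y) ∈ Prod.fst ⁻¹' B from hx)]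
      exact le_self_add
    by_cases hy : y ∈ B
    · refine le_trans (le_of_eq ?_) le_add_self
      rw [Prod.swap_prod_mk, hT, indicator_of_mem (show (y, x) ∈ Prod.fst ⁻¹' B from hy)]
      simp only [hG]
      rw [enorm_sub_rev, gagliardoWeight_comm]
    · simp [hG, hat_eq_zero hσ hx, hat_eq_zero hσ hy, hp0]
  have hx : ∀ x, ∫⁻ y, G (x, y) ∂μ ≤
      ENNReal.ofReal ((C₁ + C₀ * 2 ^ (n + 1)) / σ ^ n) := by
    intro x
    have hm2 : Measurable fun y => ENNReal.ofReal (‖e x - e y‖ ^ p) * gagliardoWeight n e x y :=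
      (((he.const_sub _).norm.pow_const p).ennreal_ofReal).mul (hwm x)
    rw [← lintegral_add_compl _ (measurableSet_embBall he x σ)]
    have e1 : ∫⁻ y in embBall e x σ, G (x, y) ∂μ ≤ ENNReal.ofReal (C₁ / σ ^ n) := by
      calc ∫⁻ y in embBall e x σ, G (x, y) ∂μ
          ≤ ∫⁻ y in embBall e x σ, ENNReal.ofReal (σ ^ p)⁻¹ *
            (ENNReal.ofReal (‖e x - e y‖ ^ p) * gagliardoWeight n e x y) ∂μ := by
            refine lintegral_mono fun y => ?_
            rw [← mul_assoc, ← ENNReal.ofReal_mul (by positivity)]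
            refine mul_le_mul_left ?_ _
            rw [← ofReal_norm, ENNReal.ofReal_rpow_of_nonneg (norm_nonneg _) hp0.le]
            refine ENNReal.ofReal_le_ofReal ?_
            rw [← div_eq_inv_mul, ← Real.div_rpow (norm_nonneg _) hσ.le]
            exact Real.rpow_le_rpow (norm_nonneg _) (abs_hat_sub_le hσ) hp0.le
        _ = ENNReal.ofReal (σ ^ p)⁻¹ * ∫⁻ y in embBall e x σ,
            ENNReal.ofReal (‖e x - e y‖ ^ p) * gagliardoWeight n e x y ∂μ :=
            lintegral_const_mul' _ _ ENNReal.ofReal_ne_top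
        _ ≤ ENNReal.ofReal (σ ^ p)⁻¹ * ENNReal.ofReal (C₁ * σ ^ (p - n)) :=
            mul_le_mul_right (hC₁' x σ hσ) _
        _ = _ := by
            rw [← ENNReal.ofReal_mul (by positivity), Real.rpow_sub hσ, Real.rpow_natCast]
            congr 1
            have : 0 < σ ^ p := by positivity
            field_simp
    have e2 : ∫⁻ y in (embBall e x σ)ᶜ, G (x, y) ∂μ ≤
        ENNReal.ofReal (C₀ * 2 ^ (n + 1) / σ ^ n) := by
      refine le_trans (lintegral_mono fun y => ?_)
        (lintegral_gagliardoWeight_compl_embBall_le hA he hn x hσ)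
      refine mul_le_of_le_one_left' (ENNReal.rpow_le_one ?_ hp0.le)
      rw [← ofReal_norm, ENNReal.ofReal_le_one, Real.norm_eq_abs, abs_le]
      have a1 := hat_nonneg (e := e) x₀ σ x
      have a2 := hat_nonneg (e := e) x₀ σ y
      have a3 := hat_le_one (e := e) x₀ σ x
      have a4 := hat_le_one (e := e) x₀ σ y
      constructor <;> linarith
    refine (add_le_add e1 e2).trans (le_of_eq ?_)
    rw [← ENNReal.ofReal_add (by positivity) (by positivity), add_div]
  have hTI : ∫⁻ w, T w ∂(μ.prod μ) ≤
      ENNReal.ofReal ((C₁ + C₀ * 2 ^ (n + 1)) * (C₀ * 2 ^ n)) := by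
    calc ∫⁻ w, T w ∂(μ.prod μ) = ∫⁻ x in B, ∫⁻ y, G (x, y) ∂μ ∂μ := by
          rw [lintegral_prod _ hTm.aemeasurable, ← lintegral_indicator hBm]
          refine lintegral_congr fun x => ?_
          by_cases hx : x ∈ B
          · rw [indicator_of_mem hx]
            refine lintegral_congr fun y => ?_
            rw [hT, indicator_of_mem (show (x, y) ∈ Prod.fst ⁻¹' B from hx)]
          · rw [indicator_of_notMem hx]
            refine (lintegral_congr fun y => ?_).trans lintegral_zero
            rw [hT, indicator_of_notMem (show (x, y) ∉ Prod.fst ⁻¹' B from hx)]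
      _ ≤ ∫⁻ _ in B, ENNReal.ofReal ((C₁ + C₀ * 2 ^ (n + 1)) / σ ^ n) ∂μ :=
          lintegral_mono fun x => hx x
      _ ≤ ENNReal.ofReal ((C₁ + C₀ * 2 ^ (n + 1)) / σ ^ n) *
          ENNReal.ofReal (C₀ * (2 * σ) ^ n) := by
          rw [setLIntegral_const]
          exact mul_le_mul_right (hA.measure_embBall_le x₀ (by positivity)) _
      _ = _ := by
          rw [← ENNReal.ofReal_mul (by positivity), mul_pow]
          congr 1
          field_simp
  calc energyOn μ n e p (hat e x₀ σ) univ ≤ ∫⁻ w, (T w + T w.swap) ∂(μ.prod μ) := by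
        rw [energyOn, Measure.restrict_univ]; exact lintegral_mono hpt
    _ = ∫⁻ w, T w ∂(μ.prod μ) + ∫⁻ w, T w ∂(μ.prod μ) := by
        rw [lintegral_add_left hTm, lintegral_prod_swap T]
    _ ≤ _ := by
        refine (add_le_add hTI hTI).trans (le_of_eq ?_)
        rw [← ENNReal.ofReal_add (by positivity) (by positivity), ← two_mul]

/-- Cutoffs at widely separated scales hardly interact. The new hat lives deep inside a ball where
`f` is constant, so only pairs joining its support to the outside of that ball see both functions,
and their total weight is of order `σ' ^ n / σ ^ n`. -/
theorem exists_energyOn_add_hat_le (hA : IsAhlfors n μ e c₀ C₀) (he : Measurable e) (hn : 1 ≤ n)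
    (hp : (n : ℝ) < p) {x₀ : X} {f : X → ℝ} (hf : Measurable f) {b σ : ℝ} (hb : 0 < b)
    (hσ : 0 < σ) (hf0 : ∀ x, 0 ≤ f x) (hfb : ∀ x, f x ≤ b) (hfσ : ∀ x ∈ embBall e x₀ σ, f x = b) :
    ∃ σ' : ℝ, 0 < σ' ∧ 2 * σ' ≤ σ ∧ energyOn μ n e p (fun x => f x + hat e x₀ σ' x) univ ≤
      energyOn μ n e p f univ + energyOn μ n e p (hat e x₀ σ') univ + 1 := by
  have hC := hA.C_pos
  have hp0 : 0 < p := lt_of_le_of_lt (Nat.cast_nonneg n) hp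
  set A : ℝ := (b + 1) ^ p * (C₀ * 2 ^ (n + 1) / (σ / 2) ^ n) * C₀ with hAdef
  have hApos : 0 < A := by positivity
  -- The three bounds keep distance `σ / 2` from the support of the hat to the complement of `U`,
  -- reduce `(2 * σ') ^ n` to `2 * σ'`, and make the interaction at most `1 / 2` in each order of
  -- the pair.
  set σ' : ℝ := min (σ / 4) (min (1 / 2) (1 / (4 * A))) with hσ'
  have hσ'0 : 0 < σ' := by positivity
  have hσ1 : σ' ≤ σ / 4 := min_le_left _ _
  have hσ2 : σ' ≤ 1 / 2 := (min_le_right _ _).trans (min_le_left _ _)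
  have hσ3 : σ' ≤ 1 / (4 * A) := (min_le_right _ _).trans (min_le_right _ _)
  refine ⟨σ', hσ'0, by linarith, ?_⟩
  set φ := hat e x₀ σ' with hφ
  have hφm : Measurable φ := measurable_hat he _ _
  set B := embBall e x₀ (2 * σ') with hB
  have hBm : MeasurableSet B := measurableSet_embBall he _ _
  set U := embBall e x₀ σ with hU
  have hUm : MeasurableSet U := measurableSet_embBall he _ _
  have hBU : B ⊆ U := fun x hx => mem_embBall.2 (lt_of_lt_of_le hx (by linarith))
  set T : X × X → ℝ≥0∞ := (B ×ˢ Uᶜ).indicator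
    fun w => ENNReal.ofReal ((b + 1) ^ p) * gagliardoWeight n e w.1 w.2 with hT
  have hTm : Measurable T := ((measurable_gagliardoWeight he).const_mul _).indicator
    (hBm.prod hUm.compl)
  have aux : ∀ x y, x ∈ B → y ∉ U →
      ‖(f x + φ x) - (f y + φ y)‖ₑ ^ p * gagliardoWeight n e x y ≤ T (x, y) := by
    intro x y hx hy
    rw [hT, indicator_of_mem (show (x, y) ∈ B ×ˢ Uᶜ from ⟨hx, hy⟩)]
    refine mul_le_mul_left ?_ _
    rw [← ofReal_norm, ENNReal.ofReal_rpow_of_nonneg (norm_nonneg _) hp0.le]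
    refine ENNReal.ofReal_le_ofReal (Real.rpow_le_rpow (norm_nonneg _) ?_ hp0.le)
    rw [Real.norm_eq_abs, abs_le]
    have a1 := hat_nonneg (e := e) x₀ σ' x
    have a2 := hat_nonneg (e := e) x₀ σ' y
    have a3 := hat_le_one (e := e) x₀ σ' x
    have a4 := hat_le_one (e := e) x₀ σ' y
    have := hf0 x; have := hf0 y; have := hfb x; have := hfb y
    constructor <;> linarith
  have hpt : ∀ w : X × X, ‖(f w.1 + φ w.1) - (f w.2 + φ w.2)‖ₑ ^ p * gagliardoWeight n e w.1 w.2 ≤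
      (‖f w.1 - f w.2‖ₑ ^ p * gagliardoWeight n e w.1 w.2 +
      ‖φ w.1 - φ w.2‖ₑ ^ p * gagliardoWeight n e w.1 w.2) + (T w + T w.swap) := by
    rintro ⟨x, y⟩
    by_cases hx : x ∈ B
    · by_cases hy : y ∈ U
      · refine le_trans (le_of_eq ?_) (le_add_self.trans le_self_add)
        simp only
        rw [hfσ x (hBU hx), hfσ y hy, add_sub_add_left_eq_sub]
      · exact (aux x y hx hy).trans (le_self_add.trans le_add_self)
    · by_cases hy : y ∈ B
      · by_cases hx' : x ∈ U
        · refine le_trans (le_of_eq ?_) (le_add_self.trans le_self_add)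
          simp only
          rw [hfσ y (hBU hy), hfσ x hx', add_sub_add_left_eq_sub]
        · have := aux y x hy hx'
          rw [enorm_sub_rev, gagliardoWeight_comm] at this
          exact this.trans (le_add_self.trans le_add_self)
      · refine le_trans (le_of_eq ?_) (le_self_add.trans le_self_add)
        simp only
        rw [hφ, hat_eq_zero hσ'0 hx, hat_eq_zero hσ'0 hy, add_zero, add_zero]
  have hTI : ∫⁻ w, T w ∂(μ.prod μ) ≤ ENNReal.ofReal (1 / 2) := by
    have hwm : ∀ x, Measurable fun y => gagliardoWeight n e x y := fun x =>
      (measurable_gagliardoWeight he).comp (measurable_prodMk_left (x := x))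
    calc ∫⁻ w, T w ∂(μ.prod μ) = ∫⁻ x in B, ∫⁻ y in Uᶜ,
          ENNReal.ofReal ((b + 1) ^ p) * gagliardoWeight n e x y ∂μ ∂μ := by
          rw [hT, lintegral_indicator (hBm.prod hUm.compl), ← Measure.prod_restrict,
            lintegral_prod]
          exact ((measurable_gagliardoWeight he).const_mul _).aemeasurable
      _ ≤ ∫⁻ x in B, ENNReal.ofReal ((b + 1) ^ p) *
            ENNReal.ofReal (C₀ * 2 ^ (n + 1) / (σ / 2) ^ n) ∂μ := by
          refine setLIntegral_mono' hBm fun x hx => ?_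
          rw [lintegral_const_mul _ (hwm x)]
          have hsub : Uᶜ ⊆ (embBall e x (σ / 2))ᶜ := by
            refine compl_subset_compl.2 fun y hy => mem_embBall.2 ?_
            have e1 : ‖e y - e x₀‖ ≤ ‖e y - e x‖ + ‖e x - e x₀‖ :=
              norm_sub_le_norm_sub_add_norm_sub ..
            have e2 := mem_embBall.1 hx
            have e3 := mem_embBall.1 hy
            linarith
          exact mul_le_mul_right (le_trans (lintegral_mono_set hsub)
            (lintegral_gagliardoWeight_compl_embBall_le hA he hn x (half_pos hσ))) _
      _ ≤ ENNReal.ofReal ((b + 1) ^ p) * ENNReal.ofReal (C₀ * 2 ^ (n + 1) / (σ / 2) ^ n) *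
          ENNReal.ofReal (C₀ * (2 * σ') ^ n) := by
          rw [setLIntegral_const]
          exact mul_le_mul_right (hA.measure_embBall_le x₀ (by positivity)) _
      _ = ENNReal.ofReal (A * (2 * σ') ^ n) := by
          rw [← ENNReal.ofReal_mul (by positivity), ← ENNReal.ofReal_mul (by positivity)]
          congr 1
          ring
      _ ≤ _ := by
          refine ENNReal.ofReal_le_ofReal ?_
          have h1 : (2 * σ') ^ n ≤ 2 * σ' :=
            pow_le_of_le_one (by positivity) (by linarith) (by lia)
          have h2 : A * σ' ≤ 1 / 4 := by
            calc A * σ' ≤ A * (1 / (4 * A)) := by gcongr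
              _ = 1 / 4 := by field_simp
          nlinarith
  calc energyOn μ n e p (fun x => f x + φ x) univ
      ≤ ∫⁻ w : X × X, ((‖f w.1 - f w.2‖ₑ ^ p * gagliardoWeight n e w.1 w.2 +
      ‖φ w.1 - φ w.2‖ₑ ^ p * gagliardoWeight n e w.1 w.2) + (T w + T w.swap)) ∂(μ.prod μ) := by
        rw [energyOn, Measure.restrict_univ]; exact lintegral_mono hpt
    _ = energyOn μ n e p f univ + energyOn μ n e p φ univ +
        (∫⁻ w, T w ∂(μ.prod μ) + ∫⁻ w, T w ∂(μ.prod μ)) := by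
        have hm3 : Measurable fun w : X × X => ‖f w.1 - f w.2‖ₑ ^ p * gagliardoWeight n e w.1 w.2 +
            ‖φ w.1 - φ w.2‖ₑ ^ p * gagliardoWeight n e w.1 w.2 :=
          (measurable_energyDensity he hf n p).add (measurable_energyDensity he hφm n p)
        rw [lintegral_add_left hm3,
          lintegral_add_left (measurable_energyDensity he hf n p), lintegral_add_left hTm,
          lintegral_prod_swap T, energyOn, energyOn, Measure.restrict_univ]
    _ ≤ _ := by
        refine add_le_add le_rfl ((add_le_add hTI hTI).trans (le_of_eq ?_))
        rw [← ENNReal.ofReal_add (by positivity) (by positivity)]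
        norm_num

/-- Stacking nested hats makes both the height and the energy grow linearly in `J`. Since the energy
is homogeneous of degree `p > 1`, dividing by the height makes it tend to zero; this replaces a
logarithmic cutoff. -/
theorem exists_staircase (hA : IsAhlfors n μ e c₀ C₀) (he : Measurable e) (hn : 1 ≤ n)
    (hp : (n : ℝ) < p) (x₀ : X) :
    ∃ C : ℝ, 0 < C ∧ ∀ (J : ℕ) (σ₀ : ℝ), 0 < σ₀ → ∃ σ : ℝ, 0 < σ ∧ σ ≤ σ₀ ∧ ∃ f : X → ℝ,
      Measurable f ∧ (∀ x, 0 ≤ f x) ∧ (∀ x, f x ≤ J + 1) ∧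
      (∀ x ∈ embBall e x₀ σ, f x = J + 1) ∧ (∀ x, x ∉ embBall e x₀ σ₀ → f x = 0) ∧
      energyOn μ n e p f univ ≤ ENNReal.ofReal ((J + 1) * C) := by
  obtain ⟨C, hC, hC'⟩ := exists_energyOn_hat_le hA he hn hp x₀
  refine ⟨C + 1, by positivity, fun J σ₀ hσ₀ => ?_⟩
  induction J with
  | zero =>
    refine ⟨σ₀ / 2, by positivity, by linarith, hat e x₀ (σ₀ / 2), measurable_hat he _ _,
      hat_nonneg _ _, fun x => by simpa using hat_le_one _ _ x,
      fun x hx => by simpa using hat_eq_one (half_pos hσ₀) hx,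
      fun x hx => hat_eq_zero (half_pos hσ₀) (by rwa [mul_div_cancel₀ _ (two_ne_zero' ℝ)]), ?_⟩
    refine (hC' _ (half_pos hσ₀)).trans (ENNReal.ofReal_le_ofReal ?_)
    simp
  | succ J ih =>
    obtain ⟨σ, hσ, hσσ, f, hf, hf0, hfb, hfσ, hfσ₀, hfE⟩ := ih
    obtain ⟨σ', hσ', h2, hE⟩ := exists_energyOn_add_hat_le hA he hn hp hf
      (b := (J : ℝ) + 1) (by positivity) hσ hf0 hfb hfσ
    refine ⟨σ', hσ', by linarith, fun x => f x + hat e x₀ σ' x, hf.add (measurable_hat he _ _),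
      fun x => add_nonneg (hf0 x) (hat_nonneg _ _ x), fun x => ?_, fun x hx => ?_, fun x hx => ?_,
      ?_⟩
    · push_cast
      exact add_le_add (hfb x) (hat_le_one _ _ x)
    · beta_reduce
      rw [hat_eq_one hσ' hx, hfσ x (mem_embBall.2 (lt_of_lt_of_le hx (by linarith)))]
      push_cast
      rfl
    · beta_reduce
      rw [hfσ₀ x hx, hat_eq_zero hσ', add_zero]
      exact fun hx' => hx (mem_embBall.2 (lt_of_lt_of_le hx' (by linarith)))
    · refine hE.trans ((add_le_add (add_le_add hfE (hC' σ' hσ')) le_rfl).trans (le_of_eq ?_))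
      rw [← ENNReal.ofReal_add (by positivity) (by positivity), ← ENNReal.ofReal_one,
        ← ENNReal.ofReal_add (by positivity) (by positivity)]
      congr 1
      push_cast
      ring

/-- Points have zero capacity for the critical Gagliardo energy. -/
theorem exists_cutoff (hA : IsAhlfors n μ e c₀ C₀) (he : Measurable e) (hn : 1 ≤ n)
    (hp : (n : ℝ) < p) (x₀ : X) {κ : ℝ≥0∞} (hκ : κ ≠ 0) {σ₀ : ℝ} (hσ₀ : 0 < σ₀) :
    ∃ σ : ℝ, 0 < σ ∧ σ ≤ σ₀ ∧ ∃ η : X → ℝ, Measurable η ∧ (∀ x, 0 ≤ η x) ∧ (∀ x, η x ≤ 1) ∧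
      (∀ x ∈ embBall e x₀ σ, η x = 1) ∧ (∀ x, x ∉ embBall e x₀ σ₀ → η x = 0) ∧
      energyOn μ n e p η univ ≤ κ := by
  obtain ⟨C, hC, h⟩ := exists_staircase hA he hn hp x₀
  have hp1 : 1 < p := lt_of_le_of_lt (by exact_mod_cast hn) hp
  -- Energy `(J + 1) * C` of the staircase, divided by `(J + 1) ^ p`.
  have hlim : Tendsto (fun J : ℕ => ENNReal.ofReal (C * ((J : ℝ) + 1) ^ (-(p - 1)))) atTop
      (𝓝 0) := by
    have h1 : Tendsto (fun J : ℕ => C * ((J : ℝ) + 1) ^ (-(p - 1))) atTop (𝓝 (C * 0)) :=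
      ((tendsto_rpow_neg_atTop (by linarith)).comp
        (tendsto_atTop_add_const_right _ _ tendsto_natCast_atTop_atTop)).const_mul C
    have h2 := ENNReal.tendsto_ofReal h1
    rwa [mul_zero, ENNReal.ofReal_zero] at h2
  obtain ⟨J, hJ⟩ := (hlim.eventually (ge_mem_nhds (pos_iff_ne_zero.2 hκ))).exists
  obtain ⟨σ, hσ, hσσ, f, hf, hf0, hfb, hfσ, hfσ₀, hfE⟩ := h J σ₀ hσ₀
  have hJ0 : (0 : ℝ) < J + 1 := by positivity
  refine ⟨σ, hσ, hσσ, fun x => f x / (J + 1), hf.div_const _,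
    fun x => div_nonneg (hf0 x) hJ0.le, fun x => (div_le_one hJ0).2 (hfb x),
    fun x hx => (congrArg (· / ((J : ℝ) + 1)) (hfσ x hx)).trans (div_self hJ0.ne'),
    fun x hx => (congrArg (· / ((J : ℝ) + 1)) (hfσ₀ x hx)).trans (zero_div _), ?_⟩
  refine le_trans (energyOn_le_of_norm_sub_le (g := f) MeasurableSet.univ
    (inv_nonneg.2 hJ0.le) (by linarith) fun w _ => ?_) (le_trans (mul_le_mul_right hfE _) ?_)
  · rw [← sub_div, norm_div, Real.norm_of_nonneg hJ0.le, div_eq_inv_mul]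
  · rw [← ENNReal.ofReal_mul (by positivity)]
    refine le_trans (ENNReal.ofReal_le_ofReal (le_of_eq ?_)) hJ
    rw [Real.inv_rpow hJ0.le, neg_sub, Real.rpow_sub hJ0, Real.rpow_one]
    have : 0 < ((J : ℝ) + 1) ^ p := by positivity
    field_simp

end Cutoff

/-! ### An averaging density that is constant in the base point on a middle annulus -/

section Annulus

variable {X : Type*} [MeasurableSpace X]
  {E : Type*} [NormedAddCommGroup E] [MeasurableSpace E] [BorelSpace E]
  [SecondCountableTopology E]
  {V : Type*} [NormedAddCommGroup V] [NormedSpace ℝ V] [CompleteSpace V] [MeasurableSpace V]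
  [BorelSpace V] [SecondCountableTopology V]
  {μ : Measure X} [IsFiniteMeasure μ] {n : ℕ} {e : X → E} {c₀ C₀ p K r : ℝ} {x₀ : X}

/-- A scale which is positive exactly at distances between `r` and `K ^ 3 * r` from `x₀`. -/
noncomputable def annulusScale (e : X → E) (x₀ : X) (K r : ℝ) (x : X) : ℝ :=
  max 0 (min r (min (‖e x - e x₀‖ - r) (K ^ 3 * r - ‖e x - e x₀‖))) / 2

/-- A cutoff which is `1` at distances between `K * r` and `K ^ 2 * r` from `x₀`. -/
noncomputable def annulusCutoff (e : X → E) (x₀ : X) (K r : ℝ) (x : X) : ℝ :=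
  max 0 (min 1 (min (‖e x - e x₀‖ / r - 2) (2 * K ^ 2 - ‖e x - e x₀‖ / r)))

/-- An averaging density at scale `annulusScale` that does not depend on the point `x` at distances
between `K * r` and `K ^ 2 * r` from `x₀`. -/
noncomputable def annulusDensity (e : X → E) (x₀ : X) (K r : ℝ) (x y : X) : ℝ :=
  (1 - annulusCutoff e x₀ K r x) * max 0 (annulusScale e x₀ K r x - ‖e x - e y‖) +
    annulusCutoff e x₀ K r x * max 0 (r / 2 - ‖e y - e x₀‖)

theorem abs_max_zero_sub_le (a b : ℝ) : |max 0 a - max 0 b| ≤ |a - b| := by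
  simpa [max_comm] using abs_max_sub_max_le_abs a b 0

theorem abs_min_const_sub_le (c a b : ℝ) : |min c a - min c b| ≤ |a - b| := by
  refine (abs_min_sub_min_le_max c a c b).trans ?_
  simp

theorem abs_emb_dist_sub_le (x x' y : X) : |‖e x - e y‖ - ‖e x' - e y‖| ≤ ‖e x - e x'‖ := by
  simpa using abs_norm_sub_norm_le (e x - e y) (e x' - e y)

theorem annulusScale_nonneg (x : X) : 0 ≤ annulusScale e x₀ K r x :=
  div_nonneg (le_max_left _ _) zero_le_two

theorem annulusScale_le (hr : 0 < r) (x : X) : annulusScale e x₀ K r x ≤ r / 2 :=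
  div_le_div_of_nonneg_right (max_le hr.le (min_le_left _ _)) zero_le_two

theorem abs_annulusScale_sub_le (x x' : X) :
    |annulusScale e x₀ K r x - annulusScale e x₀ K r x'| ≤ ‖e x - e x'‖ / 2 := by
  rw [annulusScale, annulusScale, ← sub_div, abs_div, abs_two]
  refine div_le_div_of_nonneg_right ?_ zero_le_two
  refine (abs_max_zero_sub_le _ _).trans ((abs_min_const_sub_le _ _ _).trans
    ((abs_min_sub_min_le_max _ _ _ _).trans (max_le ?_ ?_)))
  · rw [sub_sub_sub_cancel_right]
    exact abs_emb_dist_sub_le ..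
  · rw [sub_sub_sub_cancel_left, abs_sub_comm]
    exact abs_emb_dist_sub_le ..

theorem annulusScale_eq_zero {x : X} (hx : ‖e x - e x₀‖ ≤ r ∨ K ^ 3 * r ≤ ‖e x - e x₀‖) :
    annulusScale e x₀ K r x = 0 := by
  rw [annulusScale, max_eq_left, zero_div]
  rcases hx with hx | hx
  · exact (min_le_right _ _).trans ((min_le_left _ _).trans (by linarith))
  · exact (min_le_right _ _).trans ((min_le_right _ _).trans (by linarith))

theorem annulusScale_eq (hr : 0 < r) {x : X} (h1 : 2 * r ≤ ‖e x - e x₀‖)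
    (h2 : ‖e x - e x₀‖ ≤ (K ^ 3 - 1) * r) : annulusScale e x₀ K r x = r / 2 := by
  rw [annulusScale, min_eq_left (le_min (by linarith) (by linarith)), max_eq_right hr.le]

theorem annulusCutoff_nonneg (x : X) : 0 ≤ annulusCutoff e x₀ K r x := le_max_left _ _

theorem annulusCutoff_le_one (x : X) : annulusCutoff e x₀ K r x ≤ 1 :=
  max_le zero_le_one (min_le_left _ _)

theorem abs_annulusCutoff_sub_le (hr : 0 < r) (x x' : X) :
    |annulusCutoff e x₀ K r x - annulusCutoff e x₀ K r x'| ≤ ‖e x - e x'‖ / r := by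
  have h : |‖e x - e x₀‖ / r - ‖e x' - e x₀‖ / r| ≤ ‖e x - e x'‖ / r := by
    rw [← sub_div, abs_div, abs_of_pos hr]
    exact div_le_div_of_nonneg_right (abs_emb_dist_sub_le ..) hr.le
  refine (abs_max_zero_sub_le _ _).trans ((abs_min_const_sub_le _ _ _).trans
    ((abs_min_sub_min_le_max _ _ _ _).trans (max_le ?_ ?_)))
  · rwa [sub_sub_sub_cancel_right]
  · rwa [sub_sub_sub_cancel_left, abs_sub_comm]

theorem annulusCutoff_eq_one (hr : 0 < r) (hK : 3 ≤ K) {x : X} (h1 : K * r ≤ ‖e x - e x₀‖)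
    (h2 : ‖e x - e x₀‖ ≤ K ^ 2 * r) : annulusCutoff e x₀ K r x = 1 := by
  have e1 : K ≤ ‖e x - e x₀‖ / r := (le_div_iff₀ hr).2 h1
  have e2 : ‖e x - e x₀‖ / r ≤ K ^ 2 := (div_le_iff₀ hr).2 h2
  rw [annulusCutoff, min_eq_left (le_min (by linarith) (by nlinarith)), max_eq_right zero_le_one]

theorem of_annulusCutoff_ne_zero (hr : 0 < r) {x : X} (hx : annulusCutoff e x₀ K r x ≠ 0) :
    2 * r < ‖e x - e x₀‖ ∧ ‖e x - e x₀‖ < 2 * K ^ 2 * r := by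
  have h : 0 < min 1 (min (‖e x - e x₀‖ / r - 2) (2 * K ^ 2 - ‖e x - e x₀‖ / r)) := by
    by_contra h
    exact hx (max_eq_left (not_lt.1 h))
  rw [lt_min_iff, lt_min_iff] at h
  rw [← lt_div_iff₀ hr, ← div_lt_iff₀ hr]
  constructor <;> linarith

/-- `3 ≤ K` gives `2 * K ^ 2 ≤ K ^ 3 - 1`, so the cutoff is supported where the scale has its full
value `r / 2`. The two bumps blended by the density then have comparable height and mass. -/
theorem annulusScale_eq_of_cutoff_ne_zero (hr : 0 < r) (hK : 3 ≤ K) {x : X}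
    (hx : annulusCutoff e x₀ K r x ≠ 0) : annulusScale e x₀ K r x = r / 2 := by
  obtain ⟨h1, h2⟩ := of_annulusCutoff_ne_zero hr hx
  refine annulusScale_eq hr h1.le (h2.le.trans ?_)
  have : 2 * K ^ 2 ≤ K ^ 3 - 1 := by nlinarith
  gcongr

theorem annulusDensity_nonneg (x y : X) : 0 ≤ annulusDensity e x₀ K r x y := by
  have h1 := annulusCutoff_nonneg (e := e) (x₀ := x₀) (K := K) (r := r) x
  have h2 := annulusCutoff_le_one (e := e) (x₀ := x₀) (K := K) (r := r) x
  have := sub_nonneg.2 h2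
  unfold annulusDensity
  positivity

theorem measurable_annulusScale (he : Measurable e) : Measurable (annulusScale e x₀ K r) := by
  have h : Measurable fun x => ‖e x - e x₀‖ := (he.sub_const _).norm
  exact (measurable_const.max (measurable_const.min
    ((h.sub_const _).min (h.const_sub _)))).div_const _

theorem measurable_annulusCutoff (he : Measurable e) : Measurable (annulusCutoff e x₀ K r) := by
  have h : Measurable fun x => ‖e x - e x₀‖ := (he.sub_const _).norm
  exact measurable_const.max (measurable_const.min
    (((h.div_const _).sub_const _).min ((h.div_const _).const_sub _)))

theorem measurable_annulusDensity (he : Measurable e) :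
    Measurable (Function.uncurry (annulusDensity e x₀ K r)) := by
  have h : Measurable fun x => ‖e x - e x₀‖ := (he.sub_const _).norm
  have h1 : Measurable fun w : X × X => annulusScale e x₀ K r w.1 :=
    (measurable_annulusScale he).comp measurable_fst
  have h2 : Measurable fun w : X × X => annulusCutoff e x₀ K r w.1 :=
    (measurable_annulusCutoff he).comp measurable_fst
  exact ((h2.const_sub 1).mul (measurable_const.max (h1.sub (measurable_emb_dist he)))).add
    (h2.mul (measurable_const.max ((h.comp measurable_snd).const_sub _)))

theorem annulusDensity_le (hr : 0 < r) (hK : 3 ≤ K) (x y : X) :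
    annulusDensity e x₀ K r x y ≤ annulusScale e x₀ K r x := by
  have h0 := annulusScale_nonneg (e := e) (x₀ := x₀) (K := K) (r := r) x
  have h1 := annulusCutoff_nonneg (e := e) (x₀ := x₀) (K := K) (r := r) x
  have h2 := annulusCutoff_le_one (e := e) (x₀ := x₀) (K := K) (r := r) x
  have h3 : max 0 (annulusScale e x₀ K r x - ‖e x - e y‖) ≤ annulusScale e x₀ K r x :=
    max_le h0 (by linarith [norm_nonneg (e x - e y)])
  have h4 : annulusCutoff e x₀ K r x * max 0 (r / 2 - ‖e y - e x₀‖) ≤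
      annulusCutoff e x₀ K r x * annulusScale e x₀ K r x := by
    by_cases hx : annulusCutoff e x₀ K r x = 0
    · simp [hx]
    · rw [annulusScale_eq_of_cutoff_ne_zero hr hK hx]
      exact mul_le_mul_of_nonneg_left (max_le (by positivity)
        (by linarith [norm_nonneg (e y - e x₀)])) h1
  unfold annulusDensity
  nlinarith

/-- The bump about `x₀` is used only within `2 * K ^ 2 * r` of `x₀`, where the scale is `r / 2`; the
factor `8 * K ^ 2` covers the distance to it. -/
theorem annulusDensity_supp (hr : 0 < r) (hK : 3 ≤ K) {x y : X}
    (h : annulusDensity e x₀ K r x y ≠ 0) :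
    ‖e x - e y‖ < 8 * K ^ 2 * annulusScale e x₀ K r x := by
  by_cases hx : annulusCutoff e x₀ K r x = 0
  · rw [annulusDensity, hx, zero_mul, add_zero, sub_zero, one_mul] at h
    have h1 : 0 < annulusScale e x₀ K r x - ‖e x - e y‖ := by
      by_contra hcon
      exact h (max_eq_left (not_lt.1 hcon))
    have h2 := annulusScale_nonneg (e := e) (x₀ := x₀) (K := K) (r := r) x
    have h3 := le_mul_of_one_le_left h2 (show 1 ≤ 8 * K ^ 2 by nlinarith)
    linarith
  · obtain ⟨h1, h2⟩ := of_annulusCutoff_ne_zero hr hx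
    rw [annulusScale_eq_of_cutoff_ne_zero hr hK hx]
    by_cases hy : ‖e y - e x₀‖ < r / 2
    · have e1 : ‖e x - e y‖ ≤ ‖e x - e x₀‖ + ‖e x₀ - e y‖ :=
        norm_sub_le_norm_sub_add_norm_sub ..
      rw [norm_sub_rev (e x₀)] at e1
      nlinarith
    · rw [annulusDensity, max_eq_left (a := (0 : ℝ)) (b := r / 2 - ‖e y - e x₀‖) (by linarith),
        mul_zero, add_zero, annulusScale_eq_of_cutoff_ne_zero hr hK hx] at h
      have h1 : 0 < r / 2 - ‖e x - e y‖ := by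
        by_contra hcon
        exact h (by rw [max_eq_left (not_lt.1 hcon), mul_zero])
      nlinarith

/-- The cutoff has Lipschitz constant `1 / r`, but it multiplies a difference of two bumps of height
at most `r / 2`, so the resulting constant does not depend on `r`. -/
theorem abs_annulusDensity_sub_le (hr : 0 < r) (x x' y : X) :
    |annulusDensity e x₀ K r x y - annulusDensity e x₀ K r x' y| ≤ 3 * ‖e x - e x'‖ := by
  set t := ‖e x - e x'‖ with ht
  have hθ := abs_annulusCutoff_sub_le (e := e) (x₀ := x₀) (K := K) hr x x'
  have h1 := annulusCutoff_nonneg (e := e) (x₀ := x₀) (K := K) (r := r) x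
  have h2 := annulusCutoff_le_one (e := e) (x₀ := x₀) (K := K) (r := r) x
  set θ := annulusCutoff e x₀ K r x
  set θ' := annulusCutoff e x₀ K r x'
  set a := max 0 (annulusScale e x₀ K r x - ‖e x - e y‖) with ha
  set a' := max 0 (annulusScale e x₀ K r x' - ‖e x' - e y‖) with ha'
  set b := max 0 (r / 2 - ‖e y - e x₀‖) with hb
  have haa : |a - a'| ≤ 3 / 2 * t := by
    refine (abs_max_zero_sub_le _ _).trans ?_
    have e1 := abs_annulusScale_sub_le (e := e) (x₀ := x₀) (K := K) (r := r) x x'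
    have e2 := abs_emb_dist_sub_le (e := e) x x' y
    rw [abs_le] at e1 e2 ⊢
    constructor <;> linarith
  have ha0 : 0 ≤ a' := le_max_left _ _
  have hb0 : 0 ≤ b := le_max_left _ _
  have har : a' ≤ r / 2 := max_le (by positivity)
    (by linarith [annulusScale_le (e := e) (x₀ := x₀) (K := K) hr x', norm_nonneg (e x' - e y)])
  have hbr : b ≤ r / 2 := max_le (by positivity) (by linarith [norm_nonneg (e y - e x₀)])
  have hab : |b - a'| ≤ r / 2 := by rw [abs_le]; constructor <;> linarith
  have key : annulusDensity e x₀ K r x y - annulusDensity e x₀ K r x' y =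
      (1 - θ) * (a - a') + (θ - θ') * (b - a') := by
    change ((1 - θ) * a + θ * b) - ((1 - θ') * a' + θ' * b) = _
    ring
  have e1 : |(1 - θ) * (a - a')| ≤ 3 / 2 * t := by
    rw [abs_mul, abs_of_nonneg (by linarith)]
    nlinarith [abs_nonneg (a - a')]
  have e2 : |(θ - θ') * (b - a')| ≤ t / r * (r / 2) := by
    rw [abs_mul]
    exact mul_le_mul hθ hab (abs_nonneg _) (by positivity)
  have e3 : t / r * (r / 2) = t / 2 := by field_simp
  rw [key]
  refine (abs_add_le _ _).trans ?_
  have : 0 ≤ t := norm_nonneg _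
  linarith

theorem IsAhlfors.le_measureReal_embBall (hA : IsAhlfors n μ e c₀ C₀) (x : X) {ρ : ℝ}
    (hρ : 0 < ρ) (hρ1 : ρ ≤ 1) : c₀ * ρ ^ n ≤ μ.real (embBall e x ρ) := by
  have hc := hA.c_pos
  have := ENNReal.toReal_mono (measure_ne_top μ _) (hA.lower x ρ hρ hρ1)
  rwa [ENNReal.toReal_ofReal (by positivity)] at this

theorem IsAhlfors.le_integral_max_sub (hA : IsAhlfors n μ e c₀ C₀) (he : Measurable e) (z : X)
    {d : ℝ} (hd : 0 < d) (hd1 : d ≤ 1) :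
    c₀ / 2 ^ (n + 1) * d ^ (n + 1) ≤ ∫ y, max 0 (d - ‖e y - e z‖) ∂μ := by
  have hB : MeasurableSet (embBall e z (d / 2)) := measurableSet_embBall he _ _
  have hm : Measurable fun y => max 0 (d - ‖e y - e z‖) :=
    measurable_const.max ((he.sub_const _).norm.const_sub _)
  have hint : Integrable (fun y => max 0 (d - ‖e y - e z‖)) μ :=
    Integrable.of_bound hm.aestronglyMeasurable d (ae_of_all _ fun y => by
      rw [Real.norm_of_nonneg (le_max_left _ _)]
      exact max_le hd.le (by linarith [norm_nonneg (e y - e z)]))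
  have h1 := hA.le_measureReal_embBall z (half_pos hd) (by linarith)
  calc c₀ / 2 ^ (n + 1) * d ^ (n + 1) = c₀ * (d / 2) ^ n * (d / 2) := by
        rw [div_pow, pow_succ, pow_succ]; field_simp
    _ ≤ μ.real (embBall e z (d / 2)) * (d / 2) := mul_le_mul_of_nonneg_right h1 (by positivity)
    _ = ∫ y, (embBall e z (d / 2)).indicator (fun _ => d / 2) y ∂μ := by
        rw [integral_indicator hB, setIntegral_const, smul_eq_mul]
    _ ≤ _ := by
        refine integral_mono ((integrable_const _).indicator hB) hint fun y => ?_
        by_cases hy : y ∈ embBall e z (d / 2)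
        · rw [indicator_of_mem hy]
          refine le_max_of_le_right ?_
          have := mem_embBall.1 hy
          linarith
        · rw [indicator_of_notMem hy]; exact le_max_left _ _

/-- A convex combination of two integrals satisfying the same lower bound, because both bumps have
scale `r / 2` wherever the second one occurs. -/
theorem annulusDensity_mass (hA : IsAhlfors n μ e c₀ C₀) (he : Measurable e) (hr : 0 < r)
    (hr1 : r ≤ 1) (hK : 3 ≤ K) {x : X} (hd : 0 < annulusScale e x₀ K r x) :
    c₀ / 2 ^ (n + 1) * annulusScale e x₀ K r x ^ (n + 1) ≤
      ∫ y, annulusDensity e x₀ K r x y ∂μ := by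
  have h1 := annulusCutoff_nonneg (e := e) (x₀ := x₀) (K := K) (r := r) x
  have h2 := annulusCutoff_le_one (e := e) (x₀ := x₀) (K := K) (r := r) x
  have hdr := annulusScale_le (e := e) (x₀ := x₀) (K := K) hr x
  have hi : ∀ (z : X) (d : ℝ), 0 < d → Integrable (fun y => max 0 (d - ‖e y - e z‖)) μ := by
    intro z d hd
    refine Integrable.of_bound (measurable_const.max
      ((he.sub_const _).norm.const_sub _)).aestronglyMeasurable d (ae_of_all _ fun y => ?_)
    rw [Real.norm_of_nonneg (le_max_left _ _)]
    exact max_le hd.le (by linarith [norm_nonneg (e y - e z)])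
  have e1 := hA.le_integral_max_sub he x hd (by linarith)
  have hint : ∫ y, annulusDensity e x₀ K r x y ∂μ = (1 - annulusCutoff e x₀ K r x) *
      ∫ y, max 0 (annulusScale e x₀ K r x - ‖e y - e x‖) ∂μ + annulusCutoff e x₀ K r x *
      ∫ y, max 0 (r / 2 - ‖e y - e x₀‖) ∂μ := by
    rw [← integral_const_mul, ← integral_const_mul,
      ← integral_add ((hi x _ hd).const_mul _) ((hi x₀ _ (half_pos hr)).const_mul _)]
    refine integral_congr_ae (ae_of_all _ fun y => ?_)
    simp only [annulusDensity, norm_sub_rev (e x) (e y)]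
  rw [hint]
  by_cases hθ : annulusCutoff e x₀ K r x = 0
  · rw [hθ]; linarith
  · have e2 := hA.le_integral_max_sub he x₀ (half_pos hr) (by linarith)
    rw [← annulusScale_eq_of_cutoff_ne_zero hr hK hθ] at e2
    rw [← annulusScale_eq_of_cutoff_ne_zero hr hK hθ]
    have e3 := mul_le_mul_of_nonneg_left e1 (sub_nonneg.2 h2)
    have e4 := mul_le_mul_of_nonneg_left e2 h1
    linarith

/-- The scale is `1/2`-Lipschitz, so `‖e x - e y‖ < d x` makes `d x` and `d y` comparable and puts
`x` in the ball of radius `2 * d y` about `y`. The fixed bump contributes `(2 / r) ^ n` on a ball of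
radius `2 * K ^ 2 * r`. -/
theorem annulusDensity_col (hA : IsAhlfors n μ e c₀ C₀) (he : Measurable e) (hr : 0 < r)
    (hK : 3 ≤ K) (y : X) :
    ∫⁻ x, ENNReal.ofReal (annulusDensity e x₀ K r x y / annulusScale e x₀ K r x ^ (n + 1)) ∂μ ≤
      ENNReal.ofReal (C₀ * 4 ^ n + C₀ * (4 * K ^ 2) ^ n) := by
  have hC := hA.C_pos
  set d := annulusScale e x₀ K r with hd
  have hd0 : ∀ x, 0 ≤ d x := annulusScale_nonneg
  have hpt : ∀ x, ENNReal.ofReal (annulusDensity e x₀ K r x y / d x ^ (n + 1)) ≤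
      (embBall e y (2 * d y)).indicator (fun _ => ENNReal.ofReal ((2 / d y) ^ n)) x +
      (embBall e x₀ (2 * K ^ 2 * r)).indicator (fun _ => ENNReal.ofReal ((2 / r) ^ n)) x := by
    intro x
    by_cases hdx : d x = 0
    · rw [hdx, zero_pow (by lia), div_zero, ENNReal.ofReal_zero]; exact zero_le
    have hdx0 : 0 < d x := lt_of_le_of_ne (hd0 x) (Ne.symm hdx)
    have h1 := annulusCutoff_nonneg (e := e) (x₀ := x₀) (K := K) (r := r) x
    have h2 := annulusCutoff_le_one (e := e) (x₀ := x₀) (K := K) (r := r) x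
    rw [annulusDensity, add_div, ENNReal.ofReal_add (div_nonneg (mul_nonneg (by linarith)
      (le_max_left _ _)) (by positivity)) (by positivity)]
    refine add_le_add ?_ ?_
    · by_cases ht : ‖e x - e y‖ < d x
      · have e1 := abs_annulusScale_sub_le (e := e) (x₀ := x₀) (K := K) (r := r) x y
        rw [← hd, abs_le] at e1
        have hxy : x ∈ embBall e y (2 * d y) := mem_embBall.2 (by linarith)
        rw [indicator_of_mem hxy]
        refine ENNReal.ofReal_le_ofReal ?_
        have e2 : (1 - annulusCutoff e x₀ K r x) * max 0 (d x - ‖e x - e y‖) ≤ d x := by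
          have : max 0 (d x - ‖e x - e y‖) ≤ d x :=
            max_le (hd0 x) (by linarith [norm_nonneg (e x - e y)])
          nlinarith [le_max_left 0 (d x - ‖e x - e y‖)]
        calc _ ≤ d x / d x ^ (n + 1) := by
              exact div_le_div_of_nonneg_right e2 (by positivity)
          _ = (1 / d x) ^ n := by rw [pow_succ, div_pow, one_pow]; field_simp
          _ ≤ _ := by
              refine pow_le_pow_left₀ (by positivity) ?_ _
              rw [div_le_div_iff₀ hdx0 (by linarith)]
              linarith
      · rw [max_eq_left (by linarith), mul_zero, zero_div, ENNReal.ofReal_zero]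
        exact zero_le
    · by_cases hθ : annulusCutoff e x₀ K r x = 0
      · rw [hθ, zero_mul, zero_div, ENNReal.ofReal_zero]; exact zero_le
      · have hx := (of_annulusCutoff_ne_zero hr hθ).2
        rw [indicator_of_mem (mem_embBall.2 hx), hd, annulusScale_eq_of_cutoff_ne_zero hr hK hθ]
        refine ENNReal.ofReal_le_ofReal ?_
        have e2 : annulusCutoff e x₀ K r x * max 0 (r / 2 - ‖e y - e x₀‖) ≤ r / 2 := by
          have : max 0 (r / 2 - ‖e y - e x₀‖) ≤ r / 2 :=
            max_le (by positivity) (by linarith [norm_nonneg (e y - e x₀)])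
          nlinarith [le_max_left 0 (r / 2 - ‖e y - e x₀‖)]
        calc _ ≤ (r / 2) / (r / 2) ^ (n + 1) :=
              div_le_div_of_nonneg_right e2 (by positivity)
          _ = _ := by rw [pow_succ, div_pow, div_pow]; field_simp
  refine (lintegral_mono hpt).trans ?_
  rw [lintegral_add_left (measurable_const.indicator (measurableSet_embBall he _ _)),
    lintegral_indicator (measurableSet_embBall he _ _),
    lintegral_indicator (measurableSet_embBall he _ _), setLIntegral_const, setLIntegral_const,
    ENNReal.ofReal_add (by positivity) (by positivity)]
  refine add_le_add ?_ ?_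
  · rcases (hd0 y).eq_or_lt with h0 | h0
    · have : embBall e y (2 * d y) = ∅ := by
        rw [← h0]
        exact eq_empty_of_forall_notMem fun x hx => by
          have := mem_embBall.1 hx
          have := norm_nonneg (e x - e y)
          linarith
      rw [this, measure_empty, mul_zero]
      exact zero_le
    · refine (mul_le_mul_right (hA.measure_embBall_le y (by positivity)) _).trans (le_of_eq ?_)
      rw [← ENNReal.ofReal_mul (by positivity)]
      congr 1
      rw [div_pow, mul_pow, show (4 : ℝ) = 2 * 2 by norm_num, mul_pow 2 2]
      field_simp
  · refine (mul_le_mul_right (hA.measure_embBall_le x₀ (by positivity)) _).trans (le_of_eq ?_)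
    rw [← ENNReal.ofReal_mul (by positivity)]
    congr 1
    rw [div_pow, mul_pow, show (4 : ℝ) * K ^ 2 = 2 * (2 * K ^ 2) by ring, mul_pow 2 (2 * K ^ 2)]
    field_simp

theorem exists_isAveraging_annulus (hA : IsAhlfors n μ e c₀ C₀) (he : Measurable e) (hK : 3 ≤ K)
    (x₀ : X) : ∃ Λ l : ℝ, 1 ≤ Λ ∧ 0 < l ∧ ∀ r, 0 < r → r ≤ 1 →
      IsAveraging μ n e univ (annulusScale e x₀ K r) (annulusDensity e x₀ K r) Λ l := by
  have hC := hA.C_pos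
  have hc := hA.c_pos
  have hp : 0 ≤ C₀ * 4 ^ n + C₀ * (4 * K ^ 2) ^ n := by positivity
  have hK2 : 9 ≤ K ^ 2 := by nlinarith
  refine ⟨8 * K ^ 2 + (C₀ * 4 ^ n + C₀ * (4 * K ^ 2) ^ n), c₀ / 2 ^ (n + 1), by linarith,
    by positivity, fun r hr hr1 => ?_⟩
  have hd0 : ∀ x, 0 ≤ annulusScale e x₀ K r x := annulusScale_nonneg
  exact
  { measurableSet := MeasurableSet.univ
    d_meas := measurable_annulusScale he
    k_meas := measurable_annulusDensity he
    one_le := by linarith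
    l_pos := by positivity
    d_nonneg := hd0
    d_lip := fun x _ x' _ => by
      have := (abs_le.1 (abs_annulusScale_sub_le (e := e) (x₀ := x₀) (K := K) (r := r) x x')).2
      have := norm_nonneg (e x - e x')
      linarith
    k_nonneg := annulusDensity_nonneg
    k_le := fun x _ y => (annulusDensity_le hr hK x y).trans
      (le_mul_of_one_le_left (hd0 x) (by linarith))
    k_supp := fun x _ y h => (annulusDensity_supp hr hK h).trans_le
      (mul_le_mul_of_nonneg_right (by linarith) (hd0 x))
    k_lip := fun x _ x' _ y => (abs_annulusDensity_sub_le hr x x' y).trans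
      (mul_le_mul_of_nonneg_right (by linarith) (norm_nonneg _))
    mass := fun x _ hx => annulusDensity_mass hA he hr hr1 hK hx
    col := fun y => by
      rw [Measure.restrict_univ]
      exact (annulusDensity_col hA he hr hK y).trans (ENNReal.ofReal_le_ofReal (by linarith)) }

/-- This is what the bump about `x₀` is for: where the cutoff is 1, nothing in the density depends
on the base point any more. -/
theorem avg_annulus_congr (hr : 0 < r) (hK : 3 ≤ K) (f : X → V) {x x' : X}
    (h1 : K * r ≤ ‖e x - e x₀‖) (h2 : ‖e x - e x₀‖ ≤ K ^ 2 * r)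
    (h1' : K * r ≤ ‖e x' - e x₀‖) (h2' : ‖e x' - e x₀‖ ≤ K ^ 2 * r) :
    avg μ (annulusScale e x₀ K r) (annulusDensity e x₀ K r) f x =
      avg μ (annulusScale e x₀ K r) (annulusDensity e x₀ K r) f x' := by
  have e1 := annulusCutoff_eq_one hr hK h1 h2
  have e2 := annulusCutoff_eq_one hr hK h1' h2'
  have d1 := annulusScale_eq_of_cutoff_ne_zero (e := e) (x₀ := x₀) (x := x) hr hK
    (by rw [e1]; exact one_ne_zero)
  have d2 := annulusScale_eq_of_cutoff_ne_zero (e := e) (x₀ := x₀) (x := x') hr hK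
    (by rw [e2]; exact one_ne_zero)
  have hk : annulusDensity e x₀ K r x = annulusDensity e x₀ K r x' := by
    funext y
    rw [annulusDensity, annulusDensity, e1, e2]
    simp
  rw [avg, avg, if_neg (by rw [d1]; positivity), if_neg (by rw [d2]; positivity)]
  unfold normDensity
  rw [hk]

end Annulus

/-! ### Making a map constant on an annulus -/

section Blocks

variable {X : Type*} [MeasurableSpace X]
  {E : Type*} [NormedAddCommGroup E] [MeasurableSpace E] [BorelSpace E]
  [SecondCountableTopology E]
  {V : Type*} [NormedAddCommGroup V] [NormedSpace ℝ V] [CompleteSpace V] [MeasurableSpace V]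
  [BorelSpace V] [SecondCountableTopology V]
  {μ : Measure X} [IsFiniteMeasure μ] {n : ℕ} {e : X → E} {c₀ C₀ p a r : ℝ} {x₀ : X}
  {N : Type*} {ι : N → V} {ρ : V → N} {δ K : ℝ}

/-- A retraction of the `δ`-neighbourhood of the range of `ι` that is `K`-Lipschitz. -/
structure IsLipschitzRetraction (ι : N → V) (ρ : V → N) (δ K : ℝ) : Prop where
  pos : 0 < δ
  nonneg : 0 ≤ K
  left_inv : ∀ q, ρ (ι q) = q
  lip : ∀ w w', (∃ q, ‖w - ι q‖ < δ) → (∃ q, ‖w' - ι q‖ < δ) →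
    ‖ι (ρ w) - ι (ρ w')‖ ≤ K * ‖w - w'‖

/-- Nothing is known about `ρ` outside the tube, so measurability is obtained by restricting `ι ∘ ρ`
to the tube, where it is continuous. -/
theorem IsLipschitzRetraction.measurable_comp (hρ : IsLipschitzRetraction ι ρ δ K) {F : X → V}
    (hF : Measurable F) (h : ∀ x, ∃ q, ‖F x - ι q‖ < δ) : Measurable fun x => ι (ρ (F x)) := by
  set U : Set V := {w | ∃ q, ‖w - ι q‖ < δ} with hU
  have hc : ContinuousOn (fun w => ι (ρ w)) U := by
    refine LipschitzOnWith.continuousOn (K := K.toNNReal) (LipschitzOnWith.of_dist_le_mul ?_)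
    intro w hw w' hw'
    rw [dist_eq_norm, dist_eq_norm, Real.coe_toNNReal K hρ.nonneg]
    exact hρ.lip w w' hw hw'
  have h1 : Measurable (U.domRestrict fun w => ι (ρ w)) :=
    (continuousOn_iff_continuous_domRestrict.1 hc).measurable
  exact h1.comp (hF.subtype_mk (h := h))

/-- A device for fixing error budgets backwards; dividing by `c + 1` covers `c = 0`. -/
theorem exists_ne_zero_mul_le {c κ : ℝ≥0∞} (hc : c ≠ ⊤) (hκ : κ ≠ 0) :
    ∃ κ' : ℝ≥0∞, κ' ≠ 0 ∧ c * κ' ≤ κ := by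
  have h1 : c + 1 ≠ ⊤ := ENNReal.add_ne_top.2 ⟨hc, ENNReal.one_ne_top⟩
  refine ⟨κ / (c + 1), ENNReal.div_ne_zero.2 ⟨hκ, h1⟩, ?_⟩
  exact (mul_le_mul_left le_self_add _).trans ENNReal.mul_div_le

/-- By the choice of `a` the large ball has mass at least `2 * C₀ * r ^ n`, while the small one has
at most `C₀ * r ^ n`. -/
theorem exists_annulus_measure (hA : IsAhlfors n μ e c₀ C₀) (hn : 1 ≤ n)
    (x₀ : X) : ∃ a : ℝ, 3 ≤ a ∧ ∀ r : ℝ, 0 < r → a * r ≤ 1 →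
      ENNReal.ofReal (C₀ * r ^ n) ≤ μ (embBall e x₀ (a * r) \ embBall e x₀ r) := by
  have hc := hA.c_pos
  have hC := hA.C_pos
  refine ⟨max 3 (2 * C₀ / c₀), le_max_left _ _, fun r hr har => ?_⟩
  set a := max 3 (2 * C₀ / c₀) with ha
  have ha3 : 3 ≤ a := le_max_left _ _
  have h1 : 2 * C₀ ≤ c₀ * a ^ n := by
    have e1 : 2 * C₀ / c₀ ≤ a := le_max_right _ _
    have e2 : a ≤ a ^ n := le_self_pow₀ (by linarith) (by lia)
    calc 2 * C₀ = c₀ * (2 * C₀ / c₀) := by field_simp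
      _ ≤ c₀ * a ^ n := by gcongr; exact e1.trans e2
  have h2 : ENNReal.ofReal (2 * C₀ * r ^ n) ≤ μ (embBall e x₀ (a * r)) := by
    refine le_trans (ENNReal.ofReal_le_ofReal ?_) (hA.lower x₀ (a * r) (by positivity) har)
    rw [mul_pow, ← mul_assoc]
    gcongr
  refine le_trans ?_ (le_measure_sdiff ..)
  refine le_trans ?_ (tsub_le_tsub h2 (hA.measure_embBall_le x₀ hr))
  rw [← ENNReal.ofReal_sub _ (by positivity)]
  exact ENNReal.ofReal_le_ofReal (by linarith)

theorem embBall_mono {x : X} {r r' : ℝ} (h : r ≤ r') : embBall e x r ⊆ embBall e x r' :=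
  fun _ hy => lt_of_lt_of_le hy h

/-- Truncation with the annulus as separating set. Separation, diameter and mass all scale with `r`,
so the constant depends only on `n` and `a`. -/
theorem energyOn_indicator_embBall_le (hA : IsAhlfors n μ e c₀ C₀) (he : Measurable e)
    (hinj : Function.Injective e) (hn : 1 ≤ n) (hp : 0 < p) {g : X → V} (hg : Measurable g)
    {q : V} (ha : 2 ≤ a) (hr : 0 < r)
    (hq : ∀ x, r ≤ ‖e x - e x₀‖ → ‖e x - e x₀‖ < a * r → g x = q)
    (hm : ENNReal.ofReal (C₀ * r ^ n) ≤ μ (embBall e x₀ (a * r) \ embBall e x₀ r)) :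
    energyOn μ n e p ((embBall e x₀ r).indicator fun x => g x - q) univ ≤
      ENNReal.ofReal (1 + 2 * (2 ^ (n + 1) * (2 * a) ^ (2 * n))) *
        energyOn μ n e p g (embBall e x₀ (a * r) ×ˢ embBall e x₀ (a * r)) := by
  have hC := hA.C_pos
  have hU : embBall e x₀ r ∪ (embBall e x₀ (a * r) \ embBall e x₀ r) = embBall e x₀ (a * r) := by
    rw [union_sdiff_self]
    exact union_eq_self_of_subset_left (embBall_mono (le_mul_of_one_le_left hr.le (by linarith)))
  have h := energyOn_indicator_le (D := embBall e x₀ r)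
    (A := embBall e x₀ (a * r) \ embBall e x₀ r) (q := q) (σ := r) (a := 2 * a * r)
    hA he hinj hn hp hg (measurableSet_embBall he _ _)
    ((measurableSet_embBall he _ _).diff (measurableSet_embBall he _ _))
    (fun x hx => hq x (not_lt.1 hx.2) hx.1) hr (by positivity : 0 < C₀ * r ^ n) ?_ ?_ hm
  · rw [hU] at h
    refine h.trans (le_of_eq ?_)
    congr 3
    rw [mul_pow (2 * a) r, two_mul n, pow_add r]
    field_simp
  · intro x hx y hy
    rw [hU] at hy
    have h1 : a * r ≤ ‖e y - e x₀‖ := not_lt.1 hy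
    have h2 := mem_embBall.1 hx
    have h3 : ‖e y - e x₀‖ ≤ ‖e y - e x‖ + ‖e x - e x₀‖ := norm_sub_le_norm_sub_add_norm_sub ..
    rw [norm_sub_rev (e y) (e x)] at h3
    nlinarith
  · intro x hx y hy
    have h1 := mem_embBall'.1 hy.1
    have h2 := mem_embBall.1 hx
    have h3 : ‖e x - e y‖ ≤ ‖e x - e x₀‖ + ‖e x₀ - e y‖ := norm_sub_le_norm_sub_add_norm_sub ..
    nlinarith

/-- A map can be made constant on an annulus about `x₀` at a small cost of energy. -/
theorem exists_annulus_block (hA : IsAhlfors n μ e c₀ C₀) (he : Measurable e)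
    (hinj : Function.Injective e) (hn : 1 ≤ n) (hp : (n : ℝ) < p)
    (hρ : IsLipschitzRetraction ι ρ δ K) {b : ℝ} (hb : ∀ q, ‖ι q‖ ≤ b) (x₀ : X) {u : X → N}
    (hu : Measurable fun x => ι (u x)) (hE : energyOn μ n e p (fun x => ι (u x)) univ ≠ ⊤)
    (ha : 3 ≤ a) (hm : ∀ r : ℝ, 0 < r → a * r ≤ 1 →
      ENNReal.ofReal (C₀ * r ^ n) ≤ μ (embBall e x₀ (a * r) \ embBall e x₀ r))
    {κ : ℝ≥0∞} (hκ : κ ≠ 0) {R : ℝ} (hR : 0 < R) :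
    ∃ r : ℝ, 0 < r ∧ a ^ 4 * r ≤ R ∧ a ^ 4 * r ≤ 1 ∧ ∃ (g : X → N) (q : N),
      Measurable (fun x => ι (g x)) ∧
      (∀ x, ‖e x - e x₀‖ ≤ r ∨ a ^ 3 * r ≤ ‖e x - e x₀‖ → g x = u x) ∧
      (∀ x, a * r ≤ ‖e x - e x₀‖ → ‖e x - e x₀‖ ≤ a ^ 2 * r → g x = q) ∧
      energyOn μ n e p (fun x => ι (g x))
        (embBall e x₀ (a ^ 4 * r) ×ˢ embBall e x₀ (a ^ 4 * r)) ≤ κ ∧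
      energyOn μ n e p (fun x => ι (u x))
        (embBall e x₀ (a ^ 4 * r) ×ˢ embBall e x₀ (a ^ 4 * r)) ≤ κ ∧
      ∀ Q : X → Prop, (∀ᵐ x ∂μ, Q x) →
        ∃ y ∈ embBall e x₀ R, Q y ∧ ‖ι q - ι (u y)‖ < δ := by
  have hC := hA.C_pos
  have hp1 : 1 ≤ p := le_trans (by exact_mod_cast hn) hp.le
  have hp0 : 0 < p := by linarith
  obtain ⟨Λ, l, hΛ, hl, hav⟩ := exists_isAveraging_annulus hA he ha x₀
  obtain ⟨C, hC, hCE⟩ := IsAveraging.exists_energyOn_avg_le (V := V) hA he hinj hn hp Λ l hΛ hl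
  set f : X → V := fun x => ι (u x) with hf
  have hfb : ∀ x, ‖f x‖ ≤ b := fun x => hb _
  have hK := hρ.nonneg
  have hδ := hρ.pos
  -- Values within `δ₁` of `N` stay within `K * δ₁ < δ` of each other after the retraction.
  set δ₁ : ℝ := δ / (K + 1) with hδ₁
  have hδ₁0 : 0 < δ₁ := by positivity
  have hδ₁δ : δ₁ ≤ δ := div_le_self hδ.le (by linarith)
  set C₂ : ℝ := (Λ / l) ^ 2 * (2 * Λ) ^ (2 * n) with hC₂
  obtain ⟨κ₁, hκ₁, hκ₁'⟩ := exists_ne_zero_mul_le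
    (ENNReal.mul_ne_top (ENNReal.ofReal_ne_top (r := K ^ p)) (ENNReal.ofReal_ne_top (r := C))) hκ
  have hδp : ENNReal.ofReal ((δ₁ / 2) ^ p) ≠ 0 := by
    rw [Ne, ENNReal.ofReal_eq_zero, not_le]; positivity
  obtain ⟨κ₂, hκ₂, hκ₂'⟩ := exists_ne_zero_mul_le (ENNReal.ofReal_ne_top (r := C₂)) hδp
  obtain ⟨δ', hδ', hsmall⟩ := exists_energyOn_closePairs_le hA he hn hE
    (κ := min κ (min κ₁ κ₂)) (by simp [hκ, hκ₁, hκ₂])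
  have hs := hsmall.le
  rw [le_min_iff, le_min_iff] at hs
  obtain ⟨hs0, hs1, hs2⟩ := hs
  have ha4 : 1 ≤ a ^ 4 := one_le_pow₀ (by linarith)
  -- Two points of the ball of radius `a ^ 4 * r` are `2 * a ^ 4 * r`-close, and the averaging
  -- estimate enlarges distances by `4 * Λ + 1`; with `A * r ≤ δ'` all pairs involved have small
  -- energy.
  set A : ℝ := (4 * Λ + 1) * (2 * a ^ 4) with hAdef
  have hA0 : 0 < A := by positivity
  set r : ℝ := min (R / A) (min (1 / A) (δ' / A)) with hr
  have hr0 : 0 < r := by positivity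
  have hrR : A * r ≤ R := by
    rw [mul_comm, ← le_div_iff₀ hA0]; exact min_le_left _ _
  have hr1 : A * r ≤ 1 := by
    rw [mul_comm, ← le_div_iff₀ hA0]; exact (min_le_right _ _).trans (min_le_left _ _)
  have hrδ : A * r ≤ δ' := by
    rw [mul_comm, ← le_div_iff₀ hA0]; exact (min_le_right _ _).trans (min_le_right _ _)
  have hAr : (4 * Λ + 1) * (2 * a ^ 4 * r) = A * r := by rw [hAdef]; ring
  have ha4r : r ≤ a ^ 4 * r := le_mul_of_one_le_left hr0.le ha4
  have hAΛ : 4 * Λ * r + a ^ 4 * r ≤ A * r := by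
    rw [← hAr]
    nlinarith [mul_nonneg (by linarith : (0 : ℝ) ≤ Λ) (by linarith : 0 ≤ a ^ 4 * r - r)]
  have hΛr : 0 < Λ * r := by positivity
  have h := hav r hr0 (by linarith)
  set d := annulusScale e x₀ a r with hd
  have hdr : ∀ x, d x ≤ r / 2 := annulusScale_le hr0
  have hd0 : ∀ x, 0 ≤ d x := annulusScale_nonneg
  set F := avg μ d (annulusDensity e x₀ a r) f with hF
  have hFm : Measurable F := h.measurable_avg hu
  have hFu : ∀ x, d x = 0 → F x = f x := fun x hx => by rw [hF, avg, if_pos hx]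
  -- Small energy at every scale below `δ'` keeps averages close to values of `f`, even if `f` is
  -- discontinuous.
  have hclose : ∀ x, d x ≠ 0 → ∀ Q : X → Prop, (∀ᵐ x ∂μ, Q x) →
      ∃ y, Q y ∧ ‖e x - e y‖ ≤ Λ * r ∧ ‖F x - f y‖ < δ₁ := by
    intro x hx Q hQ
    have e1 : Λ * d x ≤ Λ * (r / 2) := mul_le_mul_of_nonneg_left (hdr x) (by linarith)
    obtain ⟨y, hy, hxy, hFy⟩ := h.exists_enorm_avg_sub_le he hinj hu hfb hp1 (mem_univ x) hx
      (D := δ') (by linarith) hQ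
    refine ⟨y, hy, by linarith, ?_⟩
    have e2 := hFy.trans ((mul_le_mul_right hs2 _).trans hκ₂')
    rw [← ENNReal.ofReal_rpow_of_nonneg (by positivity) hp0.le,
      ENNReal.rpow_le_rpow_iff hp0, ← ofReal_norm,
      ENNReal.ofReal_le_ofReal_iff (by positivity)] at e2
    exact e2.trans_lt (by linarith)
  have hnear : ∀ x, ∃ q, ‖F x - ι q‖ < δ := by
    intro x
    by_cases hx : d x = 0
    · exact ⟨u x, by rw [hFu x hx, hf]; simpa using hδ⟩
    · obtain ⟨y, -, -, hy⟩ := hclose x hx (fun _ => True) (ae_of_all _ fun _ => trivial)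
      exact ⟨u y, hy.trans_le hδ₁δ⟩
  have har : a * (a * r) ≤ 1 := by
    have : a * (a * r) ≤ a ^ 4 * r := by
      rw [← mul_assoc, ← sq]
      exact mul_le_mul_of_nonneg_right (pow_le_pow_right₀ (by linarith) (by norm_num)) hr0.le
    linarith
  -- The middle annulus has positive mass; any of its points `z` provides the constant value `ρ (F
  -- z)`.
  obtain ⟨z, hz⟩ : (embBall e x₀ (a * (a * r)) \ embBall e x₀ (a * r)).Nonempty := by
    refine nonempty_of_measure_ne_zero (μ := μ) (ne_of_gt (lt_of_lt_of_le ?_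
      (hm (a * r) (by positivity) har)))
    rw [ENNReal.ofReal_pos]
    positivity
  have hz1 : a * r ≤ ‖e z - e x₀‖ := not_lt.1 hz.2
  have hz2 : ‖e z - e x₀‖ ≤ a ^ 2 * r := by
    have := mem_embBall.1 hz.1
    nlinarith
  have hT : embBall e x₀ (a ^ 4 * r) ×ˢ embBall e x₀ (a ^ 4 * r) ⊆
      closePairs e (2 * a ^ 4 * r) := by
    intro w hw
    have e0 : ‖e w.1 - e w.2‖ ≤ ‖e w.1 - e x₀‖ + ‖e x₀ - e w.2‖ :=
      norm_sub_le_norm_sub_add_norm_sub ..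
    have e1 := mem_embBall.1 hw.1
    have e2 := mem_embBall'.1 hw.2
    change ‖e w.1 - e w.2‖ < _
    linarith
  refine ⟨r, hr0, by linarith, by linarith, fun x => ρ (F x), ρ (F z),
    hρ.measurable_comp hFm hnear, fun x hx => ?_, fun x hx1 hx2 => ?_, ?_, ?_, fun Q hQ => ?_⟩
  · beta_reduce
    rw [hFu x (annulusScale_eq_zero hx), hf]
    exact hρ.left_inv _
  · beta_reduce
    rw [hF, avg_annulus_congr hr0 ha f hx1 hx2 hz1 hz2]
  · calc _ ≤ ENNReal.ofReal (K ^ p) * energyOn μ n e p F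
          (embBall e x₀ (a ^ 4 * r) ×ˢ embBall e x₀ (a ^ 4 * r)) :=
          energyOn_le_of_norm_sub_le ((measurableSet_embBall he _ _).prod
            (measurableSet_embBall he _ _)) hK hp0.le
            fun w _ => hρ.lip _ _ (hnear w.1) (hnear w.2)
      _ ≤ ENNReal.ofReal (K ^ p) * energyOn μ n e p F
          (univ ×ˢ univ ∩ closePairs e (2 * a ^ 4 * r)) := by
          refine mul_le_mul_right (energyOn_mono_set ?_) _
          rw [univ_prod_univ, univ_inter]
          exact hT
      _ ≤ ENNReal.ofReal (K ^ p) * (ENNReal.ofReal C * energyOn μ n e p f (closePairs e δ')) :=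
          mul_le_mul_right (hCE univ _ _ h f b (r / 2) _ δ' hu hfb (fun x _ => hdr x)
            (by linarith) (by linarith)) _
      _ ≤ ENNReal.ofReal (K ^ p) * ENNReal.ofReal C * κ₁ := by
          rw [← mul_assoc]; exact mul_le_mul_right hs1 _
      _ ≤ κ := hκ₁'
  · refine (energyOn_mono_set (hT.trans fun w hw => ?_)).trans hs0
    refine lt_of_lt_of_le (show ‖e w.1 - e w.2‖ < 2 * a ^ 4 * r from hw) ?_
    rw [← hAr] at hrδ
    have : 0 < 2 * a ^ 4 * r := by positivity
    nlinarith
  · have hdz : d z ≠ 0 := by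
      have e1 : annulusCutoff e x₀ a r z ≠ 0 := by
        rw [annulusCutoff_eq_one hr0 ha hz1 hz2]; exact one_ne_zero
      rw [hd, annulusScale_eq_of_cutoff_ne_zero hr0 ha e1]
      positivity
    obtain ⟨y, hy, hzy, hFy⟩ := hclose z hdz Q hQ
    refine ⟨y, mem_embBall.2 ?_, hy, ?_⟩
    · have e0 : ‖e y - e x₀‖ ≤ ‖e y - e z‖ + ‖e z - e x₀‖ := norm_sub_le_norm_sub_add_norm_sub ..
      rw [norm_sub_rev (e y) (e z)] at e0
      have e1 : a ^ 2 * r ≤ a ^ 4 * r :=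
        mul_le_mul_of_nonneg_right (pow_le_pow_right₀ (by linarith) (by norm_num)) hr0.le
      linarith
    · have e1 := hρ.lip (F z) (f y) (hnear z) ⟨u y, by rw [hf]; simpa using hδ⟩
      rw [hf, hρ.left_inv] at e1
      refine e1.trans_lt (lt_of_le_of_lt (mul_le_mul_of_nonneg_left hFy.le hK) ?_)
      rw [hδ₁, mul_div_assoc', div_lt_iff₀ (by linarith)]
      nlinarith

end Blocks

/-! ### Truncation, moving constants, and gluing at a point -/

section Gluing

variable {X : Type*} [MeasurableSpace X]
  {E : Type*} [NormedAddCommGroup E] [MeasurableSpace E] [BorelSpace E]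
  [SecondCountableTopology E]
  {V : Type*} [NormedAddCommGroup V] [NormedSpace ℝ V] [CompleteSpace V] [MeasurableSpace V]
  [BorelSpace V] [SecondCountableTopology V]
  {μ : Measure X} [IsFiniteMeasure μ] {n : ℕ} {e : X → E} {c₀ C₀ p a r : ℝ} {x₀ : X}
  {N : Type*} {ι : N → V} {ρ : V → N} {δ K : ℝ}

open Classical in
/-- The map that equals `g` on the ball of radius `r` about `x₀` and `h` elsewhere. -/
noncomputable def patch (e : X → E) (x₀ : X) (r : ℝ) (g h : X → N) (x : X) : N :=
  if ‖e x - e x₀‖ < r then g x else h x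

theorem patch_of_lt {g h : X → N} {x : X} (hx : ‖e x - e x₀‖ < r) : patch e x₀ r g h x = g x :=
  if_pos hx

theorem patch_of_le {g h : X → N} {x : X} (hx : r ≤ ‖e x - e x₀‖) : patch e x₀ r g h x = h x :=
  if_neg (not_lt.2 hx)

theorem measurable_patch (he : Measurable e) {g h : X → N} (hg : Measurable fun x => ι (g x))
    (hh : Measurable fun x => ι (h x)) : Measurable fun x => ι (patch e x₀ r g h x) := by
  classical
  have : (fun x => ι (patch e x₀ r g h x)) =
      (embBall e x₀ r).piecewise (fun x => ι (g x)) (fun x => ι (h x)) := by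
    funext x
    by_cases hx : ‖e x - e x₀‖ < r
    · rw [patch_of_lt hx, piecewise_eq_of_mem _ _ _ (show x ∈ embBall e x₀ r from hx)]
    · rw [patch_of_le (not_lt.1 hx), piecewise_eq_of_notMem _ _ _ (show x ∉ embBall e x₀ r from hx)]
  rw [this]
  exact hg.piecewise (measurableSet_embBall he _ _) hh

theorem energyOn_const (hp : 0 < p) (c : V) (T : Set (X × X)) :
    energyOn μ n e p (fun _ => c) T = 0 := by
  simp [energyOn, hp]

theorem energyOn_add_const (f : X → V) (c : V) (T : Set (X × X)) :
    energyOn μ n e p (fun x => f x + c) T = energyOn μ n e p f T := by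
  refine lintegral_congr fun w => ?_
  rw [add_sub_add_right_eq_sub]

/-- `q` is close to values of `u`, on every set of full measure, near `x₀`. -/
def IsValueNear (μ : Measure X) (e : X → E) (ι : N → V) (δ : ℝ) (x₀ : X) (R : ℝ) (u : X → N)
    (q : N) : Prop :=
  ∀ Q : X → Prop, (∀ᵐ x ∂μ, Q x) → ∃ y ∈ embBall e x₀ R, Q y ∧ ‖ι q - ι (u y)‖ < δ

theorem IsValueNear.mono {R R' : ℝ} {u : X → N} {q : N} (h : IsValueNear μ e ι δ x₀ R u q)
    (hR : R ≤ R') : IsValueNear μ e ι δ x₀ R' u q := fun Q hQ =>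
  let ⟨y, hy, h'⟩ := h Q hQ
  ⟨y, embBall_mono hR hy, h'⟩

section

variable (hA : IsAhlfors n μ e c₀ C₀) (he : Measurable e)
    (hinj : Function.Injective e) (hn : 1 ≤ n) (hp : (n : ℝ) < p)
    (hρ : IsLipschitzRetraction ι ρ δ K) {b : ℝ} (hb : ∀ q, ‖ι q‖ ≤ b) (x₀ : X) {u : X → N}
    (hu : Measurable fun x => ι (u x)) (hE : energyOn μ n e p (fun x => ι (u x)) univ ≠ ⊤)
include hA he hinj hn hp

/-- The middle annulus, where `g` is the constant `q`, serves as the separating set, so cutting `g`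
there costs only a multiple of its energy near `x₀`. -/
theorem exists_energyOn_patch_const_le (ha : 3 ≤ a) (hm : ∀ r : ℝ, 0 < r → a * r ≤ 1 →
      ENNReal.ofReal (C₀ * r ^ n) ≤ μ (embBall e x₀ (a * r) \ embBall e x₀ r))
    {r : ℝ} (hr : 0 < r) (hr1 : a ^ 4 * r ≤ 1) {g : X → N} {q : N}
    (hg : Measurable fun x => ι (g x))
    (hq : ∀ x, a * r ≤ ‖e x - e x₀‖ → ‖e x - e x₀‖ ≤ a ^ 2 * r → g x = q) :
    energyOn μ n e p ((embBall e x₀ (a * r)).indicator fun x => ι (g x) - ι q) univ ≤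
      ENNReal.ofReal (1 + 2 * (2 ^ (n + 1) * (2 * a) ^ (2 * n))) *
        energyOn μ n e p (fun x => ι (g x))
          (embBall e x₀ (a ^ 4 * r) ×ˢ embBall e x₀ (a ^ 4 * r)) := by
  have hp0 : 0 < p := lt_of_le_of_lt (Nat.cast_nonneg n) hp
  have h24 : a ^ 2 * r ≤ a ^ 4 * r :=
    mul_le_mul_of_nonneg_right (pow_le_pow_right₀ (by linarith) (by norm_num)) hr.le
  have h2 : a * (a * r) = a ^ 2 * r := by ring
  refine (energyOn_indicator_embBall_le hA he hinj hn hp0 hg (by linarith : 2 ≤ a)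
    (by positivity : 0 < a * r) (fun x h1 h3 => ?_)
    (hm (a * r) (by positivity) (by linarith))).trans
    (mul_le_mul_right (energyOn_mono_set ?_) _)
  · rw [hq x h1 (by linarith)]
  · rw [h2]
    exact prod_mono (embBall_mono h24) (embBall_mono h24)

include hρ hb hu hE

/-- A map can be truncated to a constant away from `x₀` with small remaining energy. -/
theorem exists_truncation {κ : ℝ≥0∞} (hκ : κ ≠ 0) {R : ℝ} (hR : 0 < R) :
    ∃ r : ℝ, 0 < r ∧ ∃ (g : X → N) (q : N), Measurable (fun x => ι (g x)) ∧
      (∀ x ∈ embBall e x₀ r, g x = u x) ∧ (∀ x, x ∉ embBall e x₀ R → g x = q) ∧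
      energyOn μ n e p (fun x => ι (g x)) univ ≤ κ ∧ IsValueNear μ e ι δ x₀ R u q := by
  obtain ⟨a, ha, hm⟩ := exists_annulus_measure hA hn x₀
  obtain ⟨κ', hκ', hκκ⟩ := exists_ne_zero_mul_le
    (ENNReal.ofReal_ne_top (r := 1 + 2 * (2 ^ (n + 1) * (2 * a) ^ (2 * n)))) hκ
  obtain ⟨r, hr, hrR, hr1, g, q, hg, hgu, hgq, hgE, -, hval⟩ :=
    exists_annulus_block hA he hinj hn hp hρ hb x₀ hu hE ha hm hκ' hR
  have har : r ≤ a * r := le_mul_of_one_le_left hr.le (by linarith)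
  have haR : a * r ≤ a ^ 4 * r :=
    mul_le_mul_of_nonneg_right (le_self_pow₀ (by linarith) (by norm_num)) hr.le
  refine ⟨r, hr, patch e x₀ (a * r) g fun _ => q, q,
    measurable_patch he hg measurable_const, fun x hx => ?_, fun x hx => ?_, ?_, hval⟩
  · rw [patch_of_lt (lt_of_lt_of_le (mem_embBall.1 hx) har), hgu x (Or.inl (mem_embBall.1 hx).le)]
  · exact patch_of_le ((haR.trans hrR).trans (not_lt.1 hx))
  · have h1 : (fun x => ι (patch e x₀ (a * r) g (fun _ => q) x)) =
        fun x => (embBall e x₀ (a * r)).indicator (fun x => ι (g x) - ι q) x + ι q := by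
      funext x
      by_cases hx : x ∈ embBall e x₀ (a * r)
      · rw [patch_of_lt hx, indicator_of_mem hx, sub_add_cancel]
      · rw [patch_of_le (not_lt.1 hx), indicator_of_notMem hx, zero_add]
    rw [h1, energyOn_add_const]
    exact (exists_energyOn_patch_const_le hA he hinj hn hp x₀ ha hm hr hr1 hg hgq).trans
      ((mul_le_mul_right hgE _).trans hκκ)

/-- A map can be made constant near `x₀` by a small change. -/
theorem exists_const_near {κ : ℝ≥0∞} (hκ : κ ≠ 0) {R : ℝ} (hR : 0 < R) :
    ∃ r : ℝ, 0 < r ∧ r ≤ R ∧ ∃ (g : X → N) (q : N), Measurable (fun x => ι (g x)) ∧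
      (∀ x ∈ embBall e x₀ r, g x = q) ∧ (∀ x, x ∉ embBall e x₀ R → g x = u x) ∧
      energyOn μ n e p (fun x => ι (g x) - ι (u x)) univ ≤ κ ∧
      IsValueNear μ e ι δ x₀ R u q := by
  have hp1 : 1 ≤ p := le_trans (by exact_mod_cast hn) hp.le
  have hp0 : 0 < p := by linarith
  obtain ⟨a, ha, hm⟩ := exists_annulus_measure hA hn x₀
  set B : ℝ≥0∞ := ENNReal.ofReal (1 + 2 * (2 ^ (n + 1) * (2 * a) ^ (2 * n))) with hB
  have h2 : (2 : ℝ≥0∞) ^ (p - 1) ≠ ⊤ :=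
    ENNReal.rpow_ne_top_of_nonneg (by linarith) (by norm_num)
  obtain ⟨κ', hκ', hκκ⟩ := exists_ne_zero_mul_le
    (c := 2 ^ (p - 1) * (B * (2 ^ (p - 1) * 2) + B)) (ENNReal.mul_ne_top h2
      (ENNReal.add_ne_top.2 ⟨ENNReal.mul_ne_top ENNReal.ofReal_ne_top
        (ENNReal.mul_ne_top h2 (by norm_num)), ENNReal.ofReal_ne_top⟩)) hκ
  obtain ⟨r, hr, hrR, hr1, g, q, hg, hgu, hgq, hgE, huE, hval⟩ :=
    exists_annulus_block hA he hinj hn hp hρ hb x₀ hu hE ha hm hκ' hR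
  have ha1 : (1 : ℝ) ≤ a := by linarith
  have hpow : ∀ k : ℕ, k ≤ 4 → a ^ k * r ≤ a ^ 4 * r := fun k hk =>
    mul_le_mul_of_nonneg_right (pow_le_pow_right₀ ha1 hk) hr.le
  have hr4 := hpow 0 (by norm_num)
  have har4 := hpow 1 (by norm_num)
  have ha3r4 := hpow 3 (by norm_num)
  rw [pow_zero, one_mul] at hr4
  rw [pow_one] at har4
  have har0 : 0 < a * r := by positivity
  set D := (embBall e x₀ (a * r)).indicator fun x => ι (g x) - ι q with hD
  have hgm : Measurable fun x => ι (g x) - ι (u x) := hg.sub hu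
  have hDE : energyOn μ n e p D univ ≤ B * κ' :=
    (exists_energyOn_patch_const_le hA he hinj hn hp x₀ ha hm hr hr1 hg hgq).trans
      (mul_le_mul_right hgE _)
  have hgu' : ∀ x, a ^ 3 * r ≤ ‖e x - e x₀‖ → ι (g x) - ι (u x) = 0 := fun x hx => by
    rw [hgu x (Or.inr hx), sub_self]
  -- The difference vanishes beyond `a ^ 3 * r`, so it equals its own truncation with constant 0 on
  -- the annulus up to `a ^ 4 * r`; its global energy is thereby bounded by local ones.
  have hguE : energyOn μ n e p (fun x => ι (g x) - ι (u x)) univ ≤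
      B * (2 ^ (p - 1) * 2) * κ' := by
    have h1 : (fun x => ι (g x) - ι (u x)) =
        (embBall e x₀ (a ^ 3 * r)).indicator fun x => (ι (g x) - ι (u x)) - 0 := by
      funext x
      by_cases hx : x ∈ embBall e x₀ (a ^ 3 * r)
      · rw [indicator_of_mem hx, sub_zero]
      · rw [indicator_of_notMem hx, hgu' x (not_lt.1 hx)]
    have h4 : a * (a ^ 3 * r) = a ^ 4 * r := by ring
    have h5 := energyOn_indicator_embBall_le (q := 0) hA he hinj hn hp0 hgm (by linarith : 2 ≤ a)
      (by positivity : 0 < a ^ 3 * r) (fun x hx _ => hgu' x hx)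
      (hm (a ^ 3 * r) (by positivity) (by linarith))
    rw [← h1, h4] at h5
    refine h5.trans ?_
    rw [mul_assoc]
    refine mul_le_mul_right ((energyOn_sub_le he hp1 hg _).trans ?_) _
    rw [mul_assoc, two_mul κ']
    exact mul_le_mul_right (add_le_add hgE huE) _
  refine ⟨a * r, by positivity, har4.trans hrR, patch e x₀ (a * r) (fun _ => q) g, q,
    measurable_patch he measurable_const hg, fun x hx => patch_of_lt hx, fun x hx => ?_, ?_, hval⟩
  · have hx' : a ^ 4 * r ≤ ‖e x - e x₀‖ := hrR.trans (not_lt.1 hx)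
    rw [patch_of_le (har4.trans hx'), hgu x (Or.inr (ha3r4.trans hx'))]
  · have h1 : (fun x => ι (patch e x₀ (a * r) (fun _ => q) g x) - ι (u x)) =
        fun x => (ι (g x) - ι (u x)) - D x := by
      funext x
      by_cases hx : x ∈ embBall e x₀ (a * r)
      · rw [patch_of_lt hx, hD, indicator_of_mem hx]; abel
      · rw [patch_of_le (not_lt.1 hx), hD, indicator_of_notMem hx, sub_zero]
    rw [h1]
    refine (energyOn_sub_le he hp1 hgm _).trans ((mul_le_mul_right
      (add_le_add hguE hDE) _).trans (le_trans (le_of_eq ?_) hκκ))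
    rw [← add_mul, mul_assoc]

end

section

variable (hA : IsAhlfors n μ e c₀ C₀) (he : Measurable e)
    (hn : 1 ≤ n) (hp : (n : ℝ) < p)
    (hρ : IsLipschitzRetraction ι ρ δ K)
include hA he hn hp hρ

/-- A constant value near `x₀` can be moved to a close value by a small change. -/
theorem exists_move_value (x₀ : X) {κ : ℝ≥0∞} (hκ : κ ≠ 0) {σ₀ : ℝ} (hσ₀ : 0 < σ₀) :
    ∃ σ : ℝ, 0 < σ ∧ σ ≤ σ₀ ∧ ∀ (w : X → N) (q q' : N), Measurable (fun x => ι (w x)) →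
      (∀ x ∈ embBall e x₀ σ₀, w x = q) → ‖ι q - ι q'‖ < δ →
      ∃ w' : X → N, Measurable (fun x => ι (w' x)) ∧ (∀ x ∈ embBall e x₀ σ, w' x = q') ∧
        (∀ x, x ∉ embBall e x₀ σ₀ → w' x = w x) ∧
        energyOn μ n e p (fun x => ι (w' x) - ι (w x)) univ ≤ κ := by
  have hp0 : 0 < p := lt_of_le_of_lt (Nat.cast_nonneg n) hp
  have hK := hρ.nonneg
  have hδ := hρ.pos
  obtain ⟨κ', hκ', hκκ⟩ := exists_ne_zero_mul_le
    (ENNReal.ofReal_ne_top (r := (K * δ) ^ p)) hκ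
  -- The cutoff, and with it `σ`, is fixed before the map and its two values; the gluing relies on
  -- this uniformity.
  obtain ⟨σ, hσ, hσσ, η, hηm, hη0, hη1, hησ, hησ₀, hηE⟩ := exists_cutoff hA he hn hp x₀ hκ' hσ₀
  refine ⟨σ, hσ, hσσ, fun w q q' hw hwq hqq => ?_⟩
  -- The linear interpolation stays within `δ` of `ι q`, so it can be retracted, and its differences
  -- are at most `δ` times those of `η`.
  set F : X → V := fun x => ι q + η x • (ι q' - ι q) with hF
  have hFm : Measurable F := measurable_const.add (hηm.smul_const _)
  have hqq' : ‖ι q' - ι q‖ < δ := by rwa [norm_sub_rev]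
  have hnear : ∀ x, ∃ q, ‖F x - ι q‖ < δ := fun x => ⟨q, by
    simp only [hF]
    rw [add_sub_cancel_left, norm_smul, Real.norm_of_nonneg (hη0 x)]
    exact lt_of_le_of_lt (mul_le_of_le_one_left (norm_nonneg _) (hη1 x)) hqq'⟩
  have hFout : ∀ x, x ∉ embBall e x₀ σ₀ → F x = ι q := fun x hx => by
    simp only [hF]; rw [hησ₀ x hx, zero_smul, add_zero]
  refine ⟨patch e x₀ σ₀ (fun x => ρ (F x)) w,
    measurable_patch he (hρ.measurable_comp hFm hnear) hw, fun x hx => ?_,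
    fun x hx => patch_of_le (not_lt.1 hx), ?_⟩
  · rw [patch_of_lt (lt_of_lt_of_le (mem_embBall.1 hx) hσσ)]
    simp only [hF]
    rw [hησ x hx, one_smul, add_sub_cancel, hρ.left_inv]
  · have h1 : (fun x => ι (patch e x₀ σ₀ (fun x => ρ (F x)) w x) - ι (w x)) =
        fun x => ι (ρ (F x)) + -ι q := by
      funext x
      by_cases hx : x ∈ embBall e x₀ σ₀
      · rw [patch_of_lt hx, hwq x hx, sub_eq_add_neg]
      · rw [patch_of_le (not_lt.1 hx), hFout x hx, hρ.left_inv, sub_self, add_neg_cancel]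
    rw [h1, energyOn_add_const]
    refine le_trans (energyOn_le_of_norm_sub_le (g := η) MeasurableSet.univ
      (by positivity : 0 ≤ K * δ) hp0.le fun z _ => ?_) ((mul_le_mul_right hηE _).trans hκκ)
    refine (hρ.lip _ _ (hnear z.1) (hnear z.2)).trans ?_
    simp only [hF]
    rw [add_sub_add_left_eq_sub, ← sub_smul, norm_smul, mul_assoc, mul_comm δ]
    gcongr

/-- A constant value near `x₀` can be moved along a chain by a small change. -/
theorem exists_move_value_chain (x₀ : X) {q q' : N}
    (hqq : Relation.ReflTransGen (fun q q' : N => ‖ι q - ι q'‖ < δ) q q') {w : X → N}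
    (hw : Measurable fun x => ι (w x)) {σ₀ : ℝ} (hσ₀ : 0 < σ₀)
    (hwq : ∀ x ∈ embBall e x₀ σ₀, w x = q) :
    ∀ κ : ℝ≥0∞, κ ≠ 0 → ∃ σ : ℝ, 0 < σ ∧ σ ≤ σ₀ ∧ ∃ w' : X → N, Measurable (fun x => ι (w' x)) ∧
      (∀ x ∈ embBall e x₀ σ, w' x = q') ∧ (∀ x, x ∉ embBall e x₀ σ₀ → w' x = w x) ∧
        energyOn μ n e p (fun x => ι (w' x) - ι (w x)) univ ≤ κ := by
  have hp1 : 1 ≤ p := le_trans (by exact_mod_cast hn) hp.le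
  have hp0 : 0 < p := by linarith
  induction hqq with
  | refl =>
    intro κ _
    refine ⟨σ₀, hσ₀, le_rfl, w, hw, hwq, fun _ _ => rfl, ?_⟩
    simp only [sub_self]
    rw [energyOn_const hp0]
    exact zero_le
  | @tail q₁ q₂ _ h12 ih =>
    intro κ hκ
    have h2 : (2 : ℝ≥0∞) ^ (p - 1) ≠ ⊤ :=
      ENNReal.rpow_ne_top_of_nonneg (by linarith) (by norm_num)
    obtain ⟨κ', hκ', hκκ⟩ := exists_ne_zero_mul_le
      (ENNReal.mul_ne_top h2 (ENNReal.ofNat_ne_top (n := 2))) hκ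
    obtain ⟨σ₁, hσ₁, hσσ₁, w₁, hw₁, hwq₁, hww₁, hE₁⟩ := ih κ' hκ'
    obtain ⟨σ₂, hσ₂, hσσ₂, hmove⟩ := exists_move_value hA he hn hp hρ x₀ hκ' hσ₁
    obtain ⟨w₂, hw₂, hwq₂, hww₂, hE₂⟩ := hmove w₁ q₁ q₂ hw₁ hwq₁ h12
    refine ⟨σ₂, hσ₂, hσσ₂.trans hσσ₁, w₂, hw₂, hwq₂, fun x hx => ?_, ?_⟩
    · rw [hww₂ x fun hx' => hx (embBall_mono hσσ₁ hx'), hww₁ x hx]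
    · have h1 : (fun x => ι (w₂ x) - ι (w x)) =
          fun x => (ι (w₂ x) - ι (w₁ x)) + (ι (w₁ x) - ι (w x)) := by
        funext x; abel
      rw [h1]
      refine (energyOn_add_le he hp1 (hw₂.sub hw₁) _).trans
        ((mul_le_mul_right (add_le_add hE₂ hE₁) _).trans (le_trans (le_of_eq ?_) hκκ))
      rw [mul_assoc, two_mul]

end

/-- Two maps whose values near `x₀` are connected by chains can be glued at `x₀`, at a small cost
of energy. -/
theorem exists_glue [TopologicalSpace N] [CompactSpace N] (hι : Continuous ι)
    (hA : IsAhlfors n μ e c₀ C₀) (he : Measurable e)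
    (hinj : Function.Injective e) (hn : 1 ≤ n) (hp : (n : ℝ) < p)
    (hρ : IsLipschitzRetraction ι ρ δ K) {b : ℝ} (hb : ∀ q, ‖ι q‖ ≤ b) (x₀ : X) {u v : X → N}
    (hu : Measurable fun x => ι (u x)) (huE : energyOn μ n e p (fun x => ι (u x)) univ ≠ ⊤)
    (hv : Measurable fun x => ι (v x)) (hvE : energyOn μ n e p (fun x => ι (v x)) univ ≠ ⊤)
    {R₀ : ℝ} (hR₀ : 0 < R₀) (hchain : ∀ q q', IsValueNear μ e ι δ x₀ R₀ u q →
      IsValueNear μ e ι δ x₀ R₀ v q' →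
      Relation.ReflTransGen (fun q q' : N => ‖ι q - ι q'‖ < δ) q' q)
    {κ : ℝ≥0∞} (hκ : κ ≠ 0) {R : ℝ} (hR : 0 < R) :
    ∃ (w : X → N) (r : ℝ), 0 < r ∧ Measurable (fun x => ι (w x)) ∧
      (∀ x ∈ embBall e x₀ r, w x = u x) ∧ (∀ x, x ∉ embBall e x₀ R → w x = v x) ∧
      energyOn μ n e p (fun x => ι (w x) - ι (v x)) univ ≤ κ := by
  have hp1 : 1 ≤ p := le_trans (by exact_mod_cast hn) hp.le
  have hp0 : 0 < p := by linarith
  have hδ := hρ.pos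
  set t : ℝ≥0∞ := 2 ^ (p - 1) with ht
  have h2 : t ≠ ⊤ := ENNReal.rpow_ne_top_of_nonneg (by linarith) (by norm_num)
  obtain ⟨κ', hκ', hκκ⟩ := exists_ne_zero_mul_le (c := t * (t * 2 + t * 2))
    (ENNReal.mul_ne_top h2 (ENNReal.add_ne_top.2 ⟨ENNReal.mul_ne_top h2 (by norm_num),
      ENNReal.mul_ne_top h2 (by norm_num)⟩)) hκ
  set R' := min R R₀ with hR'
  have hR'0 : 0 < R' := lt_min hR hR₀
  obtain ⟨σ₁, hσ₁, hσR, v₁, qv, hv₁, hvq, hvv, hvE₁, hqv⟩ :=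
    exists_const_near hA he hinj hn hp hρ hb x₀ hv hvE hκ' hR'0
  -- The truncation of `u` must fit inside the ball where `v` has been made constant, but the size
  -- of that ball depends on a chain ending at the truncation value. Truncating at all scales and
  -- passing to a cluster value `q` breaks the circle.
  have htr : ∀ k : ℕ, ∃ r : ℝ, 0 < r ∧ ∃ (g : X → N) (q : N), Measurable (fun x => ι (g x)) ∧
      (∀ x ∈ embBall e x₀ r, g x = u x) ∧ (∀ x, x ∉ embBall e x₀ (R' / (k + 1)) → g x = q) ∧
      energyOn μ n e p (fun x => ι (g x)) univ ≤ κ' ∧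
      IsValueNear μ e ι δ x₀ (R' / (k + 1)) u q := fun k =>
    exists_truncation hA he hinj hn hp hρ hb x₀ hu huE hκ' (by positivity)
  choose rk hrk gk qk hgk hgku hgkq hgkE hqk using htr
  obtain ⟨q, -, hq⟩ := isCompact_univ.exists_mapClusterPt (f := atTop) (u := qk)
    (by simp)
  have hfreq : ∃ᶠ k in atTop, ‖ι (qk k) - ι q‖ < δ := by
    have hmem : {q' | ‖ι q' - ι q‖ < δ} ∈ 𝓝 q :=
      (isOpen_lt (hι.sub continuous_const).norm continuous_const).mem_nhds (by simpa using hδ)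
    exact hq.frequently (p := fun q' => ‖ι q' - ι q‖ < δ) hmem
  obtain ⟨k₀, hk₀⟩ := hfreq.exists
  have hle : ∀ k : ℕ, R' / ((k : ℝ) + 1) ≤ R' := fun k =>
    div_le_self hR'0.le (by have : (0 : ℝ) ≤ k := k.cast_nonneg; linarith)
  have hch : Relation.ReflTransGen (fun q q' : N => ‖ι q - ι q'‖ < δ) qv q :=
    (hchain (qk k₀) qv ((hqk k₀).mono ((hle k₀).trans (min_le_right _ _)))
      (hqv.mono (min_le_right _ _))).tail hk₀
  obtain ⟨σ₂, hσ₂, hσσ₂, v₂, hv₂, hvq₂, hvv₂, hvE₂⟩ :=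
    exists_move_value_chain hA he hn hp hρ x₀ hch hv₁ hσ₁ hvq κ' hκ'
  -- The radius `σ₃` serves for every last step from `q` to a `δ`-close value; only now is `k`
  -- chosen, with `qk k` close to `q` and the truncation supported inside this ball.
  obtain ⟨σ₃, hσ₃, hσσ₃, hmove⟩ := exists_move_value hA he hn hp hρ x₀ hκ' hσ₂
  have hlim : Tendsto (fun k : ℕ => R' / ((k : ℝ) + 1)) atTop (𝓝 0) :=
    tendsto_const_nhds.div_atTop (tendsto_atTop_add_const_right _ _ tendsto_natCast_atTop_atTop)
  obtain ⟨k, hkq, hkσ⟩ := (hfreq.and_eventually (hlim.eventually (gt_mem_nhds hσ₃))).exists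
  obtain ⟨v₃, hv₃, hvq₃, hvv₃, hvE₃⟩ := hmove v₂ q (qk k) hv₂ hvq₂ (by rwa [norm_sub_rev])
  set w := patch e x₀ σ₃ (gk k) v₃ with hw
  have hwm : Measurable fun x => ι (w x) := measurable_patch he (hgk k) hv₃
  -- Inside, `v₃` is the constant `qk k`; outside, `gk k` is. The patched map thus differs from `v₃`
  -- by `gk k` minus a constant everywhere, and no interaction energy arises.
  have hw3 : (fun x => ι (w x) - ι (v₃ x)) = fun x => ι (gk k x) + -ι (qk k) := by
    funext x
    by_cases hx : x ∈ embBall e x₀ σ₃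
    · rw [hw, patch_of_lt hx, hvq₃ x hx, sub_eq_add_neg]
    · rw [hw, patch_of_le (not_lt.1 hx), hgkq k x fun hx' => hx (embBall_mono hkσ.le hx'),
        sub_self, add_neg_cancel]
  have hwE : energyOn μ n e p (fun x => ι (w x) - ι (v₃ x)) univ ≤ κ' := by
    rw [hw3, energyOn_add_const]; exact hgkE k
  refine ⟨w, min (rk k) σ₃, lt_min (hrk k) hσ₃, hwm, fun x hx => ?_, fun x hx => ?_, ?_⟩
  · rw [hw, patch_of_lt (lt_of_lt_of_le (mem_embBall.1 hx) (min_le_right _ _)),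
      hgku k x (embBall_mono (min_le_left _ _) hx)]
  · have hx1 : x ∉ embBall e x₀ R' := fun hx' => hx (embBall_mono (min_le_left _ _) hx')
    have hx2 : x ∉ embBall e x₀ σ₁ := fun hx' => hx1 (embBall_mono hσR hx')
    have hx3 : x ∉ embBall e x₀ σ₂ := fun hx' => hx2 (embBall_mono hσσ₂ hx')
    have hx4 : x ∉ embBall e x₀ σ₃ := fun hx' => hx3 (embBall_mono hσσ₃ hx')
    rw [hw, patch_of_le (not_lt.1 hx4), hvv₃ x hx3, hvv₂ x hx2, hvv x hx1]
  · have h1 : (fun x => ι (w x) - ι (v x)) = fun x =>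
        ((ι (w x) - ι (v₃ x)) + (ι (v₃ x) - ι (v₂ x))) +
        ((ι (v₂ x) - ι (v₁ x)) + (ι (v₁ x) - ι (v x))) := by
      funext x; abel
    rw [h1]
    refine (energyOn_add_le he hp1 ((hwm.sub hv₃).add (hv₃.sub hv₂)) _).trans
      (le_trans (mul_le_mul_right (add_le_add
        ((energyOn_add_le he hp1 (hwm.sub hv₃) _).trans
          (mul_le_mul_right (add_le_add hwE hvE₃) _))
        ((energyOn_add_le he hp1 (hv₂.sub hv₁) _).trans
          (mul_le_mul_right (add_le_add hvE₂ hvE₁) _))) _) (le_trans (le_of_eq ?_) hκκ))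
    rw [← ht, mul_assoc, add_mul, mul_assoc, two_mul κ']

end Gluing

/-! ### Mollification in the ambient space -/

section Mollify

variable {X : Type*} [MeasurableSpace X]
  {E : Type*} [NormedAddCommGroup E] [NormedSpace ℝ E] [FiniteDimensional ℝ E]
  [HasContDiffBump E] [MeasurableSpace E] [BorelSpace E] [SecondCountableTopology E]
  {V : Type*} [NormedAddCommGroup V] [NormedSpace ℝ V] [CompleteSpace V] [MeasurableSpace V]
  [BorelSpace V] [SecondCountableTopology V]
  {μ : Measure X} [IsFiniteMeasure μ] {n : ℕ} {e : X → E} {c₀ C₀ p ε Λ l : ℝ} {k : X → X → ℝ}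
  {N : Type*} {ι : N → V} {ρ : V → N} {δ K : ℝ}

variable (E) in
/-- A fixed smooth bump function at the origin. -/
noncomputable def unitBump : ContDiffBump (0 : E) := ⟨1 / 2, 1, by norm_num, by norm_num⟩

/-- The rescaled bump function. -/
noncomputable def mollifier (E : Type*) [NormedAddCommGroup E] [NormedSpace ℝ E]
    [HasContDiffBump E] (ε : ℝ) (z : E) : ℝ := ε * unitBump E (ε⁻¹ • z)

theorem contDiff_mollifier (ε : ℝ) : ContDiff ℝ ∞ (mollifier E ε) :=
  contDiff_const.mul ((unitBump E).contDiff.comp (contDiff_const_smul _))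

theorem mollifier_nonneg (hε : 0 < ε) (z : E) : 0 ≤ mollifier E ε z :=
  mul_nonneg hε.le (unitBump E).nonneg

theorem mollifier_le (hε : 0 < ε) (z : E) : mollifier E ε z ≤ ε :=
  mul_le_of_le_one_right hε.le (unitBump E).le_one

theorem mollifier_eq_zero (hε : 0 < ε) {z : E} (hz : ε ≤ ‖z‖) : mollifier E ε z = 0 := by
  rw [mollifier, (unitBump E).zero_of_le_dist, mul_zero]
  rw [dist_zero_right, norm_smul, norm_inv, Real.norm_of_nonneg hε.le]
  change 1 ≤ _
  rw [← div_eq_inv_mul]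
  exact (one_le_div₀ hε).2 hz

theorem mollifier_eq (hε : 0 < ε) {z : E} (hz : ‖z‖ ≤ ε / 2) : mollifier E ε z = ε := by
  rw [mollifier, (unitBump E).one_of_mem_closedBall, mul_one]
  rw [Metric.mem_closedBall, dist_zero_right, norm_smul, norm_inv, Real.norm_of_nonneg hε.le]
  change _ ≤ (1 / 2 : ℝ)
  rw [← div_eq_inv_mul, div_le_iff₀ hε]
  linarith

theorem hasCompactSupport_mollifier (hε : 0 < ε) : HasCompactSupport (mollifier E ε) := by
  refine HasCompactSupport.of_support_subset_isCompact (isCompact_closedBall (0 : E) ε) ?_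
  intro z hz
  rw [Metric.mem_closedBall, dist_zero_right]
  by_contra hcon
  exact hz (mollifier_eq_zero hε (not_le.1 hcon).le)

/-- The factor `ε` in front of the bump cancels the `1 / ε` from the rescaling, giving the
scale-free Lipschitz constant required of averaging densities. -/
theorem exists_abs_mollifier_sub_le : ∃ C : ℝ, 0 ≤ C ∧ ∀ ε : ℝ, 0 < ε → ∀ z z' : E,
    |mollifier E ε z - mollifier E ε z'| ≤ C * ‖z - z'‖ := by
  obtain ⟨C, hC⟩ := ContDiff.lipschitzWith_of_hasCompactSupport (𝕂 := ℝ) (n := 1)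
    (unitBump E).hasCompactSupport (unitBump E).contDiff one_ne_zero
  refine ⟨C, C.2, fun ε hε z z' => ?_⟩
  have h := hC.dist_le_mul (ε⁻¹ • z) (ε⁻¹ • z')
  rw [dist_eq_norm, dist_eq_norm, Real.norm_eq_abs, ← smul_sub, norm_smul, norm_inv,
    Real.norm_of_nonneg hε.le] at h
  rw [mollifier, mollifier, ← mul_sub, abs_mul, abs_of_pos hε]
  calc _ ≤ ε * (C * (ε⁻¹ * ‖z - z'‖)) := mul_le_mul_of_nonneg_left h hε.le
    _ = _ := by field_simp

/-- The averaging density given by a mollifier. -/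
noncomputable def mollifierDensity (e : X → E) (ε : ℝ) (x y : X) : ℝ := mollifier E ε (e x - e y)

theorem exists_isAveraging_mollifier (hA : IsAhlfors n μ e c₀ C₀) (he : Measurable e) :
    ∃ Λ l : ℝ, 1 ≤ Λ ∧ 0 < l ∧ ∀ ε, 0 < ε → ε ≤ 1 →
      IsAveraging μ n e univ (fun _ => ε) (mollifierDensity e ε) Λ l := by
  have hC := hA.C_pos
  have hc := hA.c_pos
  obtain ⟨C, hC0, hCφ⟩ := exists_abs_mollifier_sub_le (E := E)
  refine ⟨1 + C + C₀, c₀ / 2 ^ n, by linarith, by positivity, fun ε hε hε1 => ?_⟩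
  have hkm : Measurable (Function.uncurry (mollifierDensity e ε)) :=
    (contDiff_mollifier ε).continuous.measurable.comp
      ((he.comp measurable_fst).sub (he.comp measurable_snd))
  have hsupp : ∀ x y, mollifierDensity e ε x y ≠ 0 → ‖e x - e y‖ < ε := fun x y h => by
    by_contra hcon
    exact h (mollifier_eq_zero hε (not_lt.1 hcon))
  exact
  { measurableSet := MeasurableSet.univ
    d_meas := measurable_const
    k_meas := hkm
    one_le := by linarith
    l_pos := by positivity
    d_nonneg := fun _ => hε.le
    d_lip := fun x _ x' _ => by linarith [norm_nonneg (e x - e x')]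
    k_nonneg := fun x y => mollifier_nonneg hε _
    k_le := fun x _ y => (mollifier_le hε _).trans (le_mul_of_one_le_left hε.le (by linarith))
    k_supp := fun x _ y h => (hsupp x y h).trans_le
      (le_mul_of_one_le_left hε.le (by linarith))
    k_lip := fun x _ x' _ y => by
      refine (hCφ ε hε _ _).trans ?_
      rw [sub_sub_sub_cancel_right]
      exact mul_le_mul_of_nonneg_right (by linarith) (norm_nonneg _)
    mass := fun x _ _ => by
      have hB : MeasurableSet (embBall e x (ε / 2)) := measurableSet_embBall he _ _
      have hm : Measurable (mollifierDensity e ε x) := hkm.comp (measurable_prodMk_left (x := x))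
      have hint : Integrable (mollifierDensity e ε x) μ :=
        Integrable.of_bound hm.aestronglyMeasurable ε (ae_of_all _ fun y => by
          rw [Real.norm_of_nonneg (show 0 ≤ mollifierDensity e ε x y from mollifier_nonneg hε _)]
          exact mollifier_le hε _)
      calc c₀ / 2 ^ n * ε ^ (n + 1) = c₀ * (ε / 2) ^ n * ε := by
            rw [div_pow, pow_succ]; field_simp
        _ ≤ μ.real (embBall e x (ε / 2)) * ε :=
            mul_le_mul_of_nonneg_right (hA.le_measureReal_embBall x (half_pos hε) (by linarith))
              hε.le
        _ = ∫ y, (embBall e x (ε / 2)).indicator (fun _ => ε) y ∂μ := by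
            rw [integral_indicator hB, setIntegral_const, smul_eq_mul]
        _ ≤ _ := by
            refine integral_mono ((integrable_const _).indicator hB) hint fun y => ?_
            by_cases hy : y ∈ embBall e x (ε / 2)
            · rw [indicator_of_mem hy]
              exact (mollifier_eq hε (mem_embBall'.1 hy).le).ge
            · rw [indicator_of_notMem hy]; exact mollifier_nonneg hε _
    col := fun y => by
      rw [Measure.restrict_univ]
      have hpt : ∀ x, ENNReal.ofReal (mollifierDensity e ε x y / ε ^ (n + 1)) ≤
          (embBall e y ε).indicator (fun _ => ENNReal.ofReal (1 / ε ^ n)) x := by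
        intro x
        by_cases hx : x ∈ embBall e y ε
        · rw [indicator_of_mem hx]
          refine ENNReal.ofReal_le_ofReal ?_
          calc _ ≤ ε / ε ^ (n + 1) :=
                div_le_div_of_nonneg_right (mollifier_le hε _) (by positivity)
            _ = _ := by rw [pow_succ]; field_simp
        · have : mollifierDensity e ε x y = 0 := by
            by_contra hcon
            exact hx (hsupp x y hcon)
          rw [this, zero_div, ENNReal.ofReal_zero]
          exact zero_le
      refine (lintegral_mono hpt).trans ?_
      rw [lintegral_indicator (measurableSet_embBall he _ _), setLIntegral_const]
      refine (mul_le_mul_right (hA.measure_embBall_le y hε) _).trans ?_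
      rw [← ENNReal.ofReal_mul (by positivity)]
      refine ENNReal.ofReal_le_ofReal ?_
      have : 1 / ε ^ n * (C₀ * ε ^ n) = C₀ := by field_simp
      linarith }

-- Pushing the measure forward by `e` and extending `f` by zero makes the integral a convolution on
-- the ambient vector space with a smooth compactly supported function. It is therefore smooth in
-- the ambient variable, whatever the regularity of `f`.
open scoped Convolution in
theorem exists_contDiff_integral_mollifier (he : MeasurableEmbedding e) (hε : 0 < ε)
    {W : Type*} [NormedAddCommGroup W] [NormedSpace ℝ W] [CompleteSpace W]
    {f : X → W} (hf : Integrable f μ) :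
    ∃ Ψ : E → W, ContDiff ℝ ∞ Ψ ∧ ∀ x, ∫ y, mollifierDensity e ε x y • f y ∂μ = Ψ (e x) := by
  have hinj := he.injective
  set L : W →L[ℝ] ℝ →L[ℝ] W := (ContinuousLinearMap.lsmul ℝ ℝ).flip with hL
  have hint : Integrable (Function.extend e f 0) (μ.map e) := by
    have : Function.extend e f 0 ∘ e = f := funext fun x => hinj.extend_apply _ _ _
    rwa [he.integrable_map_iff, this]
  refine ⟨(Function.extend e f 0) ⋆[L, μ.map e] (mollifier E ε),
    (hasCompactSupport_mollifier hε).contDiff_convolution_right (n := ⊤) L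
      hint.locallyIntegrable (contDiff_mollifier ε), fun x => ?_⟩
  rw [convolution_def, he.integral_map]
  refine integral_congr_ae (ae_of_all _ fun y => ?_)
  beta_reduce
  rw [hinj.extend_apply]
  rfl

theorem exists_contDiff_avg_mollifier (he : MeasurableEmbedding e) (hε : 0 < ε)
    (h : IsAveraging μ n e univ (fun _ => ε) (mollifierDensity e ε) Λ l)
    {f : X → V} (hf : Integrable f μ) :
    ∃ (Ψ : E → V) (Z : E → ℝ), ContDiff ℝ ∞ Ψ ∧ ContDiff ℝ ∞ Z ∧ (∀ x, Z (e x) ≠ 0) ∧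
      ∀ x, avg μ (fun _ => ε) (mollifierDensity e ε) f x = (Z (e x))⁻¹ • Ψ (e x) := by
  obtain ⟨Ψ, hΨ, hΨ'⟩ := exists_contDiff_integral_mollifier (μ := μ) he hε hf
  obtain ⟨Z, hZ, hZ'⟩ := exists_contDiff_integral_mollifier (μ := μ) he hε
    (integrable_const (1 : ℝ))
  simp only [smul_eq_mul, mul_one] at hZ'
  refine ⟨Ψ, Z, hΨ, hZ, fun x => ?_, fun x => ?_⟩
  · rw [← hZ']
    exact (h.mass_pos (mem_univ x) hε.ne').ne'
  · rw [avg, if_neg hε.ne', ← hZ', ← hΨ', ← integral_smul]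
    refine integral_congr_ae (ae_of_all _ fun y => ?_)
    beta_reduce
    rw [normDensity, smul_smul, div_eq_inv_mul]

theorem lintegral_enorm_avg_sub_rpow_le (he : Measurable e) (hinj : Function.Injective e)
    (h : IsAveraging μ n e univ (fun _ => ε) k Λ l) (hε : 0 < ε) (hε1 : ε ≤ 1) (hp : 1 ≤ p)
    {f : X → V} (hf : Measurable f) {b : ℝ} (hb : ∀ x, ‖f x‖ ≤ b) :
    ∫⁻ x, ‖avg μ (fun _ => ε) k f x - f x‖ₑ ^ p ∂μ ≤
      ENNReal.ofReal (Λ / l * Λ ^ (2 * n)) * energyOn μ n e p f (closePairs e (Λ * ε)) := by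
  have hp0 : 0 < p := by linarith
  have hΛ := h.one_le
  have hl := h.l_pos
  set G : X × X → ℝ≥0∞ := fun w => ‖f w.1 - f w.2‖ₑ ^ p * gagliardoWeight n e w.1 w.2 with hG
  have hGm : Measurable G := measurable_energyDensity he hf n p
  have hx : ∀ x, ‖avg μ (fun _ => ε) k f x - f x‖ₑ ^ p ≤
      ENNReal.ofReal (Λ / l * Λ ^ (2 * n)) * ∫⁻ y in embBall e x (Λ * ε), G (x, y) ∂μ := by
    intro x
    calc _ ≤ ∫⁻ y, ‖f y - f x‖ₑ ^ p ∂(avgKernel μ h.d_meas k x) :=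
          h.enorm_avg_sub_rpow_le hf hb (mem_univ x) hp _
      _ ≤ ENNReal.ofReal (Λ / (l * ε ^ n)) * ∫⁻ y in embBall e x (Λ * ε), ‖f y - f x‖ₑ ^ p ∂μ :=
          h.lintegral_avgKernel_le he (mem_univ x) hε.ne' ((hf.sub_const _).enorm.pow_const _)
      _ ≤ ENNReal.ofReal (Λ / (l * ε ^ n)) * ∫⁻ y in embBall e x (Λ * ε),
            ENNReal.ofReal ((Λ * ε) ^ (2 * n)) * G (x, y) ∂μ := by
          refine mul_le_mul_right (setLIntegral_mono' (measurableSet_embBall he _ _)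
            fun y hy => ?_) _
          rw [enorm_sub_rev]
          exact enorm_sub_rpow_le_mul_gagliardoWeight hinj hp0 f (mem_embBall'.1 hy).le
      _ = ENNReal.ofReal (Λ / (l * ε ^ n) * (Λ * ε) ^ (2 * n)) *
            ∫⁻ y in embBall e x (Λ * ε), G (x, y) ∂μ := by
          rw [lintegral_const_mul' _ _ ENNReal.ofReal_ne_top, ← mul_assoc,
            ← ENNReal.ofReal_mul (by positivity)]
      -- A factor `ε ^ n` is left over and is bounded by 1; smallness will come from the energy of
      -- close pairs.
      _ ≤ _ := by
          refine mul_le_mul_left (ENNReal.ofReal_le_ofReal ?_) _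
          have e1 : Λ / (l * ε ^ n) * (Λ * ε) ^ (2 * n) = Λ / l * Λ ^ (2 * n) * ε ^ n := by
            rw [mul_pow, two_mul, pow_add ε]; field_simp
          rw [e1]
          exact mul_le_of_le_one_right (by positivity) (pow_le_one₀ hε.le hε1)
  refine (lintegral_mono hx).trans (le_of_eq ?_)
  rw [lintegral_const_mul' _ _ ENNReal.ofReal_ne_top, energyOn,
    ← lintegral_indicator (measurableSet_closePairs he _), lintegral_prod _
      (hGm.indicator (measurableSet_closePairs he _)).aemeasurable]
  congr 1
  refine lintegral_congr fun x => ?_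
  rw [← lintegral_indicator (measurableSet_embBall he _ _)]
  refine lintegral_congr fun y => ?_
  by_cases hy : y ∈ embBall e x (Λ * ε)
  · rw [indicator_of_mem hy,
      indicator_of_mem (show (x, y) ∈ closePairs e (Λ * ε) from mem_embBall'.1 hy)]
  · rw [indicator_of_notMem hy,
      indicator_of_notMem (show (x, y) ∉ closePairs e (Λ * ε) from fun h => hy (mem_embBall'.2 h))]

/-- Away from the diagonal the weight is bounded, so that part of the energy is controlled by the
`L^p` norm. -/
theorem energyOn_le_closePairs_add (he : Measurable e) (hp : 1 ≤ p) {h : X → V}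
    (hh : Measurable h) (hδ : 0 < δ) :
    energyOn μ n e p h univ ≤ energyOn μ n e p h (closePairs e δ) +
      ENNReal.ofReal ((δ ^ (2 * n))⁻¹) * (2 ^ (p - 1) * (2 * μ univ)) * ∫⁻ x, ‖h x‖ₑ ^ p ∂μ := by
  have hm : Measurable fun x => ‖h x‖ₑ ^ p := hh.enorm.pow_const _
  rw [energyOn, Measure.restrict_univ, ← lintegral_add_compl _ (measurableSet_closePairs he δ)]
  refine add_le_add le_rfl ?_
  calc _ ≤ ∫⁻ w in (closePairs e δ)ᶜ, ENNReal.ofReal ((δ ^ (2 * n))⁻¹) * 2 ^ (p - 1) *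
        (‖h w.1‖ₑ ^ p + ‖h w.2‖ₑ ^ p) ∂(μ.prod μ) := by
        refine setLIntegral_mono' (measurableSet_closePairs he δ).compl fun w hw => ?_
        rw [mul_comm (‖h w.1 - h w.2‖ₑ ^ p), mul_assoc]
        refine mul_le_mul' (ENNReal.ofReal_le_ofReal ?_) ?_
        · have : δ ≤ ‖e w.1 - e w.2‖ := not_lt.1 hw
          gcongr
        · refine le_trans (ENNReal.rpow_le_rpow ?_ (by linarith))
            (ENNReal.rpow_add_le_mul_rpow_add_rpow _ _ hp)
          exact enorm_sub_le
    _ ≤ ∫⁻ w, ENNReal.ofReal ((δ ^ (2 * n))⁻¹) * 2 ^ (p - 1) *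
        (‖h w.1‖ₑ ^ p + ‖h w.2‖ₑ ^ p) ∂(μ.prod μ) := setLIntegral_le_lintegral _ _
    _ = ENNReal.ofReal ((δ ^ (2 * n))⁻¹) * 2 ^ (p - 1) *
        (μ univ * ∫⁻ x, ‖h x‖ₑ ^ p ∂μ + μ univ * ∫⁻ x, ‖h x‖ₑ ^ p ∂μ) := by
        have m1 : Measurable fun w : X × X => ‖h w.1‖ₑ ^ p := hm.comp measurable_fst
        have m2 : Measurable fun w : X × X => ‖h w.2‖ₑ ^ p := hm.comp measurable_snd
        have m3 : Measurable fun w : X × X => ‖h w.1‖ₑ ^ p + ‖h w.2‖ₑ ^ p := m1.add m2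
        rw [lintegral_const_mul _ m3, lintegral_add_left m1,
          lintegral_prod _ m1.aemeasurable, lintegral_prod _ m2.aemeasurable]
        simp only [lintegral_const]
        rw [lintegral_mul_const _ hm, mul_comm (μ univ)]
    _ = _ := by ring

/-- Mollified maps, retracted to `N`, approximate `u` in the Sobolev norm. -/
theorem exists_mollify_close (hA : IsAhlfors n μ e c₀ C₀) (he : Measurable e)
    (hinj : Function.Injective e) (hn : 1 ≤ n) (hp : (n : ℝ) < p)
    (hρ : IsLipschitzRetraction ι ρ δ K) {b : ℝ} (hb : ∀ q, ‖ι q‖ ≤ b) {u : X → N}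
    (hu : Measurable fun x => ι (u x)) (hE : energyOn μ n e p (fun x => ι (u x)) univ ≠ ⊤)
    {κ : ℝ≥0∞} (hκ : κ ≠ 0) :
    ∃ Λ l ε : ℝ, 0 < ε ∧ IsAveraging μ n e univ (fun _ => ε) (mollifierDensity e ε) Λ l ∧
      (∀ x, ∃ q, ‖avg μ (fun _ => ε) (mollifierDensity e ε) (fun x => ι (u x)) x - ι q‖ < δ) ∧
      ∫⁻ x, ‖ι (ρ (avg μ (fun _ => ε) (mollifierDensity e ε) (fun x => ι (u x)) x)) -
        ι (u x)‖ₑ ^ p ∂μ ≤ κ ∧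
      energyOn μ n e p (fun x => ι (ρ (avg μ (fun _ => ε) (mollifierDensity e ε)
        (fun x => ι (u x)) x)) - ι (u x)) univ ≤ κ := by
  have hp1 : 1 ≤ p := le_trans (by exact_mod_cast hn) hp.le
  have hp0 : 0 < p := by linarith
  obtain ⟨Λ, l, hΛ, hl, hav⟩ := exists_isAveraging_mollifier hA he
  obtain ⟨C, hC, hCE⟩ := IsAveraging.exists_energyOn_avg_le (V := V) hA he hinj hn hp Λ l hΛ hl
  set f : X → V := fun x => ι (u x) with hf
  have hfb : ∀ x, ‖f x‖ ≤ b := fun x => hb _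
  have hK := hρ.nonneg
  have hδ := hρ.pos
  set t : ℝ≥0∞ := 2 ^ (p - 1) with ht
  have htop : t ≠ ⊤ := ENNReal.rpow_ne_top_of_nonneg (by linarith) (by norm_num)
  set C₂ : ℝ := (Λ / l) ^ 2 * (2 * Λ) ^ (2 * n) with hC₂
  set C₃ : ℝ := Λ / l * Λ ^ (2 * n) with hC₃
  have hκ2 : κ / 2 ≠ 0 := ENNReal.div_ne_zero.2 ⟨hκ, by norm_num⟩
  obtain ⟨κ₁, hκ₁, hκ₁'⟩ := exists_ne_zero_mul_le
    (c := t * (ENNReal.ofReal (K ^ p) * ENNReal.ofReal C + 1)) (ENNReal.mul_ne_top htop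
      (ENNReal.add_ne_top.2 ⟨ENNReal.mul_ne_top ENNReal.ofReal_ne_top ENNReal.ofReal_ne_top,
        ENNReal.one_ne_top⟩)) hκ2
  obtain ⟨δ₁, hδ₁, hs1⟩ := exists_energyOn_closePairs_le hA he hn hE hκ₁
  -- The cut between close and distant pairs is fixed first, making the close part small for the
  -- mollified map as well as for `u`. The budget `κ₃` for the distant part depends on `δ₂`, and `ε`
  -- is chosen last.
  set δ₂ : ℝ := δ₁ / (4 * Λ + 1) with hδ₂
  have hδ₂0 : 0 < δ₂ := by positivity
  have hδ₂' : (4 * Λ + 1) * δ₂ = δ₁ := by rw [hδ₂]; field_simp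
  have hδp : ENNReal.ofReal ((δ / 2) ^ p) ≠ 0 := by
    rw [Ne, ENNReal.ofReal_eq_zero, not_le]; positivity
  obtain ⟨κ₂, hκ₂, hκ₂'⟩ := exists_ne_zero_mul_le (ENNReal.ofReal_ne_top (r := C₂)) hδp
  obtain ⟨κ₃, hκ₃, hκ₃'⟩ := exists_ne_zero_mul_le
    (c := (ENNReal.ofReal ((δ₂ ^ (2 * n))⁻¹) * (t * (2 * μ univ)) + 1) *
      (ENNReal.ofReal (K ^ p) * ENNReal.ofReal C₃)) (ENNReal.mul_ne_top (ENNReal.add_ne_top.2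
      ⟨ENNReal.mul_ne_top ENNReal.ofReal_ne_top (ENNReal.mul_ne_top htop
        (ENNReal.mul_ne_top (by norm_num) (measure_ne_top μ _))), ENNReal.one_ne_top⟩)
      (ENNReal.mul_ne_top ENNReal.ofReal_ne_top ENNReal.ofReal_ne_top)) hκ2
  obtain ⟨δ₃, hδ₃, hs3⟩ := exists_energyOn_closePairs_le hA he hn hE
    (κ := min κ₂ κ₃) (by simp [hκ₂, hκ₃])
  obtain ⟨hs2, hs3⟩ := le_min_iff.1 hs3.le
  set ε : ℝ := min 1 (min (δ₁ / (4 * Λ)) (δ₃ / (4 * Λ))) with hε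
  have hε0 : 0 < ε := by positivity
  have hε1 : ε ≤ 1 := min_le_left _ _
  have hεδ₁ : 4 * Λ * ε ≤ δ₁ := by
    rw [mul_comm, ← le_div_iff₀ (by positivity)]
    exact (min_le_right _ _).trans (min_le_left _ _)
  have hεδ₃ : 4 * Λ * ε ≤ δ₃ := by
    rw [mul_comm, ← le_div_iff₀ (by positivity)]
    exact (min_le_right _ _).trans (min_le_right _ _)
  have hΛε : 0 < Λ * ε := by positivity
  have h := hav ε hε0 hε1
  set F := avg μ (fun _ => ε) (mollifierDensity e ε) f with hF
  have hFm : Measurable F := h.measurable_avg hu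
  have hnear : ∀ x, ∃ q, ‖F x - ι q‖ < δ := by
    intro x
    obtain ⟨y, -, -, hFy⟩ := h.exists_enorm_avg_sub_le he hinj hu hfb hp1 (mem_univ x) hε0.ne'
      (D := δ₃) (by linarith) (Q := fun _ => True) (ae_of_all _ fun _ => trivial)
    refine ⟨u y, ?_⟩
    have e2 := hFy.trans ((mul_le_mul_right hs2 _).trans hκ₂')
    rw [← ENNReal.ofReal_rpow_of_nonneg (by positivity) hp0.le,
      ENNReal.rpow_le_rpow_iff hp0, ← ofReal_norm,
      ENNReal.ofReal_le_ofReal_iff (by positivity)] at e2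
    exact e2.trans_lt (by linarith)
  have hgm : Measurable fun x => ι (ρ (F x)) := hρ.measurable_comp hFm hnear
  have hLp : ∫⁻ x, ‖ι (ρ (F x)) - ι (u x)‖ₑ ^ p ∂μ ≤
      ENNReal.ofReal (K ^ p) * ENNReal.ofReal C₃ * κ₃ := by
    calc _ ≤ ∫⁻ x, ENNReal.ofReal (K ^ p) * ‖F x - f x‖ₑ ^ p ∂μ := by
          refine lintegral_mono fun x => ?_
          rw [← ENNReal.ofReal_rpow_of_nonneg hK hp0.le, ← ENNReal.mul_rpow_of_nonneg _ _ hp0.le]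
          refine ENNReal.rpow_le_rpow ?_ hp0.le
          rw [← ofReal_norm, ← ofReal_norm, ← ENNReal.ofReal_mul hK]
          refine ENNReal.ofReal_le_ofReal ?_
          have e1 := hρ.lip (F x) (f x) (hnear x) ⟨u x, by rw [hf]; simpa using hδ⟩
          rwa [hf, hρ.left_inv] at e1
      _ = ENNReal.ofReal (K ^ p) * ∫⁻ x, ‖F x - f x‖ₑ ^ p ∂μ :=
          lintegral_const_mul' _ _ ENNReal.ofReal_ne_top
      _ ≤ ENNReal.ofReal (K ^ p) * (ENNReal.ofReal C₃ * κ₃) := by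
          refine mul_le_mul_right ((lintegral_enorm_avg_sub_rpow_le he hinj h hε0 hε1 hp1 hu
            hfb).trans (mul_le_mul_right ((energyOn_mono_set fun w hw => ?_).trans hs3) _)) _
          refine lt_of_lt_of_le (show ‖e w.1 - e w.2‖ < Λ * ε from hw) ?_
          linarith
      _ = _ := by rw [mul_assoc]
  refine ⟨Λ, l, ε, hε0, h, hnear, hLp.trans ?_, ?_⟩
  · calc _ ≤ (ENNReal.ofReal ((δ₂ ^ (2 * n))⁻¹) * (t * (2 * μ univ)) + 1) *
          (ENNReal.ofReal (K ^ p) * ENNReal.ofReal C₃) * κ₃ := by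
          refine mul_le_mul_left ?_ _
          rw [add_mul, one_mul]
          exact le_add_self
      _ ≤ κ / 2 := hκ₃'
      _ ≤ κ := ENNReal.half_le_self
  · refine (energyOn_le_closePairs_add he hp1 (hgm.sub hu) hδ₂0).trans ?_
    rw [← ENNReal.add_halves κ]
    refine add_le_add (le_trans ?_ hκ₁') (le_trans ?_ hκ₃')
    · rw [mul_assoc, add_mul, one_mul]
      refine (energyOn_sub_le he hp1 hgm _).trans (mul_le_mul_right (add_le_add ?_ ?_) _)
      · calc _ ≤ ENNReal.ofReal (K ^ p) * energyOn μ n e p F (closePairs e δ₂) :=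
              energyOn_le_of_norm_sub_le (measurableSet_closePairs he _) hK hp0.le
                fun w _ => hρ.lip _ _ (hnear w.1) (hnear w.2)
          _ ≤ ENNReal.ofReal (K ^ p) * (ENNReal.ofReal C *
              energyOn μ n e p f (closePairs e δ₁)) := by
              refine mul_le_mul_right ?_ _
              have := hCE univ _ _ h f b ε δ₂ δ₁ hu hfb (fun _ _ => le_rfl) hεδ₁ hδ₂'.le
              rwa [univ_prod_univ, univ_inter] at this
          _ ≤ _ := by
              rw [← mul_assoc]
              exact mul_le_mul_right hs1.le _
      · refine (energyOn_mono_set fun w hw => ?_).trans hs1.le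
        refine lt_of_lt_of_le (show ‖e w.1 - e w.2‖ < δ₂ from hw) ?_
        rw [← hδ₂']
        nlinarith
    · exact (mul_le_mul' (le_self_add (b := 1)) hLp).trans (le_of_eq (mul_assoc _ _ _).symm)

end Mollify

/-! ### The Sobolev norm in terms of the energy on pairs -/

section SobolevNorm

variable {S : Type*} [EMetricSpace S] [MeasurableSpace S] [BorelSpace S] {n L M : ℕ}
  {e : S → EuclideanSpace ℝ (Fin L)} {s : ℝ} [IsFiniteMeasure (μHE[n] : Measure S)]

theorem gagliardoEnergy_eq_energyOn (hs : 0 < s) (he : Measurable e)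
    {f : S → EuclideanSpace ℝ (Fin M)} (hf : AEStronglyMeasurable f (μHE[n] : Measure S)) :
    gagliardoEnergy n e s (n / s) f = energyOn (μHE[n] : Measure S) n e (n / s) f univ := by
  have hp : 0 ≤ (n : ℝ) / s := by positivity
  have hm : AEMeasurable (fun w : S × S => ‖f w.1 - f w.2‖ₑ ^ ((n : ℝ) / s) *
      gagliardoWeight n e w.1 w.2) ((μHE[n] : Measure S).prod (μHE[n] : Measure S)) :=
    ((hf.comp_fst.sub hf.comp_snd).enorm.pow_const _).mul
      (measurable_gagliardoWeight he).aemeasurable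
  rw [energyOn, Measure.restrict_univ, lintegral_prod _ hm, gagliardoEnergy]
  refine lintegral_congr fun x => lintegral_congr fun y => ?_
  have h2 : (n : ℝ) + s * (n / s) = ((2 * n : ℕ) : ℝ) := by
    push_cast
    field_simp
    ring
  rw [h2, Real.rpow_natCast, div_eq_mul_inv, ENNReal.ofReal_mul (by positivity),
    ← ENNReal.ofReal_rpow_of_nonneg (norm_nonneg _) hp, ofReal_norm, gagliardoWeight]

theorem eLpNorm_ofReal_eq {X W : Type*} [MeasurableSpace X] {μ : Measure X}
    [NormedAddCommGroup W] {p : ℝ} (hp : 0 < p) (f : X → W) :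
    eLpNorm f (ENNReal.ofReal p) μ = (∫⁻ x, ‖f x‖ₑ ^ p ∂μ) ^ (1 / p) := by
  rw [eLpNorm_eq_lintegral_rpow_enorm_toReal (by simpa using hp) ENNReal.ofReal_ne_top,
    ENNReal.toReal_ofReal hp.le]

theorem sobolevNorm_eq (hs : 0 < s) (he : Measurable e)
    {f : S → EuclideanSpace ℝ (Fin M)} (hf : AEStronglyMeasurable f (μHE[n] : Measure S)) :
    sobolevNorm n e s (n / s) f = eLpNorm f (ENNReal.ofReal (n / s)) (μHE[n] : Measure S) +
      energyOn (μHE[n] : Measure S) n e (n / s) f univ ^ (1 / ((n : ℝ) / s)) := by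
  rw [sobolevNorm, gagliardoEnergy_eq_energyOn hs he hf]

omit [IsFiniteMeasure (μHE[n] : Measure S)] in
theorem gagliardoEnergy_congr_ae {p : ℝ} {f g : S → EuclideanSpace ℝ (Fin M)}
    (h : f =ᵐ[(μHE[n] : Measure S)] g) : gagliardoEnergy n e s p f = gagliardoEnergy n e s p g := by
  refine lintegral_congr_ae ?_
  filter_upwards [h] with x hx
  refine lintegral_congr_ae ?_
  filter_upwards [h] with y hy
  rw [hx, hy]

omit [IsFiniteMeasure (μHE[n] : Measure S)] in
theorem sobolevNorm_congr_ae {p : ℝ} {f g : S → EuclideanSpace ℝ (Fin M)}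
    (h : f =ᵐ[(μHE[n] : Measure S)] g) : sobolevNorm n e s p f = sobolevNorm n e s p g := by
  rw [sobolevNorm, sobolevNorm, eLpNorm_congr_ae h, gagliardoEnergy_congr_ae h]

theorem sobolevNorm_add_le (hn : 1 ≤ n) (hs : 0 < s) (hs1 : s < 1) (he : Measurable e)
    {f g : S → EuclideanSpace ℝ (Fin M)} (hf : Measurable f) (hg : Measurable g) :
    sobolevNorm n e s (n / s) (fun x => f x + g x) ≤
      sobolevNorm n e s (n / s) f + sobolevNorm n e s (n / s) g := by
  have hn' : (1 : ℝ) ≤ n := by exact_mod_cast hn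
  have hp : 1 ≤ (n : ℝ) / s := by rw [le_div_iff₀ hs]; linarith
  have hfg : Measurable fun x => f x + g x := hf.add hg
  rw [sobolevNorm_eq hs he hf.aestronglyMeasurable, sobolevNorm_eq hs he hg.aestronglyMeasurable,
    sobolevNorm_eq hs he hfg.aestronglyMeasurable, add_add_add_comm]
  refine add_le_add (eLpNorm_add_le hf.aestronglyMeasurable hg.aestronglyMeasurable ?_)
    (energyOn_add_rpow_le he hp hf hg univ)
  rwa [ENNReal.one_le_ofReal]

theorem sobolevNorm_le (hn : 1 ≤ n) (hs : 0 < s) (he : Measurable e)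
    {f : S → EuclideanSpace ℝ (Fin M)} (hf : Measurable f) {κ : ℝ≥0∞}
    (h1 : ∫⁻ x, ‖f x‖ₑ ^ ((n : ℝ) / s) ∂(μHE[n] : Measure S) ≤ (κ / 2) ^ ((n : ℝ) / s))
    (h2 : energyOn (μHE[n] : Measure S) n e (n / s) f univ ≤ (κ / 2) ^ ((n : ℝ) / s)) :
    sobolevNorm n e s (n / s) f ≤ κ := by
  have hn' : (0 : ℝ) < n := by exact_mod_cast hn
  have hp : 0 < (n : ℝ) / s := by positivity
  have key : ∀ {A : ℝ≥0∞}, A ≤ (κ / 2) ^ ((n : ℝ) / s) → A ^ (1 / ((n : ℝ) / s)) ≤ κ / 2 := by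
    intro A hA
    refine (ENNReal.rpow_le_rpow hA (by positivity)).trans (le_of_eq ?_)
    rw [← ENNReal.rpow_mul, mul_one_div_cancel hp.ne', ENNReal.rpow_one]
  rw [sobolevNorm_eq hs he hf.aestronglyMeasurable, eLpNorm_ofReal_eq hp, ← ENNReal.add_halves κ]
  exact add_le_add (key h1) (key h2)

end SobolevNorm

/-! ### Smooth approximations and measurable representatives -/

section SmoothApprox

variable {S : Type*} [EMetricSpace S] [MeasurableSpace S] [BorelSpace S] {n m L M : ℕ}
  [ChartedSpace (EuclideanSpace ℝ (Fin n)) S] {e : S → EuclideanSpace ℝ (Fin L)}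
  {N : Type*} [TopologicalSpace N] [ChartedSpace (EuclideanSpace ℝ (Fin m)) N]
  {ι : N → EuclideanSpace ℝ (Fin M)} {s p : ℝ}

theorem tendsto_floor_one_div : Tendsto (fun ε : ℝ => ⌊1 / ε⌋₊) (𝓝[>] 0) atTop := by
  simp only [one_div]
  exact tendsto_nat_floor_atTop.comp tendsto_inv_nhdsGT_zero

/-- The homotopy relation speaks of families indexed by `ε > 0`; a sequence is turned into a family
through `k = ⌊1 / ε⌋₊`. -/
theorem isSmoothApprox_of_tendsto {A : ℕ → S → N} {u : S → N}
    (hA : ∀ k, ContMDiff (𝓡 n) (𝓡 m) ∞ (A k))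
    (h : Tendsto (fun k => sobolevNorm n e s p (fun x => ι (A k x) - ι (u x))) atTop (𝓝 0)) :
    IsSmoothApprox n m e ι s p (fun ε => A ⌊1 / ε⌋₊) u :=
  ⟨fun _ _ => hA _, h.comp tendsto_floor_one_div⟩

theorem SobolevHomotopic.congr_ae {u u' v v' : S → N} (hu : u =ᵐ[(μHE[n] : Measure S)] u')
    (hv : v =ᵐ[(μHE[n] : Measure S)] v') (h : SobolevHomotopic n m e ι s p u v) :
    SobolevHomotopic n m e ι s p u' v' := by
  have key : ∀ {a : ℝ → S → N} {w w' : S → N}, w =ᵐ[(μHE[n] : Measure S)] w' →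
      IsSmoothApprox n m e ι s p a w' → IsSmoothApprox n m e ι s p a w := by
    intro a w w' hw ha
    refine ⟨ha.1, ha.2.congr fun ε => sobolevNorm_congr_ae ?_⟩
    filter_upwards [hw] with x hx
    rw [hx]
  exact fun a b ha hb => h a b (key hu ha) (key hv hb)

theorem MemSobolev.congr_ae {u u' : S → N} (hu : u =ᵐ[(μHE[n] : Measure S)] u')
    (h : MemSobolev n e ι s p u) : MemSobolev n e ι s p u' := by
  have h1 : (fun x => ι (u x)) =ᵐ[(μHE[n] : Measure S)] fun x => ι (u' x) := by
    filter_upwards [hu] with x hx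
    rw [hx]
  exact ⟨h.1.congr h1, by rw [← sobolevNorm_congr_ae h1]; exact h.2⟩

/-- The modification has to keep its values in `N`, so on a measurable null set the map is replaced
by a constant rather than by the representative of `ι ∘ u`. -/
theorem exists_measurable_representative {X N V : Type*} [MeasurableSpace X] {μ : Measure X}
    [TopologicalSpace V] [TopologicalSpace.PseudoMetrizableSpace V] [MeasurableSpace V]
    [BorelSpace V] [Nonempty N] {ι : N → V} {u : X → N}
    (hu : AEStronglyMeasurable (fun x => ι (u x)) μ) :
    ∃ u' : X → N, u =ᵐ[μ] u' ∧ Measurable fun x => ι (u' x) := by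
  classical
  obtain ⟨q⟩ := ‹Nonempty N›
  set T := toMeasurable μ {x | ι (u x) ≠ hu.mk _ x} with hT
  have hT0 : μ T = 0 := by
    rw [hT, measure_toMeasurable]
    exact hu.ae_eq_mk
  refine ⟨T.piecewise (fun _ => q) u, ?_, ?_⟩
  · have : ∀ᵐ x ∂μ, x ∉ T := measure_eq_zero_iff_ae_notMem.1 hT0
    filter_upwards [this] with x hx
    rw [piecewise_eq_of_notMem _ _ _ hx]
  · have : (fun x => ι (T.piecewise (fun _ => q) u x)) = T.piecewise (fun _ => ι q) (hu.mk _) := by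
      funext x
      by_cases hx : x ∈ T
      · rw [piecewise_eq_of_mem _ _ _ hx, piecewise_eq_of_mem _ _ _ hx]
      · rw [piecewise_eq_of_notMem _ _ _ hx, piecewise_eq_of_notMem _ _ _ hx]
        by_contra hcon
        exact hx (subset_toMeasurable _ _ hcon)
    rw [this]
    exact measurable_const.piecewise (measurableSet_toMeasurable _ _)
      hu.stronglyMeasurable_mk.measurable

end SmoothApprox

/-! ### Chains of short steps in the target -/

section Chains

variable {N V : Type*} [NormedAddCommGroup V] {ι : N → V} {δ : ℝ}

/-- `q` and `q'` are joined by a chain of steps of size less than `δ`. -/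
def Chained (ι : N → V) (δ : ℝ) : N → N → Prop :=
  Relation.ReflTransGen fun q q' => ‖ι q - ι q'‖ < δ

theorem Chained.symm {q q' : N} (h : Chained ι δ q q') : Chained ι δ q' q := by
  have : Std.Symm fun q q' : N => ‖ι q - ι q'‖ < δ := ⟨fun a b hab => by rwa [norm_sub_rev]⟩
  exact Relation.ReflTransGen.stdSymm.symm _ _ h

theorem chained_of_isPreconnected {Y : Type*} [TopologicalSpace Y] (hδ : 0 < δ) {f : Y → N}
    {T : Set Y} (hT : IsPreconnected T) (hf : ContinuousOn (fun y => ι (f y)) T) {y y' : Y}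
    (hy : y ∈ T) (hy' : y' ∈ T) : Chained ι δ (f y) (f y') := by
  refine hT.induction₂ (fun y y' => Chained ι δ (f y) (f y')) (fun z hz => ?_)
    (fun _ _ _ _ _ _ h1 h2 => h1.trans h2) (fun _ _ _ _ h => h.symm) hy hy'
  have h1 : ∀ᶠ z' in 𝓝[T] z, ι (f z') ∈ Metric.ball (ι (f z)) δ :=
    (hf z hz).eventually (Metric.ball_mem_nhds _ hδ)
  filter_upwards [h1] with z' hz'
  refine Relation.ReflTransGen.single ?_
  rwa [Metric.mem_ball', dist_eq_norm] at hz'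

/-- Values of `u` near `x₀` are chained to the values at `x₀` of approximations of `u`. -/
theorem eventually_chained {X : Type*} [TopologicalSpace X] [MeasurableSpace X]
    {E : Type*} [NormedAddCommGroup E] {e : X → E} {μ : Measure X} (hδ : 0 < δ) {x₀ : X} {R : ℝ}
    (hR : embBall e x₀ R ⊆ connectedComponent x₀) {p : ℝ≥0∞} (hp : p ≠ 0) {u : X → N} {q : N}
    (hq : IsValueNear μ e ι δ x₀ R u q) {A : ℕ → X → N} (hA : ∀ k, Continuous fun x => ι (A k x))
    (hAm : ∀ k, AEStronglyMeasurable (fun x => ι (A k x)) μ)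
    (hum : AEStronglyMeasurable (fun x => ι (u x)) μ)
    (h : Tendsto (fun k => eLpNorm (fun x => ι (A k x) - ι (u x)) p μ) atTop (𝓝 0)) :
    ∀ᶠ k in atTop, Chained ι δ (A k x₀) q := by
  have hmeas := tendstoInMeasure_of_tendsto_eLpNorm hp hAm hum h (ENNReal.ofReal δ)
    (ENNReal.ofReal_pos.2 hδ)
  -- This set is not null, because `q` stays close to values of `u` after removing any null set.
  -- Convergence in measure then provides a point of `G` at which `A k` is close to `u`.
  set G : Set X := {y | y ∈ embBall e x₀ R ∧ ‖ι q - ι (u y)‖ < δ} with hG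
  have hG0 : μ G ≠ 0 := by
    intro h0
    obtain ⟨y, hy, hy1, hy2⟩ := hq (fun y => y ∉ G) (measure_eq_zero_iff_ae_notMem.1 h0)
    exact hy1 ⟨hy, hy2⟩
  filter_upwards [hmeas.eventually (gt_mem_nhds (pos_iff_ne_zero.2 hG0))] with k hk
  obtain ⟨y, hyG, hy⟩ : ∃ y ∈ G, y ∉ {x | ENNReal.ofReal δ ≤ edist (ι (A k x)) (ι (u x))} := by
    by_contra hcon
    push Not at hcon
    exact absurd (measure_mono hcon) (not_le.2 hk)
  have h1 : ‖ι (A k y) - ι (u y)‖ < δ := by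
    have : edist (ι (A k y)) (ι (u y)) < ENNReal.ofReal δ := not_le.1 hy
    rwa [edist_dist, ENNReal.ofReal_lt_ofReal_iff hδ, dist_eq_norm] at this
  have h2 : ‖ι (u y) - ι q‖ < δ := by rw [norm_sub_rev]; exact hyG.2
  -- The chain runs from `A k x₀` to `A k y` by continuity on the connected component, then to `u
  -- y`, then to `q`.
  have h3 : Chained ι δ (A k x₀) (A k y) := chained_of_isPreconnected hδ
    isPreconnected_connectedComponent (hA k).continuousOn mem_connectedComponent (hR hyG.1)
  exact (h3.tail h1).tail h2

end Chains

theorem isContinuousRiemannianBundle {n : ℕ} {S : Type*} [TopologicalSpace S]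
    [ChartedSpace (EuclideanSpace ℝ (Fin n)) S] [IsManifold (𝓡 n) ∞ S]
    [RiemannianBundle (fun x : S => TangentSpace (𝓡 n) x)]
    [h : IsContMDiffRiemannianBundle (𝓡 n) ∞ (EuclideanSpace ℝ (Fin n))
      (fun x : S => TangentSpace (𝓡 n) x)] :
    IsContinuousRiemannianBundle (EuclideanSpace ℝ (Fin n))
      (fun x : S => TangentSpace (𝓡 n) x) :=
  ⟨let ⟨g, hg, hg'⟩ := h.exists_contMDiff; ⟨g, hg.continuous, hg'⟩⟩

/-! ### Stability of the homotopy relation and conclusion -/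

section Main

variable {n : ℕ} {s : ℝ} {S : Type*} [EMetricSpace S] [CompactSpace S] [MeasurableSpace S]
  [BorelSpace S] [ChartedSpace (EuclideanSpace ℝ (Fin n)) S] [IsManifold (𝓡 n) ∞ S]
  {L : ℕ} {e : S → EuclideanSpace ℝ (Fin L)} {m : ℕ} {N : Type*} [TopologicalSpace N]
  [CompactSpace N] [ChartedSpace (EuclideanSpace ℝ (Fin m)) N] [IsManifold (𝓡 m) ∞ N]
  {M : ℕ} {ι : N → EuclideanSpace ℝ (Fin M)} {ρ : EuclideanSpace ℝ (Fin M) → N} {δ K b c₀ C₀ : ℝ}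
  [IsFiniteMeasure (μHE[n] : Measure S)]

theorem lt_div_self {n : ℕ} {s : ℝ} (hn : 1 ≤ n) (hs : 0 < s) (hs1 : s < 1) :
    (n : ℝ) < n / s := by
  have hn' : (0 : ℝ) < n := by exact_mod_cast hn
  rw [lt_div_iff₀ hs]
  nlinarith

theorem ne_zero_of_tendsto_bound {k : ℕ} : (ENNReal.ofReal (1 / ((k : ℝ) + 1))) ≠ 0 := by
  rw [Ne, ENNReal.ofReal_eq_zero, not_le]
  positivity

theorem tendsto_ofReal_one_div : Tendsto (fun k : ℕ => ENNReal.ofReal (1 / ((k : ℝ) + 1))) atTop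
    (𝓝 0) := by
  have := ENNReal.tendsto_ofReal (tendsto_one_div_add_atTop_nhds_zero_nat (𝕜 := ℝ))
  rwa [ENNReal.ofReal_zero] at this

/-- Smooth maps are dense. -/
theorem exists_contMDiff_sobolevNorm_le (hn : 1 ≤ n) (hs : 0 < s) (hs1 : s < 1)
    (he : IsSmoothEmbedding (𝓡 n) (𝓡 L) ∞ e)
    (hA : IsAhlfors n (μHE[n] : Measure S) e c₀ C₀) (hρ : IsLipschitzRetraction ι ρ δ K)
    (hρs : ∀ w, (∃ q, ‖w - ι q‖ < δ) → ContMDiffAt (𝓡 M) (𝓡 m) ∞ ρ w) (hb : ∀ q, ‖ι q‖ ≤ b)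
    {u : S → N} (hu : Measurable fun x => ι (u x))
    (hE : energyOn (μHE[n] : Measure S) n e (n / s) (fun x => ι (u x)) univ ≠ ⊤)
    {κ : ℝ≥0∞} (hκ : κ ≠ 0) :
    ∃ A : S → N, ContMDiff (𝓡 n) (𝓡 m) ∞ A ∧
      sobolevNorm n e s (n / s) (fun x => ι (A x) - ι (u x)) ≤ κ := by
  have hec : Continuous e := he.isEmbedding.continuous
  have hinj : Function.Injective e := he.isEmbedding.injective
  have hem : MeasurableEmbedding e := (hec.isClosedEmbedding hinj).measurableEmbedding
  have hn' : (0 : ℝ) < n := by exact_mod_cast hn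
  have hp : 0 < (n : ℝ) / s := by positivity
  have hκ' : (κ / 2) ^ ((n : ℝ) / s) ≠ 0 := by
    rw [Ne, ENNReal.rpow_eq_zero_iff_of_pos hp]
    exact ENNReal.div_ne_zero.2 ⟨hκ, by norm_num⟩
  obtain ⟨Λ, l, ε, hε, hav, hnear, h1, h2⟩ := exists_mollify_close hA hec.measurable hinj hn
    (lt_div_self hn hs hs1) hρ hb hu hE hκ'
  have hFm := hav.measurable_avg hu
  have hint : Integrable (fun x => ι (u x)) (μHE[n] : Measure S) :=
    Integrable.of_bound hu.aestronglyMeasurable b (ae_of_all _ fun x => hb _)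
  obtain ⟨Ψ, Z, hΨ, hZ, hZ0, hF⟩ := exists_contDiff_avg_mollifier hem hε hav hint
  refine ⟨_, fun x => ?_, sobolevNorm_le hn hs hec.measurable
    ((hρ.measurable_comp hFm hnear).sub hu) h1 h2⟩
  simp only [hF] at hnear ⊢
  have hg : ContDiffAt ℝ ∞ (fun z => (Z z)⁻¹ • Ψ z) (e x) :=
    (hZ.contDiffAt.inv (hZ0 x)).smul hΨ.contDiffAt
  exact (hρs _ (hnear x)).comp x (hg.contMDiffAt.comp x (he.contMDiff x))

theorem exists_tendsto_contMDiff (hn : 1 ≤ n) (hs : 0 < s) (hs1 : s < 1)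
    (he : IsSmoothEmbedding (𝓡 n) (𝓡 L) ∞ e)
    (hA : IsAhlfors n (μHE[n] : Measure S) e c₀ C₀) (hρ : IsLipschitzRetraction ι ρ δ K)
    (hρs : ∀ w, (∃ q, ‖w - ι q‖ < δ) → ContMDiffAt (𝓡 M) (𝓡 m) ∞ ρ w) (hb : ∀ q, ‖ι q‖ ≤ b)
    {u : S → N} (hu : Measurable fun x => ι (u x))
    (hE : energyOn (μHE[n] : Measure S) n e (n / s) (fun x => ι (u x)) univ ≠ ⊤) :
    ∃ A : ℕ → S → N, (∀ k, ContMDiff (𝓡 n) (𝓡 m) ∞ (A k)) ∧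
      Tendsto (fun k => sobolevNorm n e s (n / s) (fun x => ι (A k x) - ι (u x))) atTop (𝓝 0) := by
  choose A hAs hAu using fun k : ℕ => exists_contMDiff_sobolevNorm_le hn hs hs1 he hA hρ hρs hb hu
    hE (ne_zero_of_tendsto_bound (k := k))
  exact ⟨A, hAs, tendsto_of_tendsto_of_tendsto_of_le_of_le tendsto_const_nhds
    tendsto_ofReal_one_div (fun _ => zero_le) hAu⟩

/-- Values near `x₀` of homotopic Sobolev maps are joined by chains. -/
theorem chained_of_sobolevHomotopic (hn : 1 ≤ n) (hs : 0 < s) (hs1 : s < 1)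
    (he : IsSmoothEmbedding (𝓡 n) (𝓡 L) ∞ e)
    (hA : IsAhlfors n (μHE[n] : Measure S) e c₀ C₀) (hρ : IsLipschitzRetraction ι ρ δ K)
    (hρs : ∀ w, (∃ q, ‖w - ι q‖ < δ) → ContMDiffAt (𝓡 M) (𝓡 m) ∞ ρ w) (hb : ∀ q, ‖ι q‖ ≤ b)
    (hι : Continuous ι) {u v : S → N} (hu : Measurable fun x => ι (u x))
    (huE : energyOn (μHE[n] : Measure S) n e (n / s) (fun x => ι (u x)) univ ≠ ⊤)
    (hv : Measurable fun x => ι (v x))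
    (hvE : energyOn (μHE[n] : Measure S) n e (n / s) (fun x => ι (v x)) univ ≠ ⊤)
    (huv : SobolevHomotopic n m e ι s (n / s) u v) {x₀ : S} {R : ℝ}
    (hR : embBall e x₀ R ⊆ connectedComponent x₀) {q q' : N}
    (hq : IsValueNear (μHE[n] : Measure S) e ι δ x₀ R u q)
    (hq' : IsValueNear (μHE[n] : Measure S) e ι δ x₀ R v q') : Chained ι δ q' q := by
  have hn' : (0 : ℝ) < n := by exact_mod_cast hn
  have hp : 0 < (n : ℝ) / s := by positivity
  have hp0 : ENNReal.ofReal ((n : ℝ) / s) ≠ 0 := (ENNReal.ofReal_pos.2 hp).ne'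
  obtain ⟨A, hAs, hAu⟩ := exists_tendsto_contMDiff hn hs hs1 he hA hρ hρs hb hu huE
  obtain ⟨B, hBs, hBv⟩ := exists_tendsto_contMDiff hn hs hs1 he hA hρ hρs hb hv hvE
  have hAc : ∀ k, Continuous fun x => ι (A k x) := fun k => hι.comp (hAs k).continuous
  have hBc : ∀ k, Continuous fun x => ι (B k x) := fun k => hι.comp (hBs k).continuous
  have hLp : ∀ {f : ℕ → S → EuclideanSpace ℝ (Fin M)},
      Tendsto (fun k => sobolevNorm n e s (n / s) (f k)) atTop (𝓝 0) →
      Tendsto (fun k => eLpNorm (f k) (ENNReal.ofReal (n / s)) (μHE[n] : Measure S)) atTop (𝓝 0) :=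
    fun h => tendsto_of_tendsto_of_tendsto_of_le_of_le tendsto_const_nhds h
      (fun _ => zero_le) fun _ => le_self_add
  have hA1 := eventually_chained hρ.pos hR hp0 hq hAc
    (fun k => (hAc k).measurable.aestronglyMeasurable) hu.aestronglyMeasurable (hLp hAu)
  have hB1 := eventually_chained hρ.pos hR hp0 hq' hBc
    (fun k => (hBc k).measurable.aestronglyMeasurable) hv.aestronglyMeasurable (hLp hBv)
  obtain ⟨ε₀, hε₀, hhom⟩ := huv _ _ (isSmoothApprox_of_tendsto hAs hAu)
    (isSmoothApprox_of_tendsto hBs hBv)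
  have hε : ∀ᶠ ε in 𝓝[>] (0 : ℝ), ε ∈ Ioo 0 ε₀ := Ioo_mem_nhdsGT hε₀
  obtain ⟨ε, ⟨hε1, hA2⟩, hB2⟩ := ((hε.and (tendsto_floor_one_div.eventually hA1)).and
    (tendsto_floor_one_div.eventually hB1)).exists
  obtain ⟨H, hH, hH0, hH1⟩ := hhom ε hε1.1 hε1.2
  -- Following `x₀` along the homotopy of the approximations joins their values there by a path in
  -- `N`.
  have hpath : ContinuousOn (fun t : ℝ => ι (H (t, x₀))) (Icc 0 1) := by
    refine hι.comp_continuousOn (hH.continuousOn.comp (by fun_prop) fun t ht => ?_)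
    exact ⟨ht, mem_univ _⟩
  have h01 := chained_of_isPreconnected hρ.pos (f := fun t : ℝ => H (t, x₀)) isPreconnected_Icc
    hpath (left_mem_Icc.2 zero_le_one) (right_mem_Icc.2 zero_le_one)
  rw [hH0, hH1] at h01
  exact (hB2.symm.trans h01.symm).trans hA2

/-- Diagonal argument: if `u` is homotopic to `v`, it is homotopic to maps close to `v`. -/
theorem exists_ne_zero_forall_sobolevHomotopic (hn : 1 ≤ n) (hs : 0 < s) (hs1 : s < 1)
    (he : Measurable e) (hι : Continuous ι) {u v : S → N} (hv : Measurable fun x => ι (v x))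
    (huv : SobolevHomotopic n m e ι s (n / s) u v) :
    ∃ κ : ℝ≥0∞, κ ≠ 0 ∧ ∀ w : S → N, Measurable (fun x => ι (w x)) →
      sobolevNorm n e s (n / s) (fun x => ι (w x) - ι (v x)) ≤ κ →
      SobolevHomotopic n m e ι s (n / s) u w := by
  -- Otherwise some maps `w k` converge to `v` without being homotopic to `u`. For each `k` the
  -- failure supplies smooth maps, as close as desired to `u` and `w k`, that are not homotopic;
  -- these form approximations of `u` and `v` that contradict `u ∼ v`.
  by_contra hcon
  push Not at hcon
  choose w hw hwv hnot using fun k : ℕ => hcon _ (ne_zero_of_tendsto_bound (k := k))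
  have hdiag : ∀ k : ℕ, ∃ A B : S → N, ContMDiff (𝓡 n) (𝓡 m) ∞ A ∧ ContMDiff (𝓡 n) (𝓡 m) ∞ B ∧
      sobolevNorm n e s (n / s) (fun x => ι (A x) - ι (u x)) ≤ ENNReal.ofReal (1 / ((k : ℝ) + 1)) ∧
      sobolevNorm n e s (n / s) (fun x => ι (B x) - ι (w k x)) ≤
        ENNReal.ofReal (1 / ((k : ℝ) + 1)) ∧ ¬ SmoothHomotopic n m A B := by
    intro k
    have hk := hnot k
    rw [SobolevHomotopic] at hk
    push Not at hk
    obtain ⟨a, b, ha, hb, hab⟩ := hk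
    have hev := (ha.2.eventually (ge_mem_nhds (pos_iff_ne_zero.2
      (ne_zero_of_tendsto_bound (k := k))))).and (hb.2.eventually (ge_mem_nhds
        (pos_iff_ne_zero.2 (ne_zero_of_tendsto_bound (k := k)))))
    obtain ⟨ε₀, hε₀, hsub⟩ := mem_nhdsGT_iff_exists_Ioo_subset.1 hev
    obtain ⟨ε, hε, hεε, hn⟩ := hab ε₀ hε₀
    exact ⟨a ε, b ε, ha.1 ε hε, hb.1 ε hε, (hsub ⟨hε, hεε⟩).1, (hsub ⟨hε, hεε⟩).2, hn⟩
  choose A B hAs hBs hAu hBw hAB using hdiag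
  have hBv : ∀ k, sobolevNorm n e s (n / s) (fun x => ι (B k x) - ι (v x)) ≤
      ENNReal.ofReal (1 / ((k : ℝ) + 1)) + ENNReal.ofReal (1 / ((k : ℝ) + 1)) := by
    intro k
    have hB : Measurable fun x => ι (B k x) := (hι.comp (hBs k).continuous).measurable
    have h1 : (fun x => ι (B k x) - ι (v x)) =
        fun x => (ι (B k x) - ι (w k x)) + (ι (w k x) - ι (v x)) := by
      funext x; abel
    rw [h1]
    exact (sobolevNorm_add_le hn hs hs1 he (hB.sub (hw k)) ((hw k).sub hv)).trans
      (add_le_add (hBw k) (hwv k))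
  have hlim2 := tendsto_ofReal_one_div.add tendsto_ofReal_one_div
  rw [add_zero] at hlim2
  obtain ⟨ε₀, hε₀, hhom⟩ := huv _ _
    (isSmoothApprox_of_tendsto hAs (tendsto_of_tendsto_of_tendsto_of_le_of_le tendsto_const_nhds
      tendsto_ofReal_one_div (fun _ => zero_le) hAu))
    (isSmoothApprox_of_tendsto hBs (tendsto_of_tendsto_of_tendsto_of_le_of_le tendsto_const_nhds
      hlim2 (fun _ => zero_le) hBv))
  exact hAB _ (hhom (ε₀ / 2) (half_pos hε₀) (half_lt_self hε₀))

/-- Gluing with control of the Sobolev norm. -/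
theorem exists_glue_sobolevNorm_le (hn : 1 ≤ n) (hs : 0 < s) (hs1 : s < 1)
    (he : IsSmoothEmbedding (𝓡 n) (𝓡 L) ∞ e)
    (hA : IsAhlfors n (μHE[n] : Measure S) e c₀ C₀) (hρ : IsLipschitzRetraction ι ρ δ K)
    (hb : ∀ q, ‖ι q‖ ≤ b)
    (hι : Continuous ι) {u v : S → N} (hu : Measurable fun x => ι (u x))
    (huE : energyOn (μHE[n] : Measure S) n e (n / s) (fun x => ι (u x)) univ ≠ ⊤)
    (hv : Measurable fun x => ι (v x))
    (hvE : energyOn (μHE[n] : Measure S) n e (n / s) (fun x => ι (v x)) univ ≠ ⊤)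
    {x₀ : S} {R₀ : ℝ} (hR₀ : 0 < R₀)
    (hchain : ∀ q q', IsValueNear (μHE[n] : Measure S) e ι δ x₀ R₀ u q →
      IsValueNear (μHE[n] : Measure S) e ι δ x₀ R₀ v q' → Chained ι δ q' q)
    {κ : ℝ≥0∞} (hκ : κ ≠ 0) {R : ℝ} (hR : 0 < R) :
    ∃ (w : S → N) (r : ℝ), 0 < r ∧ Measurable (fun x => ι (w x)) ∧
      (∀ x ∈ embBall e x₀ r, w x = u x) ∧ (∀ x, x ∉ embBall e x₀ R → w x = v x) ∧
      sobolevNorm n e s (n / s) (fun x => ι (w x) - ι (v x)) ≤ κ := by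
  have hec : Continuous e := he.isEmbedding.continuous
  have hn' : (0 : ℝ) < n := by exact_mod_cast hn
  have hp : 0 < (n : ℝ) / s := by positivity
  have hC := hA.C_pos
  set κ' : ℝ≥0∞ := (κ / 2) ^ ((n : ℝ) / s) with hκ'def
  have hκ' : κ' ≠ 0 := by
    rw [hκ'def, Ne, ENNReal.rpow_eq_zero_iff_of_pos hp]
    exact ENNReal.div_ne_zero.2 ⟨hκ, by norm_num⟩
  -- The `L^p` part of the norm: `w - v` is bounded by `2 * b` and vanishes off a ball, whose radius
  -- is taken small.
  have hlim : Tendsto (fun r : ℝ => ENNReal.ofReal (2 * b) ^ ((n : ℝ) / s) *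
      ENNReal.ofReal (C₀ * r ^ n)) (𝓝[>] 0) (𝓝 0) := by
    have h1 : Continuous fun r : ℝ => C₀ * r ^ n := by fun_prop
    have h2 := h1.tendsto 0
    simp only [zero_pow (by lia : n ≠ 0), mul_zero] at h2
    have h3 := ENNReal.tendsto_ofReal (h2.mono_left (nhdsWithin_le_nhds (s := Ioi 0)))
    rw [ENNReal.ofReal_zero] at h3
    simpa using ENNReal.Tendsto.const_mul h3 (Or.inr (ENNReal.rpow_ne_top_of_nonneg hp.le
      (ENNReal.ofReal_ne_top (r := 2 * b))))
  obtain ⟨r, hr, hr0⟩ := ((hlim.eventually (ge_mem_nhds (pos_iff_ne_zero.2 hκ'))).and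
    self_mem_nhdsWithin).exists
  have hr0 : 0 < r := hr0
  obtain ⟨w, r', hr', hw, hwu, hwv, hE⟩ := exists_glue hι hA hec.measurable
    he.isEmbedding.injective hn (lt_div_self hn hs hs1) hρ hb x₀ hu huE hv hvE hR₀ hchain hκ'
    (lt_min hR hr0)
  refine ⟨w, r', hr', hw, hwu, fun x hx => hwv x fun hx' => hx (embBall_mono (min_le_left _ _) hx'),
    sobolevNorm_le hn hs hec.measurable (hw.sub hv) ?_ hE⟩
  refine le_trans (lintegral_mono (g := (embBall e x₀ r).indicator fun _ =>
    ENNReal.ofReal (2 * b) ^ ((n : ℝ) / s)) fun x => ?_) (le_trans ?_ hr)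
  · by_cases hx : x ∈ embBall e x₀ r
    · rw [indicator_of_mem hx]
      refine ENNReal.rpow_le_rpow ?_ hp.le
      rw [← ofReal_norm]
      refine ENNReal.ofReal_le_ofReal ((norm_sub_le _ _).trans ?_)
      linarith [hb (w x), hb (v x)]
    · simp only [Pi.sub_apply]
      rw [hwv x fun hx' => hx (embBall_mono (min_le_right _ _) hx'), sub_self]
      simp [hp]
  · rw [lintegral_indicator (measurableSet_embBall hec.measurable _ _), setLIntegral_const]
    exact mul_le_mul_right (hA.measure_embBall_le x₀ hr0) _

theorem exists_embBall_subset (he : IsSmoothEmbedding (𝓡 n) (𝓡 L) ∞ e) {x₀ : S} {U : Set S}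
    (hU : U ∈ 𝓝 x₀) : ∃ r : ℝ, 0 < r ∧ embBall e x₀ r ⊆ U := by
  rw [he.isEmbedding.toIsInducing.nhds_eq_comap] at hU
  obtain ⟨r, hr, hsub⟩ := ((Metric.nhds_basis_ball (x := e x₀)).comap e).mem_iff.1 hU
  refine ⟨r, hr, fun x hx => hsub ?_⟩
  rw [mem_preimage, Metric.mem_ball, dist_eq_norm]
  exact hx

theorem energyOn_ne_top_of_memSobolev (hn : 1 ≤ n) (hs : 0 < s) (he : Measurable e) {u : S → N}
    (hu : MemSobolev n e ι s (n / s) u) :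
    energyOn (μHE[n] : Measure S) n e (n / s) (fun x => ι (u x)) univ ≠ ⊤ := by
  have hn' : (0 : ℝ) < n := by exact_mod_cast hn
  have h := hu.2
  rw [sobolevNorm_eq hs he hu.1] at h
  intro htop
  rw [htop, ENNReal.top_rpow_of_pos (by positivity), add_top] at h
  exact lt_irrefl _ h

/-- The theorem for measurable representatives: the glued map is used as a competitor, and the cost
of gluing tends to zero. -/
theorem gagliardoEnergy_le_of_minimizing_away [RiemannianBundle (fun x : S => TangentSpace (𝓡 n) x)]
    [IsContMDiffRiemannianBundle (𝓡 n) ∞ (EuclideanSpace ℝ (Fin n))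
      (fun x : S => TangentSpace (𝓡 n) x)]
    [IsRiemannianManifold (𝓡 n) S] (hn : 1 ≤ n) (hs : 0 < s) (hs1 : s < 1)
    (he : IsSmoothEmbedding (𝓡 n) (𝓡 L) ∞ e) (hι : IsSmoothEmbedding (𝓡 m) (𝓡 M) ∞ ι)
    (hA : IsAhlfors n (μHE[n] : Measure S) e c₀ C₀) {x₀ : S} {R : ℝ} (hR : 0 < R)
    {u : S → N} (hum : Measurable fun x => ι (u x)) (hu : MemSobolev n e ι s (n / s) u)
    (hmin : ∀ ε : ℝ, 0 < ε → ∀ w : S → N, MemSobolev n e ι s (n / s) w →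
      (∀ᵐ x ∂(μHE[n] : Measure S),
        x ∈ Metric.eball x₀ (ENNReal.ofReal ε) ∪ (Metric.eball x₀ (ENNReal.ofReal R))ᶜ →
          u x = w x) →
      SobolevHomotopic n m e ι s (n / s) u w →
      gagliardoEnergy n e s (n / s) (fun x => ι (u x)) ≤
        gagliardoEnergy n e s (n / s) (fun x => ι (w x)))
    {v : S → N} (hvm : Measurable fun x => ι (v x)) (hv : MemSobolev n e ι s (n / s) v)
    (huv : ∀ᵐ x ∂(μHE[n] : Measure S), x ∈ (Metric.eball x₀ (ENNReal.ofReal R))ᶜ → u x = v x)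
    (hhom : SobolevHomotopic n m e ι s (n / s) u v) :
    gagliardoEnergy n e s (n / s) (fun x => ι (u x)) ≤
      gagliardoEnergy n e s (n / s) (fun x => ι (v x)) := by
  have hec : Continuous e := he.isEmbedding.continuous
  have hιc : Continuous ι := hι.isEmbedding.continuous
  have hn' : (1 : ℝ) ≤ n := by exact_mod_cast hn
  have hp1 : 1 ≤ (n : ℝ) / s := by rw [le_div_iff₀ hs]; linarith
  have hp : 0 < (n : ℝ) / s := by linarith
  have : Nonempty N := ⟨u x₀⟩
  obtain ⟨ρ, δ, K, hδ, hρι, hρs, hρL⟩ := exists_smooth_retraction hι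
  have hρ : IsLipschitzRetraction ι ρ δ K := ⟨hδ, K.2, hρι, hρL⟩
  obtain ⟨b, hb⟩ := (isCompact_range hιc).isBounded.exists_norm_le
  have hb : ∀ q, ‖ι q‖ ≤ b := fun q => hb _ (mem_range_self q)
  have huE := energyOn_ne_top_of_memSobolev hn hs hec.measurable hu
  have hvE := energyOn_ne_top_of_memSobolev hn hs hec.measurable hv
  have : LocallyConnectedSpace S := ChartedSpace.locallyConnectedSpace (EuclideanSpace ℝ (Fin n)) S
  -- The manifold may be disconnected; values are compared only on a ball inside the component of
  -- `x₀`.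
  obtain ⟨R₀, hR₀, hR₀c⟩ := exists_embBall_subset he (x₀ := x₀)
    (isOpen_connectedComponent.mem_nhds mem_connectedComponent)
  obtain ⟨R₁, hR₁, hR₁R⟩ := exists_embBall_subset he (x₀ := x₀)
    (Metric.eball_mem_nhds x₀ (ENNReal.ofReal_pos.2 hR))
  obtain ⟨κ₀, hκ₀, hκ₀h⟩ := exists_ne_zero_forall_sobolevHomotopic hn hs hs1 hec.measurable hιc
    hvm hhom
  have key : ∀ κ : ℝ≥0∞, κ ≠ 0 → gagliardoEnergy n e s (n / s) (fun x => ι (u x)) ^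
      (1 / ((n : ℝ) / s)) ≤ gagliardoEnergy n e s (n / s) (fun x => ι (v x)) ^
      (1 / ((n : ℝ) / s)) + κ := by
    intro κ hκ
    obtain ⟨w, r, hr, hw, hwu, hwv, hwn⟩ := exists_glue_sobolevNorm_le hn hs hs1 he hA hρ hb hιc
      hum huE hvm hvE hR₀ (fun q q' hq hq' => chained_of_sobolevHomotopic hn hs hs1 he hA hρ hρs hb
        hιc hum huE hvm hvE hhom hR₀c hq hq') (κ := min 1 (min κ κ₀)) (by simp [hκ, hκ₀]) hR₁
    have hwn1 := hwn.trans (min_le_left _ _)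
    have hwn2 := hwn.trans ((min_le_right _ _).trans (min_le_left _ _))
    have hwn3 := hwn.trans ((min_le_right _ _).trans (min_le_right _ _))
    have hsum : (fun x => ι (w x)) = fun x => ι (v x) + (ι (w x) - ι (v x)) := by
      funext x; abel
    have hwv_m : Measurable fun x => ι (w x) - ι (v x) := hw.sub hvm
    have hwS : MemSobolev n e ι s (n / s) w := by
      refine ⟨hw.aestronglyMeasurable, ?_⟩
      rw [hsum]
      exact (sobolevNorm_add_le hn hs hs1 hec.measurable hvm hwv_m).trans_lt
        (ENNReal.add_lt_top.2 ⟨hv.2, hwn1.trans_lt ENNReal.one_lt_top⟩)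
    -- The gluing uses balls for the Euclidean distance, the hypothesis geodesic ones; they are
    -- nested because the topologies agree.
    obtain ⟨ε, hε, hεr⟩ : ∃ ε : ℝ, 0 < ε ∧
        Metric.eball x₀ (ENNReal.ofReal ε) ⊆ embBall e x₀ r := by
      have hop : embBall e x₀ r ∈ 𝓝 x₀ :=
        (isOpen_lt (hec.sub continuous_const).norm continuous_const).mem_nhds (by simpa using hr)
      obtain ⟨ε, hε, hsub⟩ := Metric.nhds_basis_eball.mem_iff.1 hop
      obtain ⟨ε', hε', hεε'⟩ := ENNReal.lt_iff_exists_real_btwn.1 hε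
      refine ⟨ε', ENNReal.ofReal_pos.1 hεε'.1, fun x hx => hsub ?_⟩
      exact lt_trans hx hεε'.2
    have hle := hmin ε hε w hwS (by
      filter_upwards [huv] with x hx hxs
      rcases hxs with hxs | hxs
      · exact (hwu x (hεr hxs)).symm
      · rw [hx hxs, hwv x fun hx' => hxs (hR₁R hx')]) (hκ₀h w hw hwn3)
    refine (ENNReal.rpow_le_rpow hle (by positivity)).trans ?_
    rw [gagliardoEnergy_eq_energyOn hs hec.measurable hw.aestronglyMeasurable,
      gagliardoEnergy_eq_energyOn hs hec.measurable hvm.aestronglyMeasurable]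
    -- Minkowski for `w = v + (w - v)`; the second term is at most the Sobolev norm of `w - v`.
    have hmink := energyOn_add_rpow_le (μ := (μHE[n] : Measure S)) (n := n) hec.measurable hp1 hvm
      hwv_m univ
    rw [← hsum] at hmink
    refine hmink.trans (add_le_add le_rfl (le_trans ?_ hwn2))
    rw [sobolevNorm_eq hs hec.measurable hwv_m.aestronglyMeasurable]
    exact le_add_self
  have hfin := ENNReal.le_of_forall_pos_le_add fun κ (hκ : (0 : NNReal) < κ) _ =>
    key κ (by exact_mod_cast hκ.ne')
  exact (ENNReal.rpow_le_rpow_iff (by positivity)).1 hfin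

end Main

end FracHarmonic

theorem mainTheorem6
    (n : ℕ) (hn : 1 ≤ n) (s : ℝ) (hs0 : 0 < s) (hs1 : s < 1)
    -- the closed Riemannian `n`-manifold `S` with its geodesic distance, embedded into `ℝ^L`
    {S : Type*} [EMetricSpace S] [CompactSpace S] [MeasurableSpace S] [BorelSpace S]
    [ChartedSpace (EuclideanSpace ℝ (Fin n)) S] [IsManifold (𝓡 n) ∞ S]
    [RiemannianBundle (fun x : S => TangentSpace (𝓡 n) x)]
    [IsContMDiffRiemannianBundle (𝓡 n) ∞ (EuclideanSpace ℝ (Fin n))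
      (fun x : S => TangentSpace (𝓡 n) x)]
    [IsRiemannianManifold (𝓡 n) S]
    (L : ℕ) (e : S → EuclideanSpace ℝ (Fin L)) (he : IsSmoothEmbedding (𝓡 n) (𝓡 L) ∞ e)
    -- the closed manifold `N`, embedded into `ℝ^M`
    (m : ℕ) {N : Type*} [TopologicalSpace N] [CompactSpace N]
    [ChartedSpace (EuclideanSpace ℝ (Fin m)) N] [IsManifold (𝓡 m) ∞ N]
    (M : ℕ) (ι : N → EuclideanSpace ℝ (Fin M)) (hι : IsSmoothEmbedding (𝓡 m) (𝓡 M) ∞ ι)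
    (x₀ : S) (R : ℝ) (hR : 0 < R)
    (u : S → N) (hu : FracHarmonic.MemSobolev n e ι s (n / s) u)
    -- `u` is minimizing in `B(x₀, R)` in homotopy away from the point `x₀`
    (hmin : ∀ ε : ℝ, 0 < ε → ∀ w : S → N, FracHarmonic.MemSobolev n e ι s (n / s) w →
      (∀ᵐ x ∂(μHE[n] : Measure S),
        x ∈ Metric.eball x₀ (ENNReal.ofReal ε) ∪ (Metric.eball x₀ (ENNReal.ofReal R))ᶜ →
          u x = w x) →
      FracHarmonic.SobolevHomotopic n m e ι s (n / s) u w →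
      FracHarmonic.gagliardoEnergy n e s (n / s) (fun x => ι (u x)) ≤
        FracHarmonic.gagliardoEnergy n e s (n / s) (fun x => ι (w x))) :
    ∀ v : S → N, FracHarmonic.MemSobolev n e ι s (n / s) v →
      (∀ᵐ x ∂(μHE[n] : Measure S), x ∈ (Metric.eball x₀ (ENNReal.ofReal R))ᶜ → u x = v x) →
      FracHarmonic.SobolevHomotopic n m e ι s (n / s) u v →
      FracHarmonic.gagliardoEnergy n e s (n / s) (fun x => ι (u x)) ≤
        FracHarmonic.gagliardoEnergy n e s (n / s) (fun x => ι (v x)) := by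
  intro v hv huv hhom
  have : Nonempty N := ⟨u x₀⟩
  have := FracHarmonic.isContinuousRiemannianBundle (n := n) (S := S)
  obtain ⟨c₀, C₀, hA, hfin⟩ := FracHarmonic.exists_isAhlfors he
  have : IsFiniteMeasure (μHE[n] : Measure S) := ⟨hfin⟩
  -- Energies, membership, the homotopy relation and the boundary conditions depend only on the maps
  -- almost everywhere, so both maps may be replaced by measurable representatives.
  obtain ⟨u', hu', hum⟩ := FracHarmonic.exists_measurable_representative hu.1
  obtain ⟨v', hv', hvm⟩ := FracHarmonic.exists_measurable_representative hv.1
  have hιu : (fun x => ι (u x)) =ᵐ[(μHE[n] : Measure S)] fun x => ι (u' x) := hu'.fun_comp ι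
  have hιv : (fun x => ι (v x)) =ᵐ[(μHE[n] : Measure S)] fun x => ι (v' x) := hv'.fun_comp ι
  rw [FracHarmonic.gagliardoEnergy_congr_ae hιu, FracHarmonic.gagliardoEnergy_congr_ae hιv]
  refine FracHarmonic.gagliardoEnergy_le_of_minimizing_away (x₀ := x₀) hn hs0 hs1 he hι hA hR hum
    (hu.congr_ae hu') (fun ε hε w hw huw hhw => ?_) hvm (hv.congr_ae hv') ?_
    (hhom.congr_ae hu' hv')
  · rw [← FracHarmonic.gagliardoEnergy_congr_ae hιu]
    refine hmin ε hε w hw ?_ (hhw.congr_ae hu'.symm EventuallyEq.rfl)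
    filter_upwards [huw, hu'] with x h1 h2 hx
    rw [h2, h1 hx]
  · filter_upwards [huv, hu', hv'] with x h1 h2 h3 hx
    rw [← h2, ← h3, h1 hx]
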